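/- Let $k$ be an algebraically closed field, let $w$ be an integer with $w \neq 0, 1$, and set $d = w-1$. Let $A = k[T]$ be the polynomial algebra, viewed as a DG algebra with $T$ in homological degree $d$ and zero differential. Let $\mathsf{D}(A)$ be the derived category of DG left $A$-modules with suspension $\Sigma$, and let $\mathsf{T} = \langle k \rangle$ be the thick subcategory of $\mathsf{D}(A)$ generated by the trivial DG module $k = A/(T)$. (This is the $k$-linear algebraic, idempotent complete triangulated category classically generated by a $w$-spherical object.) The Auslander-Reiten (AR) quiver of $\mathsf{T}$ has the isomorphism classes of indecomposable objects as vertices, with an arrow from $x$ to $y$ if there is an irreducible morphism $x \to y$ in $\mathsf{T}$. Each of its components is isomorphic to $\mathbb{Z}A_\infty$, the quiver with vertices $(n,r)$ for $n \in \mathbb{Z}$, $r \in \mathbb{Z}_{\geq 0}$, and with arrows $(n,r) \to (n,r+1)$ and $(n,r+1) \to (n+1,r)$. For an indecomposable object $t$ of $\mathsf{T}$, identify its component with $\mathbb{Z}A_\infty$, let $t$ correspond to $(n,r)$, and let $F^+(t)$ and $F^-(t)$ be the sets of indecomposable objects of the component (up to isomorphism) corresponding to the vertices in the rectangles $$\{\,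 (n+j,\; r-j+m) \mid 0 \leq j \leq r,\ m \geq 0 \,\} \quad \text{and} \quad \{\, (n-m,\; r-j+m) \mid 0 \leq j \leq r,\ m \geq 0 \,\},$$ respectively. (The identification is unique up to translation in the first coordinate, so these sets do not depend on it.) Let $t, u$ be indecomposable objects in $\mathsf{T}$. Then $$\dim_k \mathsf{T}(t,u) = \begin{cases} 1 & \text{for } u \in F^+(t) \cup F^-(St), \\ 0 & \text{otherwise,} \end{cases}$$ where $S = \Sigma^w$. -/

import Mathlib

universe u v

namespace SphericalAR

open CategoryTheory CategoryTheory.Limits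

noncomputable section

/-! ### Differential graded modules over `k[T]`

`A = k[T]` is the polynomial algebra, viewed as a DG algebra with `T` in homological degree `d` and
zero differential.  Its component of degree `j` is spanned by the `T ^ n` with `n * d = j`. -/

/-- The sign `(-1) ^ n` as an element of `k`. -/
def sgn (k : Type u) [Field k] (n : ℤ) : k := ((n.negOnePow : ℤ) : k)

section Sign

variable (k : Type u) [Field k]

@[simp] lemma sgn_zero : sgn k 0 = 1 := by simp [sgn]

lemma sgn_add (m n : ℤ) : sgn k (m + n) = sgn k m * sgn k n := by
  simp [sgn, Int.negOnePow_add]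

@[simp] lemma sgn_mul_self (n : ℤ) : sgn k n * sgn k n = 1 := by
  rw [← sgn_add, sgn, Int.negOnePow_even _ ⟨n, rfl⟩]; simp

@[simp] lemma sgn_smul_sgn_smul {V : Type v} [AddCommGroup V] [Module k V] (n : ℤ) (x : V) :
    sgn k n • sgn k n • x = x := by
  rw [smul_smul, sgn_mul_self, one_smul]

lemma sgn_ne_zero (n : ℤ) : sgn k n ≠ 0 := fun h => by
  have := sgn_mul_self k n
  simp [h] at this

end Sign

section Internal

variable {k : Type u} [Field k] {V W : Type v} [AddCommGroup V] [Module k V]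
  [AddCommGroup W] [Module k W]

lemma isInternal_reindex {A : ℤ → Submodule k V} (hA : DirectSum.IsInternal A) (n : ℤ) :
    DirectSum.IsInternal (fun i => A (i - n)) := by
  rw [DirectSum.isInternal_submodule_iff_iSupIndep_and_iSup_eq_top] at hA ⊢
  refine ⟨hA.1.comp (f := fun i => i - n) (sub_left_injective (b := n)), ?_⟩
  rw [← hA.2]
  exact (Equiv.subRight n).iSup_comp (g := A)

lemma isInternal_prod {A : ℤ → Submodule k V} {B : ℤ → Submodule k W}
    (hA : DirectSum.IsInternal A) (hB : DirectSum.IsInternal B) :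
    DirectSum.IsInternal (fun i => (A i).prod (B i)) := by
  rw [DirectSum.isInternal_submodule_iff_iSupIndep_and_iSup_eq_top] at hA hB ⊢
  refine ⟨fun i => ?_, ?_⟩
  · have hle : (⨆ j, ⨆ (_ : j ≠ i), (A j).prod (B j)) ≤
        (⨆ j, ⨆ (_ : j ≠ i), A j).prod (⨆ j, ⨆ (_ : j ≠ i), B j) :=
      iSup₂_le fun j hj => Submodule.prod_mono
        (le_iSup₂ (f := fun j (_ : j ≠ i) => A j) j hj)
        (le_iSup₂ (f := fun j (_ : j ≠ i) => B j) j hj)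
    refine Disjoint.mono_right hle ?_
    rw [Submodule.disjoint_def]
    rintro ⟨x, y⟩ ⟨hx, hy⟩ ⟨hx', hy'⟩
    exact Prod.ext (Submodule.disjoint_def.1 (hA.1 i) x hx hx')
      (Submodule.disjoint_def.1 (hB.1 i) y hy hy')
  · rw [eq_top_iff]
    rintro ⟨x, y⟩ -
    have hx : LinearMap.inl k V W x ∈ ⨆ i, (A i).prod (B i) := by
      have h : (⊤ : Submodule k V) ≤ (⨆ i, (A i).prod (B i)).comap (LinearMap.inl k V W) := by
        rw [← hA.2]
        refine iSup_le fun i a ha => ?_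
        exact Submodule.mem_iSup_of_mem (p := fun i => (A i).prod (B i)) i
          ⟨ha, Submodule.zero_mem _⟩
      exact h trivial
    have hy : LinearMap.inr k V W y ∈ ⨆ i, (A i).prod (B i) := by
      have h : (⊤ : Submodule k W) ≤ (⨆ i, (A i).prod (B i)).comap (LinearMap.inr k V W) := by
        rw [← hB.2]
        refine iSup_le fun i a ha => ?_
        exact Submodule.mem_iSup_of_mem (p := fun i => (A i).prod (B i)) i
          ⟨Submodule.zero_mem _, ha⟩
      exact h trivial
    simpa using Submodule.add_mem _ hx hy

end Internal

/-- A DG left module over `A = k[T]`, where `T` has homological degree `d` and `∂_A = 0`: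
a `k`-vector space with a grading `M = ⨁ i, M i`, a differential of degree `-1`, and a left
`k[T]`-action, recorded by the operator `T`, which has degree `d` and satisfies the Leibniz rule
`∂ (T x) = (-1) ^ d T (∂ x)`.  See `DGMod.act`, `DGMod.act_mem` and `DGMod.diff_act` for the action
of all of `k[T]`. -/
structure DGMod (k : Type u) [Field k] (d : ℤ) where
  carrier : Type u
  [addCommGroup : AddCommGroup carrier]
  [module : Module k carrier]
  /-- the homogeneous components -/
  gr : ℤ → Submodule k carrier
  isInternal : DirectSum.IsInternal gr
  /-- the differential -/
  diff : carrier →ₗ[k] carrier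
  /-- the action of `T` -/
  T : carrier →ₗ[k] carrier
  diff_mem : ∀ {i : ℤ} {x : carrier}, x ∈ gr i → diff x ∈ gr (i - 1)
  T_mem : ∀ {i : ℤ} {x : carrier}, x ∈ gr i → T x ∈ gr (i + d)
  diff_diff : ∀ x, diff (diff x) = 0
  diff_T : ∀ x, diff (T x) = sgn k d • T (diff x)

attribute [instance] DGMod.addCommGroup DGMod.module
attribute [simp] DGMod.diff_diff

namespace DGMod

variable {k : Type u} [Field k] {d : ℤ}

/-- The left `k[T]`-module structure of a DG module. -/
def act (M : DGMod k d) : Polynomial k →ₐ[k] Module.End k M.carrier := Polynomial.aeval M.T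

lemma act_monomial (M : DGMod k d) (n : ℕ) (c : k) (x : M.carrier) :
    M.act (Polynomial.monomial n c) x = c • (M.T ^ n) x := by
  simp [act, Polynomial.aeval_monomial]

/-- `A` acts by a graded action: `A_{n d} M_i ⊆ M_{i + n d}`. -/
lemma act_mem (M : DGMod k d) (n : ℕ) (c : k) {i : ℤ} {x : M.carrier} (hx : x ∈ M.gr i) :
    M.act (Polynomial.monomial n c) x ∈ M.gr (i + n * d) := by
  rw [act_monomial]
  refine Submodule.smul_mem _ _ ?_
  induction n with
  | zero => simpa using hx
  | succ n ih =>
    rw [pow_succ', Module.End.mul_apply]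
    have := M.T_mem ih
    push_cast
    rwa [show i + ((n : ℤ) + 1) * d = i + n * d + d by ring]

/-- The Leibniz rule for all homogeneous elements of `A`. -/
lemma diff_act (M : DGMod k d) (n : ℕ) (c : k) (x : M.carrier) :
    M.diff (M.act (Polynomial.monomial n c) x) =
      sgn k (n * d) • M.act (Polynomial.monomial n c) (M.diff x) := by
  rw [act_monomial, act_monomial, map_smul, smul_comm (sgn k (n * d)) c]
  congr 1
  induction n with
  | zero => simp
  | succ n ih =>
    rw [pow_succ', Module.End.mul_apply, Module.End.mul_apply, M.diff_T, ih, map_smul, smul_smul,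
      ← sgn_add]
    push_cast
    rw [show d + (n : ℤ) * d = ((n : ℤ) + 1) * d by ring]

/-- Morphisms of DG modules: `A`-linear maps of degree `0` commuting with the differentials. -/
def homSubmodule (M N : DGMod k d) : Submodule k (M.carrier →ₗ[k] N.carrier) where
  carrier := {f | (∀ i, ∀ x ∈ M.gr i, f x ∈ N.gr i) ∧ (∀ x, f (M.T x) = N.T (f x)) ∧
    ∀ x, f (M.diff x) = N.diff (f x)}
  add_mem' := by
    rintro f g ⟨hf, hf', hf''⟩ ⟨hg, hg', hg''⟩
    exact ⟨fun i x hx => Submodule.add_mem _ (hf i x hx) (hg i x hx),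
      fun x => by simp [hf', hg'], fun x => by simp [hf'', hg'']⟩
  zero_mem' := ⟨fun i x _ => Submodule.zero_mem _, fun x => by simp, fun x => by simp⟩
  smul_mem' := by
    rintro a f ⟨hf, hf', hf''⟩
    exact ⟨fun i x hx => Submodule.smul_mem _ _ (hf i x hx),
      fun x => by simp [hf'], fun x => by simp [hf'']⟩

instance : Category.{u} (DGMod k d) where
  Hom M N := homSubmodule M N
  id M := ⟨LinearMap.id, fun _ _ hx => hx, fun _ => rfl, fun _ => rfl⟩
  comp f g := ⟨g.1.comp f.1, fun i x hx => g.2.1 i _ (f.2.1 i x hx),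
    fun x => by simp [f.2.2.1, g.2.2.1], fun x => by simp [f.2.2.2, g.2.2.2]⟩

/-- The underlying linear map of a morphism. -/
def lin {M N : DGMod k d} (f : M ⟶ N) : M.carrier →ₗ[k] N.carrier :=
  (show homSubmodule M N from f).1

/-- Constructor for morphisms. -/
def mkHom {M N : DGMod k d} (f : M.carrier →ₗ[k] N.carrier)
    (h₁ : ∀ i, ∀ x ∈ M.gr i, f x ∈ N.gr i) (h₂ : ∀ x, f (M.T x) = N.T (f x))
    (h₃ : ∀ x, f (M.diff x) = N.diff (f x)) : M ⟶ N :=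
  (⟨f, h₁, h₂, h₃⟩ : homSubmodule M N)

lemma lin_mem {M N : DGMod k d} (f : M ⟶ N) {i : ℤ} {x : M.carrier} (hx : x ∈ M.gr i) :
    lin f x ∈ N.gr i := (show homSubmodule M N from f).2.1 i x hx

lemma lin_T {M N : DGMod k d} (f : M ⟶ N) (x : M.carrier) : lin f (M.T x) = N.T (lin f x) :=
  (show homSubmodule M N from f).2.2.1 x

lemma lin_diff {M N : DGMod k d} (f : M ⟶ N) (x : M.carrier) :
    lin f (M.diff x) = N.diff (lin f x) :=
  (show homSubmodule M N from f).2.2.2 x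

lemma hom_ext {M N : DGMod k d} {f g : M ⟶ N} (h : ∀ x, lin f x = lin g x) : f = g :=
  Subtype.ext (LinearMap.ext h)

instance (M N : DGMod k d) : AddCommGroup (M ⟶ N) :=
  inferInstanceAs (AddCommGroup (homSubmodule M N))

instance (M N : DGMod k d) : Module k (M ⟶ N) :=
  inferInstanceAs (Module k (homSubmodule M N))

@[simp] lemma lin_mkHom {M N : DGMod k d} (f : M.carrier →ₗ[k] N.carrier) (h₁ h₂ h₃) :
    lin (mkHom (M := M) (N := N) f h₁ h₂ h₃) = f := rfl

@[simp] lemma lin_id (M : DGMod k d) : lin (𝟙 M) = LinearMap.id := rfl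

@[simp] lemma lin_comp {M N P : DGMod k d} (f : M ⟶ N) (g : N ⟶ P) :
    lin (f ≫ g) = (lin g).comp (lin f) := rfl

@[simp] lemma lin_add {M N : DGMod k d} (f g : M ⟶ N) : lin (f + g) = lin f + lin g := rfl

@[simp] lemma lin_smul {M N : DGMod k d} (a : k) (f : M ⟶ N) : lin (a • f) = a • lin f := rfl

instance : Preadditive (DGMod k d) where
  add_comp _ _ _ f g h := hom_ext fun x => by simp
  comp_add _ _ _ f g h := hom_ext fun x => by simp

instance : Linear k (DGMod k d) where
  smul_comp _ _ _ a f g := hom_ext fun x => by simp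
  comp_smul _ _ _ f a g := hom_ext fun x => by simp

/-- The `n`-fold suspension `Σ ^ n M`: one has `(Σ ^ n M)_i = M_{i - n}`, the differential is
multiplied by `(-1) ^ n`, and a homogeneous `a` in `A` acts with the additional sign
`(-1) ^ (n |a|)`. -/
abbrev shift (n : ℤ) (M : DGMod k d) : DGMod k d where
  carrier := M.carrier
  gr i := M.gr (i - n)
  isInternal := isInternal_reindex M.isInternal n
  diff := sgn k n • M.diff
  T := sgn k (n * d) • M.T
  diff_mem {i x} hx := by
    have := Submodule.smul_mem _ (sgn k n) (M.diff_mem hx)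
    rwa [show i - n - 1 = i - 1 - n by ring] at this
  T_mem {i x} hx := by
    have := Submodule.smul_mem _ (sgn k (n * d)) (M.T_mem hx)
    rwa [show i - n + d = i + d - n by ring] at this
  diff_diff x := by simp
  diff_T x := by
    simp only [LinearMap.smul_apply, map_smul, M.diff_T, smul_smul]
    congr 1
    ring

/-- The mapping cone of a morphism `f : M ⟶ N` of DG modules, that is `N ⊕ Σ M` with the
differential `(y, x) ↦ (∂ y + f x, - ∂ x)`. -/
abbrev cone {M N : DGMod k d} (f : M ⟶ N) : DGMod k d where
  carrier := N.carrier × M.carrier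
  gr i := (N.gr i).prod (M.gr (i - 1))
  isInternal := isInternal_prod N.isInternal (isInternal_reindex M.isInternal 1)
  diff := (N.diff.comp (LinearMap.fst k _ _) + (lin f).comp (LinearMap.snd k _ _)).prod
    (-(M.diff.comp (LinearMap.snd k _ _)))
  T := (N.T.comp (LinearMap.fst k _ _)).prod (sgn k d • (M.T.comp (LinearMap.snd k _ _)))
  diff_mem {i x} hx := ⟨Submodule.add_mem _ (N.diff_mem hx.1) (lin_mem f hx.2),
    Submodule.neg_mem _ (M.diff_mem hx.2)⟩
  T_mem {i x} hx := by
    refine ⟨N.T_mem hx.1, Submodule.smul_mem _ _ ?_⟩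
    have := M.T_mem hx.2
    rwa [show i - 1 + d = i + d - 1 by ring] at this
  diff_diff x := by
    simp [lin_diff]
  diff_T x := by
    simp [lin_T, N.diff_T, M.diff_T, smul_add]

/-- The direct sum of two DG modules. -/
abbrev prod (M N : DGMod k d) : DGMod k d where
  carrier := M.carrier × N.carrier
  gr i := (M.gr i).prod (N.gr i)
  isInternal := isInternal_prod M.isInternal N.isInternal
  diff := M.diff.prodMap N.diff
  T := M.T.prodMap N.T
  diff_mem hx := ⟨M.diff_mem hx.1, N.diff_mem hx.2⟩
  T_mem hx := ⟨M.T_mem hx.1, N.T_mem hx.2⟩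
  diff_diff x := by simp
  diff_T x := by simp [M.diff_T, N.diff_T]

/-- The trivial DG module `k = A / (T)`, concentrated in degree `0`. -/
abbrev trivial (k : Type u) [Field k] (d : ℤ) : DGMod k d where
  carrier := k
  gr i := if i = 0 then ⊤ else ⊥
  isInternal := by
    rw [DirectSum.isInternal_submodule_iff_iSupIndep_and_iSup_eq_top]
    refine ⟨fun i => ?_, ?_⟩
    · by_cases hi : i = 0
      · have : (⨆ j, ⨆ (_ : j ≠ i), (if j = 0 then ⊤ else ⊥ : Submodule k k)) = ⊥ := by
          subst hi
          simp only [iSup_eq_bot]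
          intro j hj
          simp [hj]
        rw [this]
        exact disjoint_bot_right
      · simp [hi]
    · exact eq_top_iff.2 (le_iSup_of_le 0 (by simp))
  diff := 0
  T := 0
  diff_mem _ := Submodule.zero_mem _
  T_mem _ := Submodule.zero_mem _
  diff_diff _ := rfl
  diff_T _ := by simp

/-! ### Homology and homotopy -/

/-- The boundaries, as a subspace of the space of cycles. -/
def boundaries (M : DGMod k d) : Submodule k (LinearMap.ker M.diff) :=
  (LinearMap.range M.diff).comap (LinearMap.ker M.diff).subtype

/-- The map induced on cycles. -/
def cyclesMap {M N : DGMod k d} (f : M ⟶ N) :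
    LinearMap.ker M.diff →ₗ[k] LinearMap.ker N.diff :=
  (lin f).restrict fun x hx => by
    rw [LinearMap.mem_ker] at hx ⊢
    rw [← lin_diff, hx, map_zero]

lemma boundaries_le_comap {M N : DGMod k d} (f : M ⟶ N) :
    M.boundaries ≤ N.boundaries.comap (cyclesMap f) := by
  rintro ⟨x, hx⟩ ⟨y, hy⟩
  exact ⟨lin f y, by rw [← lin_diff, hy]; rfl⟩

/-- The (total) homology `H(M) = Ker ∂ / Im ∂ = ⨁ i, H_i(M)` as a functor. -/
def homology (k : Type u) [Field k] (d : ℤ) : DGMod k d ⥤ ModuleCat.{u} k where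
  obj M := ModuleCat.of k (LinearMap.ker M.diff ⧸ M.boundaries)
  map f := ModuleCat.ofHom (Submodule.mapQ _ _ (cyclesMap f) (boundaries_le_comap f))
  map_id M := by
    ext x
    rfl
  map_comp f g := by
    ext x
    rfl

/-- Two morphisms `f g : M ⟶ N` are homotopic if `f - g = ∂ h + h ∂` for an `A`-linear map `h` of
degree `1`, i.e. one with `h (a x) = (-1) ^ |a| a h(x)`. -/
def homotopic (k : Type u) [Field k] (d : ℤ) : HomRel (DGMod k d) := fun M N f g =>
  ∃ h : M.carrier →ₗ[k] N.carrier, (∀ i, ∀ x ∈ M.gr i, h x ∈ N.gr (i + 1)) ∧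
    (∀ x, h (M.T x) = sgn k d • N.T (h x)) ∧
    ∀ x, lin f x - lin g x = N.diff (h x) + h (M.diff x)

lemma homotopic_add {M N : DGMod k d} {f f' g g' : M ⟶ N} (hf : homotopic k d f f')
    (hg : homotopic k d g g') : homotopic k d (f + g) (f' + g') := by
  obtain ⟨h, h1, h2, h3⟩ := hf
  obtain ⟨l, l1, l2, l3⟩ := hg
  refine ⟨h + l, fun i x hx => Submodule.add_mem _ (h1 i x hx) (l1 i x hx),
    fun x => by simp [h2, l2], fun x => ?_⟩
  have := congrArg₂ (· + ·) (h3 x) (l3 x)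
  simp only [lin_add, LinearMap.add_apply, map_add] at this ⊢
  rw [add_sub_add_comm, this]
  abel

lemma homotopic_smul {M N : DGMod k d} (a : k) {f f' : M ⟶ N} (hf : homotopic k d f f') :
    homotopic k d (a • f) (a • f') := by
  obtain ⟨h, h1, h2, h3⟩ := hf
  refine ⟨a • h, fun i x hx => Submodule.smul_mem _ _ (h1 i x hx),
    fun x => by simp [h2, smul_comm a], fun x => ?_⟩
  simp only [lin_smul, LinearMap.smul_apply, map_smul, ← smul_add, ← smul_sub, h3]

instance : Congruence (homotopic k d) where
  equivalence {M N} :=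
    { refl := fun f => ⟨0, fun _ _ _ => Submodule.zero_mem _, fun x => by simp, fun x => by simp⟩
      symm := by
        rintro f g ⟨h, h1, h2, h3⟩
        refine ⟨-h, fun i x hx => Submodule.neg_mem _ (h1 i x hx), fun x => by simp [h2],
          fun x => ?_⟩
        rw [← neg_sub, h3]
        simp [add_comm]
      trans := by
        rintro f g l ⟨h, h1, h2, h3⟩ ⟨h', h1', h2', h3'⟩
        refine ⟨h + h', fun i x hx => Submodule.add_mem _ (h1 i x hx) (h1' i x hx),
          fun x => by simp [h2, h2'], fun x => ?_⟩
        rw [← sub_add_sub_cancel _ (lin g x), h3, h3']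
        simp only [LinearMap.add_apply, map_add]
        abel }
  comp_left {M N P} f g g' := by
    rintro ⟨h, h1, h2, h3⟩
    refine ⟨h.comp (lin f), fun i x hx => h1 _ _ (lin_mem f hx), fun x => by simp [h2, lin_T],
      fun x => ?_⟩
    simp [h3, lin_diff]
  comp_right {M N P} f f' g := by
    rintro ⟨h, h1, h2, h3⟩
    refine ⟨(lin g).comp h, fun i x hx => lin_mem g (h1 _ _ hx), fun x => by simp [h2, lin_T],
      fun x => ?_⟩
    simp only [lin_comp, LinearMap.comp_apply, ← map_sub, h3, map_add, lin_diff]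

lemma homology_map_eq {M N : DGMod k d} {f g : M ⟶ N} (h : homotopic k d f g) :
    (homology k d).map f = (homology k d).map g := by
  obtain ⟨h, -, -, h3⟩ := h
  ext x
  obtain ⟨⟨x, hx⟩, rfl⟩ := Submodule.Quotient.mk_surjective _ x
  refine (Submodule.Quotient.eq _).2 ⟨h x, ?_⟩
  have := h3 x
  rw [LinearMap.mem_ker.1 hx, map_zero, add_zero] at this
  exact this.symm

/-- A morphism is a quasi-isomorphism iff it is injective and surjective on homology. -/
lemma isIso_homology_map_iff {M N : DGMod k d} (f : M ⟶ N) :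
    IsIso ((homology k d).map f) ↔
      (∀ x, M.diff x = 0 → (∃ y, N.diff y = lin f x) → ∃ z, M.diff z = x) ∧
      (∀ y, N.diff y = 0 → ∃ x z, M.diff x = 0 ∧ N.diff z = lin f x - y) := by
  rw [ConcreteCategory.isIso_iff_bijective]
  refine and_congr ?_ ?_
  · refine (injective_iff_map_eq_zero (((homology k d).map f).hom)).trans ⟨fun h x hx hy => ?_, ?_⟩
    · have := h (Submodule.Quotient.mk ⟨x, hx⟩) ((Submodule.Quotient.mk_eq_zero _).2 hy)
      exact (Submodule.Quotient.mk_eq_zero _).1 this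
    · intro h x hx
      obtain ⟨⟨x, hx'⟩, rfl⟩ := Submodule.Quotient.mk_surjective _ x
      exact (Submodule.Quotient.mk_eq_zero _).2
        (h x hx' ((Submodule.Quotient.mk_eq_zero _).1 hx))
  · constructor
    · intro h y hy
      obtain ⟨x, hx⟩ := h (Submodule.Quotient.mk ⟨y, hy⟩)
      obtain ⟨⟨x, hx'⟩, rfl⟩ := Submodule.Quotient.mk_surjective _ x
      obtain ⟨z, hz⟩ := (Submodule.Quotient.eq _).1 hx
      exact ⟨x, z, hx', hz⟩
    · intro h y
      obtain ⟨⟨y, hy⟩, rfl⟩ := Submodule.Quotient.mk_surjective _ y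
      obtain ⟨x, z, hx, hz⟩ := h y hy
      exact ⟨Submodule.Quotient.mk ⟨x, hx⟩, (Submodule.Quotient.eq _).2 ⟨z, hz⟩⟩

/-- The suspension as a functor. -/
def shiftFunctor (k : Type u) [Field k] (d n : ℤ) : DGMod k d ⥤ DGMod k d where
  obj M := shift n M
  map {M N} f := mkHom (M := shift n M) (N := shift n N) (lin (M := M) (N := N) f) (fun _ _ hx => lin_mem f hx)
    (fun (x : M.carrier) => show lin f (sgn k (n * d) • M.T x) = sgn k (n * d) • N.T (lin f x) by
      rw [map_smul, lin_T])
    (fun (x : M.carrier) => show lin f (sgn k n • M.diff x) = sgn k n • N.diff (lin f x) by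
      rw [map_smul, lin_diff])
  map_id _ := rfl
  map_comp _ _ := rfl

lemma homotopic_shift (n : ℤ) {M N : DGMod k d} {f g : M ⟶ N} (h : homotopic k d f g) :
    homotopic k d ((shiftFunctor k d n).map f) ((shiftFunctor k d n).map g) := by
  obtain ⟨h, h1, h2, h3⟩ := h
  refine ⟨sgn k n • h, fun i x hx => ?_, fun (x : M.carrier) =>
    show sgn k n • h (sgn k (n * d) • M.T x) = sgn k d • sgn k (n * d) • N.T (sgn k n • h x) from ?_,
    fun (x : M.carrier) => show lin f x - lin g x =
      sgn k n • N.diff (sgn k n • h x) + sgn k n • h (sgn k n • M.diff x) from ?_⟩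
  · have := Submodule.smul_mem _ (sgn k n) (h1 _ _ hx)
    rwa [show i - n + 1 = i + 1 - n by ring] at this
  · simp only [map_smul, h2, smul_smul]
    congr 1
    ring
  · simp [h3]

lemma isIso_homology_shift (n : ℤ) {M N : DGMod k d} (f : M ⟶ N)
    (hf : IsIso ((homology k d).map f)) :
    IsIso ((homology k d).map ((shiftFunctor k d n).map f)) := by
  rw [isIso_homology_map_iff] at hf ⊢
  have key : ∀ (P : DGMod k d) (x y : P.carrier),
      sgn k n • P.diff x = y ↔ P.diff (sgn k n • x) = y := fun P x y => by rw [map_smul]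
  refine ⟨fun x (hx : sgn k n • M.diff x = 0) => ?_, fun y (hy : sgn k n • N.diff y = 0) => ?_⟩
  · rintro ⟨y, hy⟩
    obtain ⟨z, hz⟩ := hf.1 x ((smul_eq_zero.1 hx).resolve_left (sgn_ne_zero k n))
      ⟨sgn k n • y, (key N _ _).1 hy⟩
    exact ⟨sgn k n • z, (key M _ _).2 (by rw [sgn_smul_sgn_smul, hz])⟩
  · obtain ⟨x, z, hx, hz⟩ := hf.2 y ((smul_eq_zero.1 hy).resolve_left (sgn_ne_zero k n))
    refine ⟨x, sgn k n • z, ?_, (key N _ _).2 (by rw [sgn_smul_sgn_smul, hz]; rfl)⟩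
    change sgn k n • M.diff x = 0
    rw [hx, smul_zero]

end DGMod

/-! ### The homotopy category and the derived category -/

/-- The homotopy category `K(A)` of DG left `A`-modules. -/
abbrev HoCat (k : Type u) [Field k] (d : ℤ) := CategoryTheory.Quotient (DGMod.homotopic k d)

namespace HoCat

variable (k : Type u) [Field k] (d : ℤ)

/-- The projection to the homotopy category. -/
abbrev proj : DGMod k d ⥤ HoCat k d := Quotient.functor _

instance : Preadditive (HoCat k d) :=
  Quotient.preadditive _ fun _ _ _ _ _ _ h h' => DGMod.homotopic_add h h'

instance : (proj k d).Additive :=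
  Quotient.functor_additive _ fun _ _ _ _ _ _ h h' => DGMod.homotopic_add h h'

instance : Linear k (HoCat k d) :=
  Quotient.linear k _ fun a _ _ _ _ h => DGMod.homotopic_smul a h

/-- Homology as a functor on the homotopy category. -/
def homology : HoCat k d ⥤ ModuleCat.{u} k :=
  CategoryTheory.Quotient.lift _ (DGMod.homology k d) fun _ _ _ _ h => DGMod.homology_map_eq h

/-- The quasi-isomorphisms in `K(A)`. -/
def qis : MorphismProperty (HoCat k d) :=
  (MorphismProperty.isomorphisms (ModuleCat.{u} k)).inverseImage (homology k d)

variable {k d}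

lemma qis_proj_map_iff {M N : DGMod k d} (f : M ⟶ N) :
    qis k d ((proj k d).map f) ↔
      (∀ x, M.diff x = 0 → (∃ y, N.diff y = DGMod.lin f x) → ∃ z, M.diff z = x) ∧
      (∀ y, N.diff y = 0 → ∃ x z, M.diff x = 0 ∧ N.diff z = DGMod.lin f x - y) :=
  DGMod.isIso_homology_map_iff f

instance : (qis k d).IsMultiplicative := by
  unfold qis; infer_instance

lemma exists_ore_square {X' X Y : DGMod k d} (s : X' ⟶ X) (f : X' ⟶ Y)
    (hs : qis k d ((proj k d).map s)) :
    ∃ (Z : DGMod k d) (g : X ⟶ Z) (t : Y ⟶ Z),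
      qis k d ((proj k d).map t) ∧ DGMod.homotopic k d (f ≫ t) (s ≫ g) := by
  rw [qis_proj_map_iff] at hs
  let l : X' ⟶ DGMod.prod Y X := DGMod.mkHom (N := DGMod.prod Y X)
    ((DGMod.lin f).prod (DGMod.lin s))
    (fun _ _ hx => ⟨DGMod.lin_mem f hx, DGMod.lin_mem s hx⟩)
    (fun _ => Prod.ext (DGMod.lin_T f _) (DGMod.lin_T s _))
    (fun _ => Prod.ext (DGMod.lin_diff f _) (DGMod.lin_diff s _))
  let Z := DGMod.cone l
  have hZ : ∀ (y : Y.carrier) (x : X.carrier) (x' : X'.carrier),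
      Z.diff ((y, x), x') =
        ((Y.diff y + DGMod.lin f x', X.diff x + DGMod.lin s x'), -X'.diff x') :=
    fun _ _ _ => rfl
  have hT : ∀ (y : Y.carrier) (x : X.carrier) (x' : X'.carrier),
      Z.T ((y, x), x') = ((Y.T y, X.T x), sgn k d • X'.T x') := fun _ _ _ => rfl
  let t : Y ⟶ Z := DGMod.mkHom (N := Z)
    ((LinearMap.inl k (Y.carrier × X.carrier) X'.carrier).comp (LinearMap.inl k _ _))
    (fun _ _ hx => ⟨⟨hx, Submodule.zero_mem _⟩, Submodule.zero_mem _⟩)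
    (fun y => ((hT y 0 0).trans (by simp)).symm) (fun y => ((hZ y 0 0).trans (by simp)).symm)
  let g : X ⟶ Z := DGMod.mkHom (N := Z)
    (-((LinearMap.inl k (Y.carrier × X.carrier) X'.carrier).comp (LinearMap.inr k _ _)))
    (fun _ _ hx => Submodule.neg_mem _ ⟨⟨Submodule.zero_mem _, hx⟩, Submodule.zero_mem _⟩)
    (fun x => ((hT (-0) (-x) (-0)).trans (by simp)).symm)
    (fun x => ((hZ (-0) (-x) (-0)).trans (by simp)).symm)
  have ht : ∀ y, DGMod.lin t y = ((y, 0), 0) := fun _ => rfl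
  refine ⟨Z, g, t, ?_, ?_⟩
  · rw [qis_proj_map_iff]
    constructor
    · rintro y hy ⟨⟨⟨y', x⟩, x'⟩, h⟩
      rw [hZ, ht, Prod.mk.injEq, Prod.mk.injEq, neg_eq_zero] at h
      obtain ⟨⟨h1, h2⟩, h3⟩ := h
      obtain ⟨z, rfl⟩ := hs.1 x' h3 ⟨-x, by rw [map_neg, eq_comm, eq_neg_iff_add_eq_zero, add_comm, h2]⟩
      exact ⟨y' + DGMod.lin f z, by rw [map_add, ← DGMod.lin_diff, h1]⟩
    · rintro ⟨⟨y, x⟩, x'⟩ h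
      rw [hZ, Prod.mk_eq_zero, Prod.mk_eq_zero, neg_eq_zero] at h
      obtain ⟨⟨h1, h2⟩, h3⟩ := h
      obtain ⟨z, rfl⟩ := hs.1 x' h3 ⟨-x, by rw [map_neg, eq_comm, eq_neg_iff_add_eq_zero, add_comm, h2]⟩
      obtain ⟨c, b, hc, hb⟩ := hs.2 (x + DGMod.lin s z)
        (by rw [map_add, ← DGMod.lin_diff, h2])
      refine ⟨y + DGMod.lin f (z - c), ((0, b), z - c), ?_, ?_⟩
      · rw [map_add, ← DGMod.lin_diff, map_sub, hc, sub_zero, h1]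
      · rw [hZ, ht, hb, map_sub, map_sub, map_sub, hc]
        refine Prod.ext (Prod.ext ?_ ?_) ?_
        · change Y.diff 0 + (DGMod.lin f z - DGMod.lin f c) =
            y + (DGMod.lin f z - DGMod.lin f c) - y
          rw [map_zero, zero_add, add_sub_cancel_left]
        · change DGMod.lin s c - (x + DGMod.lin s z) + (DGMod.lin s z - DGMod.lin s c) = 0 - x
          abel
        · change -(X'.diff z - 0) = 0 - X'.diff z
          rw [sub_zero, zero_sub]
  · refine ⟨LinearMap.inr k (Y.carrier × X.carrier) X'.carrier, fun i x hx =>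
      ⟨Submodule.zero_mem _, ?_⟩, fun x => ?_, fun x => ?_⟩
    · change x ∈ X'.gr (i + 1 - 1)
      rwa [add_sub_cancel_right]
    · refine Eq.trans ?_ (congrArg (fun z => sgn k d • z) (hT 0 0 x).symm)
      refine Prod.ext (Prod.ext ?_ ?_) ?_
      · change (0 : Y.carrier) = sgn k d • Y.T 0
        rw [map_zero, smul_zero]
      · change (0 : X.carrier) = sgn k d • X.T 0
        rw [map_zero, smul_zero]
      · exact (sgn_smul_sgn_smul k d _).symm
    · refine Eq.trans ?_ (congrArg (fun z => z + _) (hZ 0 0 x).symm)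
      refine Prod.ext (Prod.ext ?_ ?_) ?_
      · change DGMod.lin f x - -0 = Y.diff 0 + DGMod.lin f x + 0
        simp
      · change 0 - -DGMod.lin s x = X.diff 0 + DGMod.lin s x + 0
        simp
      · change (0 : X'.carrier) - -0 = -X'.diff x + X'.diff x
        simp

lemma exists_coequalizing {X' X Y : DGMod k d} (s : X' ⟶ X) (f g : X ⟶ Y)
    (hs : qis k d ((proj k d).map s)) (hfg : DGMod.homotopic k d (s ≫ f) (s ≫ g)) :
    ∃ (Z : DGMod k d) (t : Y ⟶ Z),
      qis k d ((proj k d).map t) ∧ DGMod.homotopic k d (f ≫ t) (g ≫ t) := by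
  rw [qis_proj_map_iff] at hs
  obtain ⟨h, h1, h2, h3⟩ := hfg
  have h3' : ∀ x, DGMod.lin f (DGMod.lin s x) - DGMod.lin g (DGMod.lin s x) =
    Y.diff (h x) + h (X'.diff x) := h3
  let C := DGMod.cone s
  have hC : ∀ (x : X.carrier) (x' : X'.carrier),
      C.diff (x, x') = (X.diff x + DGMod.lin s x', -X'.diff x') := fun _ _ => rfl
  let p : C ⟶ Y := DGMod.mkHom (M := C) ((DGMod.lin f - DGMod.lin g).coprod h)
    (fun i x hx => Submodule.add_mem _
      (Submodule.sub_mem _ (DGMod.lin_mem f hx.1) (DGMod.lin_mem g hx.1))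
      (by have := h1 _ _ hx.2; rwa [sub_add_cancel] at this))
    (by
      rintro ⟨x, x'⟩
      change (DGMod.lin f (X.T x) - DGMod.lin g (X.T x)) + h (sgn k d • X'.T x') =
        Y.T ((DGMod.lin f x - DGMod.lin g x) + h x')
      rw [map_smul, h2, sgn_smul_sgn_smul, map_add, map_sub, DGMod.lin_T, DGMod.lin_T])
    (by
      rintro ⟨x, x'⟩
      change (DGMod.lin f (X.diff x + DGMod.lin s x') - DGMod.lin g (X.diff x + DGMod.lin s x')) +
        h (-X'.diff x') = Y.diff ((DGMod.lin f x - DGMod.lin g x) + h x')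
      have := h3' x'
      rw [map_add, map_add, map_add, map_sub, map_neg, ← DGMod.lin_diff, ← DGMod.lin_diff,
        add_sub_add_comm, this]
      abel)
  have hp : ∀ (x : X.carrier) (x' : X'.carrier), DGMod.lin p (x, x') =
      (DGMod.lin f x - DGMod.lin g x) + h x' := fun _ _ => rfl
  have hC0 : ∀ c, C.diff c = 0 → ∃ b, C.diff b = c := by
    rintro ⟨x, x'⟩ hc
    rw [hC, Prod.mk_eq_zero, neg_eq_zero] at hc
    obtain ⟨z, rfl⟩ := hs.1 x' hc.2
      ⟨-x, by rw [map_neg, eq_comm, eq_neg_iff_add_eq_zero, add_comm, hc.1]⟩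
    obtain ⟨c, b, hc', hb⟩ := hs.2 (x + DGMod.lin s z)
      (by rw [map_add, ← DGMod.lin_diff, hc.1])
    refine ⟨(-b, c - z), ?_⟩
    rw [hC, map_neg, hb, map_sub, map_sub, hc']
    refine Prod.ext ?_ (by simp)
    change -(DGMod.lin s c - (x + DGMod.lin s z)) + (DGMod.lin s c - DGMod.lin s z) = x
    abel
  let Z := DGMod.cone p
  have hZ : ∀ (y : Y.carrier) (c : C.carrier),
      Z.diff (y, c) = (Y.diff y + DGMod.lin p c, -C.diff c) := fun _ _ => rfl
  have hT : ∀ (y : Y.carrier) (c : C.carrier),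
      Z.T (y, c) = (Y.T y, sgn k d • C.T c) := fun _ _ => rfl
  let t : Y ⟶ Z := DGMod.mkHom (N := Z) (LinearMap.inl k Y.carrier C.carrier)
    (fun _ _ hx => ⟨hx, Submodule.zero_mem _⟩)
    (fun y => show (Y.T y, (0 : C.carrier)) = (Y.T y, sgn k d • C.T 0) by
      rw [map_zero, smul_zero])
    (fun y => show (Y.diff y, (0 : C.carrier)) = (Y.diff y + DGMod.lin p 0, -C.diff 0) by
      rw [map_zero, map_zero, neg_zero, add_zero])
  have ht : ∀ y, DGMod.lin t y = (y, 0) := fun _ => rfl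
  refine ⟨Z, t, ?_, ?_⟩
  · rw [qis_proj_map_iff]
    constructor
    · rintro y hy ⟨⟨y', c⟩, hc⟩
      rw [hZ, ht, Prod.mk.injEq, neg_eq_zero] at hc
      obtain ⟨b, rfl⟩ := hC0 c hc.2
      exact ⟨y' + DGMod.lin p b, by rw [map_add, ← DGMod.lin_diff, hc.1]⟩
    · rintro ⟨y, c⟩ hc
      rw [hZ, Prod.mk_eq_zero, neg_eq_zero] at hc
      obtain ⟨b, rfl⟩ := hC0 c hc.2
      refine ⟨y + DGMod.lin p b, (0, b), ?_, ?_⟩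
      · rw [map_add, ← DGMod.lin_diff, hc.1]
      · rw [hZ, ht]
        refine Prod.ext ?_ ?_
        · change Y.diff 0 + DGMod.lin p b = y + DGMod.lin p b - y
          rw [map_zero, zero_add, add_sub_cancel_left]
        · change -C.diff b = 0 - C.diff b
          rw [zero_sub]
  · refine ⟨(LinearMap.inr k Y.carrier C.carrier).comp (LinearMap.inl k X.carrier X'.carrier),
      fun i x hx => ⟨Submodule.zero_mem _, ?_, Submodule.zero_mem _⟩, fun x => ?_, fun x => ?_⟩
    · change x ∈ X.gr (i + 1 - 1)
      rwa [add_sub_cancel_right]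
    · change ((0 : Y.carrier), X.T x, (0 : X'.carrier)) =
        sgn k d • (Y.T 0, sgn k d • (X.T x, sgn k d • X'.T 0))
      simp
    · refine Prod.ext ?_ (Prod.ext ?_ ?_)
      · change DGMod.lin f x - DGMod.lin g x =
          Y.diff 0 + ((DGMod.lin f x - DGMod.lin g x) + h 0) + 0
        simp
      · change (0 : X.carrier) - 0 = -(X.diff x + DGMod.lin s 0) + X.diff x
        simp
      · change (0 : X'.carrier) - 0 = - -X'.diff 0 + 0
        simp

/-- The quasi-isomorphisms in `K(A)` admit a calculus of left fractions. -/
instance : (qis k d).HasLeftCalculusOfFractions where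
  exists_leftFraction := by
    rintro ⟨X⟩ ⟨Y⟩ ⟨s, hs, f⟩
    rename_i X'
    obtain ⟨X'⟩ := X'
    obtain ⟨s, rfl⟩ := (proj k d).map_surjective (X := X') (Y := X) s
    obtain ⟨f, rfl⟩ := (proj k d).map_surjective (X := X') (Y := Y) f
    obtain ⟨Z, g, t, ht, h⟩ := exists_ore_square s f hs
    exact ⟨⟨(proj k d).map g, (proj k d).map t, ht⟩, CategoryTheory.Quotient.sound _ h⟩
  ext := by
    rintro ⟨X'⟩ ⟨X⟩ ⟨Y⟩ f₁ f₂ s hs h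
    obtain ⟨s, rfl⟩ := (proj k d).map_surjective (X := X') (Y := X) s
    obtain ⟨f₁, rfl⟩ := (proj k d).map_surjective (X := X) (Y := Y) f₁
    obtain ⟨f₂, rfl⟩ := (proj k d).map_surjective (X := X) (Y := Y) f₂
    have h' : DGMod.homotopic k d (s ≫ f₁) (s ≫ f₂) :=
      (CategoryTheory.Quotient.functor_map_eq_iff (DGMod.homotopic k d) (s ≫ f₁) (s ≫ f₂)).1 h
    obtain ⟨Z, t, ht, h⟩ := exists_coequalizing s f₁ f₂ hs h'
    exact ⟨(proj k d).obj Z, (proj k d).map t, ht, CategoryTheory.Quotient.sound _ h⟩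

variable (k d)

/-- The suspension `Σ ^ n` on the homotopy category. -/
def shift (n : ℤ) : HoCat k d ⥤ HoCat k d :=
  CategoryTheory.Quotient.lift _ (DGMod.shiftFunctor k d n ⋙ proj k d) fun _ _ _ _ h =>
    CategoryTheory.Quotient.sound _ (DGMod.homotopic_shift n h)

variable {k d}

lemma qis_shift (n : ℤ) {X Y : HoCat k d} (f : X ⟶ Y) (hf : qis k d f) :
    qis k d ((shift k d n).map f) := by
  obtain ⟨X⟩ := X
  obtain ⟨Y⟩ := Y
  obtain ⟨f, rfl⟩ := (proj k d).map_surjective (X := X) (Y := Y) f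
  exact DGMod.isIso_homology_shift n f hf

end HoCat

/-- The derived category `D(A)` of DG left `A`-modules: the localization of the homotopy category
at the quasi-isomorphisms, with its induced `k`-linear structure. -/
abbrev DerCat (k : Type u) [Field k] (d : ℤ) := (HoCat.qis k d).Localization

namespace DerCat

variable (k : Type u) [Field k] (d : ℤ)

/-- The canonical functor from DG modules to the derived category. -/
abbrev proj : DGMod k d ⥤ DerCat k d := HoCat.proj k d ⋙ (HoCat.qis k d).Q

/-- The suspension `Σ ^ n` on the derived category. -/
def shift (n : ℤ) : DerCat k d ⥤ DerCat k d :=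
  Localization.Construction.lift (HoCat.shift k d n ⋙ (HoCat.qis k d).Q) fun _ _ f hf =>
    Localization.inverts (HoCat.qis k d).Q (HoCat.qis k d) _ (HoCat.qis_shift n f hf)

variable {k d}

/-- `Thick G X` says that `X` lies in the thick subcategory `⟨G⟩` of `D(A)`: it can be built from
`G` using finitely many (de)suspensions, distinguished triangles and direct summands.  The
distinguished triangles of `D(A)` are, up to isomorphism and rotation, those given by
`M ⟶ N ⟶ cone f` for morphisms `f : M ⟶ N` of DG modules; closure under isomorphisms is the case
of `retract` in which the retraction is an isomorphism. -/
inductive Thick (G : DerCat k d) : DerCat k d → Prop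
  | base : Thick G G
  | shift (n : ℤ) {X : DerCat k d} : Thick G X → Thick G ((DerCat.shift k d n).obj X)
  | cone {M N : DGMod k d} (f : M ⟶ N) : Thick G ((proj k d).obj M) →
      Thick G ((proj k d).obj N) → Thick G ((proj k d).obj (DGMod.cone f))
  | retract {X Y : DerCat k d} (r : Retract X Y) : Thick G Y → Thick G X

/-- The thick subcategory generated by `G`, as a property of objects. -/
def thick (G : DerCat k d) : ObjectProperty (DerCat k d) := Thick G

end DerCat

/-- The category `T`: the thick subcategory `⟨k⟩` of `D(A)` generated by the trivial DG module
`k = A / (T)`, where `A = k[T]` with `T` in homological degree `d = w - 1`. -/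
abbrev SphericalCat (k : Type u) [Field k] (w : ℤ) :=
  (DerCat.thick ((DerCat.proj k (w - 1)).obj (DGMod.trivial k (w - 1)))).FullSubcategory

/-- The suspension `Σ ^ n` on the category `T`. -/
def SphericalCat.susp (k : Type u) [Field k] (w n : ℤ) : SphericalCat k w ⥤ SphericalCat k w :=
  ObjectProperty.lift _ (ObjectProperty.ι _ ⋙ DerCat.shift k (w - 1) n)
    fun X => DerCat.Thick.shift n X.property

/-! ### The Auslander-Reiten quiver -/

section ARQuiver

variable {C : Type u} [Category.{v} C] [Preadditive C]

/-- `X` is non-zero, and in each decomposition of `X` as a direct sum one summand is zero. -/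
def IsIndec (X : C) : Prop :=
  ¬ IsZero X ∧ ∀ (Y Z : C) (b : BinaryBicone Y Z), Nonempty b.IsBilimit →
    Nonempty (X ≅ b.pt) → IsZero Y ∨ IsZero Z

/-- `f` is neither a split monomorphism nor a split epimorphism, and in each factorization of `f`
the first factor is a split monomorphism or the second one is a split epimorphism. -/
def IsIrred {X Y : C} (f : X ⟶ Y) : Prop :=
  ¬ IsSplitMono f ∧ ¬ IsSplitEpi f ∧
    ∀ (Z : C) (g : X ⟶ Z) (h : Z ⟶ Y), g ≫ h = f → IsSplitMono g ∨ IsSplitEpi h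

/-- The AR quiver has the isomorphism classes of indecomposable objects as vertices, and an arrow
from the class of `X` to the class of `Y` if there is an irreducible morphism `X ⟶ Y`. -/
def ARArrow (X Y : C) : Prop :=
  IsIndec X ∧ IsIndec Y ∧ ∃ f : X ⟶ Y, IsIrred f

/-- `X` and `Y` lie in the same (connected) component of the AR quiver. -/
def ARConnected : C → C → Prop :=
  Relation.EqvGen fun X Y => Nonempty (X ≅ Y) ∨ ARArrow X Y

/-- The arrows of the quiver `ℤA_∞`.  Its vertices are the pairs `(n, r)` with `n` an integer and
`r ≥ 0` the height above the base line.  From `(n, r)` there is an arrow going up, to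
`(n, r + 1)`, and if `r ≥ 1` an arrow going down, to `(n + 1, r - 1)`. -/
def ZAInftyArrow (p q : ℤ × ℕ) : Prop :=
  (q.1 = p.1 ∧ q.2 = p.2 + 1) ∨ (q.1 = p.1 + 1 ∧ q.2 + 1 = p.2)

/-- `φ` is an isomorphism of quivers from `ℤA_∞` onto a component of the AR quiver. -/
structure IsZAInftyComponent (φ : ℤ × ℕ → C) : Prop where
  indec : ∀ p, IsIndec (φ p)
  injective : ∀ p q, Nonempty (φ p ≅ φ q) → p = q
  arrow_iff : ∀ p q, ARArrow (φ p) (φ q) ↔ ZAInftyArrow p q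
  surjective : ∀ p X, IsIndec X → ARConnected (φ p) X → ∃ q, Nonempty (X ≅ φ q)

/-- The infinite rectangle to the right of the vertex `p` of `ℤA_∞`: the vertices reached from `p`
by following `j` arrows down, where `j` is at most the height of `p`, and then `m` arrows up. -/
def rectPlus (p : ℤ × ℕ) : Set (ℤ × ℕ) :=
  {q | ∃ j m : ℕ, j ≤ p.2 ∧ q.1 = p.1 + j ∧ q.2 + j = p.2 + m}

/-- The infinite rectangle to the left of the vertex `p` of `ℤA_∞`: the vertices reached from `p`
by going backwards along `j` arrows to the lower left, where `j` is at most the height of `p`, and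
then backwards along `m` arrows to the upper left. -/
def rectMinus (p : ℤ × ℕ) : Set (ℤ × ℕ) :=
  {q | ∃ j m : ℕ, j ≤ p.2 ∧ q.1 = p.1 - m ∧ q.2 + j = p.2 + m}

/-- The region `F⁺(t)` in the AR component of `t`, identified with `ℤA_∞`.  The identification is
unique up to translations, which respect the rectangles. -/
def FPlus (t : C) : Set C :=
  {u | ∃ φ : ℤ × ℕ → C, IsZAInftyComponent φ ∧ ∃ p q, Nonempty (t ≅ φ p) ∧ Nonempty (u ≅ φ q) ∧
    q ∈ rectPlus p}

/-- The region `F⁻(t)` in the AR component of `t`, identified with `ℤA_∞`. -/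
def FMinus (t : C) : Set C :=
  {u | ∃ φ : ℤ × ℕ → C, IsZAInftyComponent φ ∧ ∃ p q, Nonempty (t ≅ φ p) ∧ Nonempty (u ≅ φ q) ∧
    q ∈ rectMinus p}

end ARQuiver

end

end SphericalAR

/-! Write X(r,i) for Σ^i(A/T^(r+1)), the objects `DerCat.X`. The computation rests on the triangle
Σ^(i+(r+1)d)A → Σ^iA → X(r,i) → Σ^(i+(r+1)d+1)A whose first morphism is T^(r+1). Morphisms from Σ^iA
to Z are the homology classes of Z of degree i, so applying Hom(-, X(s,j)) to the triangle leaves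
two kinds of morphisms X(r,i) → X(s,j). The first kind sends the generator to T^m times the
generator, where i = j + md and m ≤ s ≤ m + r. The second kind factors through the connecting
morphism, where i + (r+1)d + 1 = j + bd and b ≤ r, b ≤ s. Since d ≠ 0, each kind contributes at most
one dimension. Both at once would force (m + r - b + 1)d = -1, hence d = -1, which is excluded. So
Hom has dimension 1 or 0 according to `HomNonzero` (`exists_generator_of_homNonzero`,
`homNonzero_of_ne_zero`), and all endomorphisms of X(r,i) are scalars.

Objects are decomposed by a purity argument. Let g : X(r,i) → Z be such that T^r times the image of
the generator is not divisible by T^(r+1) in the homology of Z. A linear form detecting this defines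
a morphism from Z to a second model of X(r,i), built from graded duals of A
(`exists_hom_cores_of_pure`). Its composite with g is non-zero, hence invertible, and g is a split
monomorphism (`exists_retraction`). On objects of ⟨k⟩ some power of T kills the homology
(`isNil_of_thick`), so a class of maximal T-length splits off an X(r,i) (`exists_splitting`), and
every indecomposable is of this form (`exists_iso_X`). The same criterion shows that the inclusions
X(r,i) → X(r+1,i-d) and the projections X(r+1,i) → X(r,i) are irreducible. No other pair of these
objects admits an irreducible morphism, since all other morphisms factor through a third object
(`arArrow_X_iff`).

Hence (n,r) ↦ X(r, c - (n+r)d) identifies a component with ℤA_∞ (`isZAInftyComponent_coord`).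
Automorphisms of ℤA_∞ are translations, so the rectangles may be computed in these coordinates.
F⁺(t) describes the morphisms of the first kind, with m the number of arrows up. F⁻(Σ^w t) describes
those of the second kind, because w = d + 1. -/

namespace SphericalAR

open CategoryTheory CategoryTheory.Limits

noncomputable section

/-! ### Graded components -/

namespace DGMod

variable {k : Type u} [Field k] {d : ℤ}

/-- The projection onto the homogeneous component of degree `j`. -/
def pr (M : DGMod k d) (j : ℤ) : M.carrier →ₗ[k] M.carrier :=
  (M.gr j).subtype ∘ₗ DirectSum.component k ℤ (fun i => M.gr i) j ∘ₗ
    (LinearEquiv.ofBijective (DirectSum.coeLinearMap M.gr) M.isInternal).symm.toLinearMap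

lemma pr_mem (M : DGMod k d) (j : ℤ) (x : M.carrier) : M.pr j x ∈ M.gr j := by
  simp [pr]

lemma pr_of_mem (M : DGMod k d) {j : ℤ} {x : M.carrier} (hx : x ∈ M.gr j) : M.pr j x = x := by
  exact congrArg Subtype.val (M.isInternal.ofBijective_coeLinearMap_of_mem hx)

lemma pr_of_mem_ne (M : DGMod k d) {i j : ℤ} {x : M.carrier} (hx : x ∈ M.gr i) (h : i ≠ j) :
    M.pr j x = 0 := by
  exact congrArg Subtype.val (M.isInternal.ofBijective_coeLinearMap_of_mem_ne h hx)

/-- Every element is a finite sum of homogeneous ones. -/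
lemma homogeneous_induction (M : DGMod k d) {p : M.carrier → Prop} (x : M.carrier)
    (h0 : p 0) (hadd : ∀ x y, p x → p y → p (x + y)) (hmem : ∀ i, ∀ x ∈ M.gr i, p x) : p x := by
  have hx : x ∈ ⨆ i, M.gr i := by
    rw [M.isInternal.submodule_iSup_eq_top]; trivial
  exact Submodule.iSup_induction M.gr (motive := p) hx hmem h0 hadd

/-- Both sides are additive, so homogeneous elements suffice. Taking components makes it possible to
choose cycles and boundaries homogeneous, although `IsQis` speaks of arbitrary elements. -/
lemma pr_map {M N : DGMod k d} (f : M.carrier →ₗ[k] N.carrier) (e : ℤ)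
    (hf : ∀ i, ∀ x ∈ M.gr i, f x ∈ N.gr (i + e)) (j : ℤ) (x : M.carrier) :
    N.pr (j + e) (f x) = f (M.pr j x) := by
  induction x using homogeneous_induction with
  | h0 => simp
  | hadd x y hx hy => simp [hx, hy]
  | hmem i x hx =>
    by_cases h : i = j
    · subst h
      rw [pr_of_mem _ hx, pr_of_mem _ (hf i x hx)]
    · rw [pr_of_mem_ne _ hx h, pr_of_mem_ne _ (hf i x hx) (by omega), map_zero]

lemma pr_lin {M N : DGMod k d} (f : M ⟶ N) (j : ℤ) (x : M.carrier) :
    N.pr j (lin f x) = lin f (M.pr j x) := by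
  simpa using pr_map (lin f) 0 (fun i x hx => by simpa using lin_mem f hx) j x

lemma pr_diff (M : DGMod k d) (j : ℤ) (x : M.carrier) :
    M.pr (j - 1) (M.diff x) = M.diff (M.pr j x) :=
  pr_map (N := M) M.diff (-1) (fun _ _ hx => M.diff_mem hx) j x

lemma T_pow_mem (M : DGMod k d) (n : ℕ) {i : ℤ} {x : M.carrier} (hx : x ∈ M.gr i) :
    (M.T ^ n) x ∈ M.gr (i + n * d) := by
  simpa [act_monomial] using M.act_mem n 1 hx

lemma diff_T_pow (M : DGMod k d) (n : ℕ) (x : M.carrier) :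
    M.diff ((M.T ^ n) x) = sgn k (n * d) • (M.T ^ n) (M.diff x) := by
  simpa [act_monomial] using M.diff_act n 1 x

lemma lin_T_pow {M N : DGMod k d} (f : M ⟶ N) (n : ℕ) (x : M.carrier) :
    lin f ((M.T ^ n) x) = (N.T ^ n) (lin f x) := by
  induction n with
  | zero => rfl
  | succ n ih => rw [pow_succ', pow_succ', Module.End.mul_apply, Module.End.mul_apply, lin_T, ih]

lemma diff_T_pow_eq_zero (M : DGMod k d) (n : ℕ) {x : M.carrier} (hx : M.diff x = 0) :
    M.diff ((M.T ^ n) x) = 0 := by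
  rw [diff_T_pow, hx, map_zero, smul_zero]

/-- A morphism that is bijective on homology. -/
def IsQis {M N : DGMod k d} (f : M ⟶ N) : Prop :=
  (∀ x, M.diff x = 0 → (∃ y, N.diff y = lin f x) → ∃ z, M.diff z = x) ∧
    (∀ y, N.diff y = 0 → ∃ x z, M.diff x = 0 ∧ N.diff z = lin f x - y)

lemma IsQis.exists_boundary {M N : DGMod k d} {f : M ⟶ N} (hf : IsQis f) {i : ℤ} {x : M.carrier}
    (hx : x ∈ M.gr i) (hx' : M.diff x = 0) (h : ∃ y, N.diff y = lin f x) :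
    ∃ z ∈ M.gr (i + 1), M.diff z = x := by
  obtain ⟨z, hz⟩ := hf.1 x hx' h
  refine ⟨M.pr (i + 1) z, M.pr_mem _ _, ?_⟩
  rw [← pr_diff, hz, add_sub_cancel_right, pr_of_mem _ hx]

lemma IsQis.exists_cycle {M N : DGMod k d} {f : M ⟶ N} (hf : IsQis f) {i : ℤ} {y : N.carrier}
    (hy : y ∈ N.gr i) (hy' : N.diff y = 0) :
    ∃ x ∈ M.gr i, ∃ z ∈ N.gr (i + 1), M.diff x = 0 ∧ N.diff z = lin f x - y := by
  obtain ⟨x, z, hx, hz⟩ := hf.2 y hy'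
  refine ⟨M.pr i x, M.pr_mem _ _, N.pr (i + 1) z, N.pr_mem _ _, ?_, ?_⟩
  · rw [← pr_diff, hx, map_zero]
  · rw [← pr_diff, hz, add_sub_cancel_right, map_sub, pr_of_mem _ hy, pr_lin]

/-! ### DG modules with a given homogeneous basis -/

section OfBasis

variable {ι : Type} (k)

/-- The span of the basis vectors of degree `j`. -/
def basisGr (deg : ι → ℤ) (j : ℤ) : Submodule k (ι →₀ k) := Finsupp.supported k k {a | deg a = j}

variable {k}

lemma mem_basisGr {deg : ι → ℤ} {j : ℤ} {x : ι →₀ k} :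
    x ∈ basisGr k deg j ↔ ∀ a, deg a ≠ j → x a = 0 := by
  rw [basisGr, Finsupp.mem_supported']
  rfl

lemma single_mem_basisGr {deg : ι → ℤ} {j : ℤ} {a : ι} (h : deg a = j) (c : k) :
    Finsupp.single a c ∈ basisGr k deg j :=
  Finsupp.single_mem_supported k c h

lemma isInternal_basisGr (deg : ι → ℤ) : DirectSum.IsInternal (basisGr k deg) := by
  rw [DirectSum.isInternal_submodule_iff_iSupIndep_and_iSup_eq_top]
  refine ⟨fun i => ?_, ?_⟩
  · refine Disjoint.mono_right (iSup₂_le fun j hj => ?_ : _ ≤ Finsupp.supported k k {a | deg a ≠ i})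
      (Finsupp.disjoint_supported_supported (Set.disjoint_left.2 fun a h h' => h' h))
    exact Finsupp.supported_mono fun a (h : deg a = j) => by simpa [h] using hj
  · rw [eq_top_iff]
    rintro x -
    induction x using Finsupp.induction_linear with
    | zero => exact Submodule.zero_mem _
    | add x y hx hy => exact Submodule.add_mem _ hx hy
    | single a c => exact Submodule.mem_iSup_of_mem (deg a) (single_mem_basisGr rfl c)

lemma linearCombination_mem {V : Type u} [AddCommGroup V] [Module k V] {deg : ι → ℤ}
    {v : ι → V} {G : ℤ → Submodule k V} {e : ℤ} (hv : ∀ a, v a ∈ G (deg a + e)) {i : ℤ}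
    {x : ι →₀ k} (hx : x ∈ basisGr k deg i) : Finsupp.linearCombination k v x ∈ G (i + e) := by
  rw [Finsupp.linearCombination_apply]
  refine Submodule.sum_mem _ fun a ha => Submodule.smul_mem _ _ ?_
  have : deg a = i := by
    by_contra h
    exact Finsupp.mem_support_iff.1 ha (mem_basisGr.1 hx a h)
  exact this ▸ hv a

/-- The DG module with a homogeneous basis indexed by `ι`, where `T` and `∂` are given on the
basis. -/
abbrev ofBasis (deg : ι → ℤ) (t δ : ι → ι →₀ k)
    (ht : ∀ a, t a ∈ basisGr k deg (deg a + d)) (hδ : ∀ a, δ a ∈ basisGr k deg (deg a + -1))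
    (hδδ : ∀ a, Finsupp.linearCombination k δ (δ a) = 0)
    (hδt : ∀ a, Finsupp.linearCombination k δ (t a) =
      sgn k d • Finsupp.linearCombination k t (δ a)) : DGMod k d where
  carrier := ι →₀ k
  gr := basisGr k deg
  isInternal := isInternal_basisGr deg
  diff := Finsupp.linearCombination k δ
  T := Finsupp.linearCombination k t
  diff_mem hx := linearCombination_mem hδ hx
  T_mem hx := linearCombination_mem ht hx
  diff_diff x := by
    have : Finsupp.linearCombination k δ ∘ₗ Finsupp.linearCombination k δ = 0 :=
      Finsupp.lhom_ext' fun a => LinearMap.ext_ring (by simp [hδδ])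
    exact LinearMap.congr_fun this x
  diff_T x := by
    have : Finsupp.linearCombination k δ ∘ₗ Finsupp.linearCombination k t =
        sgn k d • Finsupp.linearCombination k t ∘ₗ Finsupp.linearCombination k δ :=
      Finsupp.lhom_ext' fun a => LinearMap.ext_ring (by simp [hδt])
    exact LinearMap.congr_fun this x

variable {deg : ι → ℤ} {t δ : ι → ι →₀ k} {ht hδ hδδ hδt}

lemma finsupp_map_eq {V : Type u} [AddCommGroup V] [Module k V] {f g : (ι →₀ k) →ₗ[k] V}
    (h : ∀ a, f (Finsupp.single a 1) = g (Finsupp.single a 1)) (x : ι →₀ k) : f x = g x :=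
  LinearMap.congr_fun (Finsupp.lhom_ext' fun a => LinearMap.ext_ring (h a)) x

/-- Morphisms are determined by their values on the basis. -/
abbrev homOfBasis (N : DGMod k d) (v : ι → N.carrier) (hv : ∀ a, v a ∈ N.gr (deg a))
    (hvt : ∀ a, Finsupp.linearCombination k v (t a) = N.T (v a))
    (hvδ : ∀ a, Finsupp.linearCombination k v (δ a) = N.diff (v a)) :
    ofBasis (d := d) deg t δ ht hδ hδδ hδt ⟶ N :=
  mkHom (M := ofBasis (d := d) deg t δ ht hδ hδδ hδt) (Finsupp.linearCombination k v)
    (fun i x hx => by simpa using linearCombination_mem (e := 0) (fun a => by simpa using hv a) hx)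
    (finsupp_map_eq (f := Finsupp.linearCombination k v ∘ₗ Finsupp.linearCombination k t)
      (g := N.T ∘ₗ Finsupp.linearCombination k v) fun a => by simp [hvt])
    (finsupp_map_eq (f := Finsupp.linearCombination k v ∘ₗ Finsupp.linearCombination k δ)
      (g := N.diff ∘ₗ Finsupp.linearCombination k v) fun a => by simp [hvδ])

lemma ofBasis_hom_ext {N : DGMod k d} {f g : ofBasis (d := d) deg t δ ht hδ hδδ hδt ⟶ N}
    (h : ∀ a, lin f (Finsupp.single a 1) = lin g (Finsupp.single a 1)) : f = g :=
  hom_ext (finsupp_map_eq h)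

/-- A homotopy is determined by its values on the basis. -/
lemma homotopic_of_basis {N : DGMod k d} {f g : ofBasis (d := d) deg t δ ht hδ hδδ hδt ⟶ N}
    (v : ι → N.carrier) (hv : ∀ a, v a ∈ N.gr (deg a + 1))
    (hvt : ∀ a, Finsupp.linearCombination k v (t a) = sgn k d • N.T (v a))
    (hvδ : ∀ a, lin f (Finsupp.single a 1) - lin g (Finsupp.single a 1) =
      N.diff (v a) + Finsupp.linearCombination k v (δ a)) : homotopic k d f g :=
  ⟨Finsupp.linearCombination k v, fun i x hx => linearCombination_mem hv hx,
    finsupp_map_eq (f := Finsupp.linearCombination k v ∘ₗ Finsupp.linearCombination k t)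
      (g := sgn k d • N.T ∘ₗ Finsupp.linearCombination k v) fun a => by simp [hvt],
    finsupp_map_eq (f := lin f - lin g) (g := N.diff ∘ₗ Finsupp.linearCombination k v +
      Finsupp.linearCombination k v ∘ₗ Finsupp.linearCombination k δ) fun a => by simp [hvδ]⟩

end OfBasis

end DGMod

/-! ### Powers of T, homotopies and a criterion for quasi-isomorphisms -/

namespace DGMod

variable {k : Type u} [Field k] {d : ℤ}

@[simp] lemma lin_zero {M N : DGMod k d} : lin (0 : M ⟶ N) = 0 := rfl

@[simp] lemma lin_sub {M N : DGMod k d} (f g : M ⟶ N) : lin (f - g) = lin f - lin g := rfl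

lemma sgn_T_pow_diff (M : DGMod k d) (n : ℕ) (x : M.carrier) :
    sgn k (n * d) • M.diff ((M.T ^ n) x) = (M.T ^ n) (M.diff x) := by
  rw [diff_T_pow, sgn_smul_sgn_smul]

lemma T_pow_add_apply (M : DGMod k d) (m n : ℕ) (x : M.carrier) :
    (M.T ^ (m + n)) x = (M.T ^ m) ((M.T ^ n) x) := by
  rw [pow_add, Module.End.mul_apply]

lemma T_pow_succ_apply (M : DGMod k d) (n : ℕ) (x : M.carrier) :
    (M.T ^ (n + 1)) x = M.T ((M.T ^ n) x) := by
  rw [pow_succ', Module.End.mul_apply]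

lemma homotopy_T_pow {M N : DGMod k d} {h : M.carrier →ₗ[k] N.carrier}
    (hT : ∀ x, h (M.T x) = sgn k d • N.T (h x)) (n : ℕ) (x : M.carrier) :
    h ((M.T ^ n) x) = sgn k (n * d) • (N.T ^ n) (h x) := by
  induction n with
  | zero => simp
  | succ n ih =>
    rw [T_pow_succ_apply, T_pow_succ_apply, hT, ih, map_smul, smul_smul, ← sgn_add]
    push_cast
    rw [show d + (n : ℤ) * d = ((n : ℤ) + 1) * d by ring]

/-- The maps `σ`, `s` and `t` are only k-linear: bijectivity on homology does not involve the action
of T. The contractions to which this is applied are not A-linear. -/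
lemma isQis_of_homotopy_inverse {M N : DGMod k d} (f : M ⟶ N) (σ : N.carrier →ₗ[k] M.carrier)
    (s : M.carrier →ₗ[k] M.carrier) (t : N.carrier →ₗ[k] N.carrier)
    (hσ : ∀ y, M.diff (σ y) = σ (N.diff y))
    (hs : ∀ x, M.diff (s x) + s (M.diff x) = x - σ (lin f x))
    (ht : ∀ y, N.diff (t y) + t (N.diff y) = lin f (σ y) - y) : IsQis f := by
  refine ⟨?_, fun y hy => ⟨σ y, t y, by rw [hσ, hy, map_zero], by rw [← ht, hy, map_zero, add_zero]⟩⟩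
  rintro x hx ⟨y, hy⟩
  refine ⟨s x + σ y, ?_⟩
  have := hs x
  rw [hx, map_zero, add_zero] at this
  rw [map_add, hσ, hy, this, sub_add_cancel]

/-! ### Semifree DG modules -/

/-- Morphisms out of `P` lift, uniquely up to homotopy, along quasi-isomorphisms. -/
def KProj (P : DGMod k d) : Prop :=
  ∀ ⦃N N' : DGMod k d⦄ (s : N ⟶ N'), IsQis s →
    (∀ f : P ⟶ N', ∃ g : P ⟶ N, homotopic k d (g ≫ s) f) ∧
      ∀ g : P ⟶ N, homotopic k d (g ≫ s) 0 → homotopic k d g 0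

variable (k d)

/-- The free DG module on a generator of degree `i`, that is `Σ ^ i A`. -/
abbrev free (i : ℤ) : DGMod k d :=
  ofBasis (ι := ℕ) (fun n => i + n * d) (fun n => Finsupp.single (n + 1) 1) 0
    (fun n => single_mem_basisGr (by push_cast; ring) _) (fun _ => Submodule.zero_mem _)
    (fun _ => by simp) (fun _ => by simp)

variable {k d}

lemma free_T_pow_single (i : ℤ) (m n : ℕ) (c : k) :
    ((free k d i).T ^ m) (Finsupp.single n c : ℕ →₀ k) = (Finsupp.single (n + m) c : ℕ →₀ k) := by
  induction m with
  | zero => rfl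
  | succ m ih =>
    rw [T_pow_succ_apply, ih]
    simp [add_assoc]

/-- The generator of a free DG module. -/
def freeGen (i : ℤ) : (free k d i).carrier := (Finsupp.single 0 1 : ℕ →₀ k)

lemma freeGen_mem {i : ℤ} : freeGen i ∈ (free k d i).gr i := single_mem_basisGr (by simp) _

/-- The morphism out of a free DG module given by a cycle. -/
def freeHom {i : ℤ} (N : DGMod k d) (x : N.carrier) (hx : x ∈ N.gr i) (hx' : N.diff x = 0) :
    free k d i ⟶ N :=
  homOfBasis N (fun n => (N.T ^ n) x) (fun n => T_pow_mem N n hx)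
    (fun n => by simp [T_pow_succ_apply])
    (fun n => by simp [diff_T_pow_eq_zero N n hx'])

lemma freeHom_gen {i : ℤ} (N : DGMod k d) (x : N.carrier) (hx : x ∈ N.gr i)
    (hx' : N.diff x = 0) : lin (freeHom N x hx hx') (freeGen i) = x := by
  simp [freeHom, freeGen]

lemma freeHom_single {i : ℤ} (N : DGMod k d) (f : free k d i ⟶ N) (n : ℕ) :
    lin f (Finsupp.single n 1 : ℕ →₀ k) = (N.T ^ n) (lin f (freeGen i)) := by
  rw [← lin_T_pow, freeGen, free_T_pow_single, zero_add]

lemma free_hom_ext {i : ℤ} {N : DGMod k d} {f g : free k d i ⟶ N}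
    (h : lin f (freeGen i) = lin g (freeGen i)) : f = g :=
  ofBasis_hom_ext fun n => by rw [freeHom_single, freeHom_single, h]

lemma free_gen_mem {i : ℤ} (N : DGMod k d) (f : free k d i ⟶ N) :
    lin f (freeGen i) ∈ N.gr i :=
  lin_mem f freeGen_mem

lemma free_gen_cycle {i : ℤ} (N : DGMod k d) (f : free k d i ⟶ N) :
    N.diff (lin f (freeGen i)) = 0 := by
  rw [← lin_diff]
  simp [freeGen]

lemma free_homotopic {i : ℤ} {N : DGMod k d} {f g : free k d i ⟶ N} {a : N.carrier}
    (ha : a ∈ N.gr (i + 1)) (h : lin f (freeGen i) -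
      lin g (freeGen i) = N.diff a) : homotopic k d f g := by
  refine homotopic_of_basis (fun n => sgn k (n * d) • (N.T ^ n) a)
    (fun n => Submodule.smul_mem _ _ ?_) (fun n => ?_) (fun n => ?_)
  · have := T_pow_mem N n ha
    rwa [show i + 1 + n * d = i + n * d + 1 by ring] at this
  · simp only [Finsupp.linearCombination_single, T_pow_succ_apply, map_smul, smul_smul,
      ← sgn_add]
    push_cast
    rw [one_mul, show d + (n : ℤ) * d = ((n : ℤ) + 1) * d by ring]
  · rw [freeHom_single, freeHom_single, ← map_sub, h, map_smul, sgn_T_pow_diff]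
    simp

lemma exists_of_free_homotopic {i : ℤ} {N : DGMod k d} {f g : free k d i ⟶ N}
    (h : homotopic k d f g) : ∃ a ∈ N.gr (i + 1), lin f (freeGen i) -
      lin g (freeGen i) = N.diff a := by
  obtain ⟨h, h1, -, h3⟩ := h
  refine ⟨h (freeGen i), h1 _ _ freeGen_mem, ?_⟩
  rw [h3]
  simp [freeGen]

/-- A morphism from Σ^iA is a cycle and a homotopy to zero is an element bounding it, so the two
clauses are surjectivity and injectivity of `s` on homology. -/
lemma kProj_free (i : ℤ) : KProj (free k d i) := by
  intro N N' s hs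
  refine ⟨fun f => ?_, fun g hg => ?_⟩
  · obtain ⟨x, hx, z, hz, hx', h⟩ := hs.exists_cycle (free_gen_mem _ f) (free_gen_cycle _ f)
    exact ⟨freeHom N x hx hx', free_homotopic hz
      (by rw [h, lin_comp, LinearMap.comp_apply, freeHom_gen])⟩
  · obtain ⟨a, -, h⟩ := exists_of_free_homotopic hg
    obtain ⟨z, hz, hz'⟩ := hs.exists_boundary (free_gen_mem _ g) (free_gen_cycle _ g)
      ⟨a, by rw [← h]; simp⟩
    exact free_homotopic hz (by rw [hz']; simp)

/-- The action of `T ^ m` on homology, as a morphism of free DG modules. -/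
def freeTau (m : ℕ) {i j : ℤ} (h : i = j + m * d) : free k d i ⟶ free k d j :=
  freeHom _ (Finsupp.single m 1 : ℕ →₀ k) (single_mem_basisGr (deg := fun n : ℕ => j + n * d) h.symm _) (by simp)

lemma lin_freeTau_comp (m : ℕ) {i j : ℤ} (h : i = j + m * d) {N : DGMod k d}
    (f : free k d j ⟶ N) : lin (freeTau m h ≫ f) (freeGen i) =
      (N.T ^ m) (lin f (freeGen j)) := by
  rw [lin_comp, LinearMap.comp_apply, freeTau, freeHom_gen, freeHom_single]

variable (k d)

/-- The semifree resolution of `Σ ^ i (A / T ^ (r + 1))`: it has homogeneous generators `inl 0` in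
degree `i`, a cycle, and `inr 0`, whose boundary is `T ^ (r + 1)` times the first one. -/
abbrev res (r : ℕ) (i : ℤ) : DGMod k d :=
  ofBasis (ι := ℕ ⊕ ℕ)
    (Sum.elim (fun n => i + n * d) (fun n => i + (r + 1) * d + 1 + n * d))
    (Sum.elim (fun n => Finsupp.single (Sum.inl (n + 1)) 1)
      (fun n => Finsupp.single (Sum.inr (n + 1)) 1))
    -- `inr n` is T^n applied to the second generator, so the Leibniz rule forces the sign
    -- (-1)^(nd).
    (Sum.elim 0 (fun n => Finsupp.single (Sum.inl (n + (r + 1))) (sgn k (n * d))))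
    (by
      rintro (n | n)
      · exact single_mem_basisGr (by simp; ring) _
      · exact single_mem_basisGr (by simp; ring) _)
    (by
      rintro (n | n)
      · exact Submodule.zero_mem _
      · exact single_mem_basisGr (by simp; ring) _)
    (by rintro (n | n) <;> simp)
    (by
      rintro (n | n)
      · simp
      · simp only [Sum.elim_inr, Finsupp.linearCombination_single, Sum.elim_inl,
          Finsupp.smul_single, smul_eq_mul, mul_one, one_mul, ← sgn_add]
        push_cast
        rw [show n + 1 + (r + 1) = n + (r + 1) + 1 by ring,
          show d + (n : ℤ) * d = ((n : ℤ) + 1) * d by ring])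

variable {k d}

section Res

variable {r : ℕ} {i : ℤ}

/-- The generating cycle of `res r i`. -/
def resGen (r : ℕ) (i : ℤ) : (res k d r i).carrier :=
  (Finsupp.single (Sum.inl 0) 1 : ℕ ⊕ ℕ →₀ k)

/-- The second generator of `res r i`. -/
def resRel (r : ℕ) (i : ℤ) : (res k d r i).carrier :=
  (Finsupp.single (Sum.inr 0) 1 : ℕ ⊕ ℕ →₀ k)

lemma res_T_pow_gen (m : ℕ) : ((res k d r i).T ^ m) (resGen r i) =
    (Finsupp.single (Sum.inl m) 1 : ℕ ⊕ ℕ →₀ k) := by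
  induction m with
  | zero => rfl
  | succ m ih =>
    rw [T_pow_succ_apply, ih]
    simp

lemma res_T_pow_rel (m : ℕ) : ((res k d r i).T ^ m) (resRel r i) =
    (Finsupp.single (Sum.inr m) 1 : ℕ ⊕ ℕ →₀ k) := by
  induction m with
  | zero => rfl
  | succ m ih =>
    rw [T_pow_succ_apply, ih]
    simp

lemma resGen_mem : resGen r i ∈ (res k d r i).gr i := single_mem_basisGr (by simp) _

lemma resRel_mem : resRel r i ∈ (res k d r i).gr (i + (r + 1) * d + 1) :=
  single_mem_basisGr (by simp) _

lemma diff_resGen : (res k d r i).diff (resGen r i) = 0 := by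
  simp [resGen]

lemma diff_resRel : (res k d r i).diff (resRel r i) =
    ((res k d r i).T ^ (r + 1)) (resGen r i) := by
  rw [res_T_pow_gen]
  simp [resRel]

/-- The morphism out of `res r i` given by a cycle `x` and `y` with `∂ y = T ^ (r + 1) x`. -/
def resHom (N : DGMod k d) (x y : N.carrier) (hx : x ∈ N.gr i) (hx' : N.diff x = 0)
    (hy : y ∈ N.gr (i + (r + 1) * d + 1)) (hy' : N.diff y = (N.T ^ (r + 1)) x) :
    res k d r i ⟶ N :=
  homOfBasis N (Sum.elim (fun n => (N.T ^ n) x) (fun n => (N.T ^ n) y))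
    (by
      rintro (n | n)
      · exact T_pow_mem N n hx
      · exact T_pow_mem N n hy)
    (by rintro (n | n) <;> simp [T_pow_succ_apply])
    (by
      rintro (n | n)
      · simp [diff_T_pow_eq_zero N n hx']
      · simp only [Sum.elim_inr, Finsupp.linearCombination_single, Sum.elim_inl, diff_T_pow, hy',
          T_pow_add_apply])

lemma resHom_gen (N : DGMod k d) (x y : N.carrier) (hx : x ∈ N.gr i) (hx' : N.diff x = 0)
    (hy : y ∈ N.gr (i + (r + 1) * d + 1)) (hy' : N.diff y = (N.T ^ (r + 1)) x) :
    lin (resHom N x y hx hx' hy hy') (resGen r i) = x := by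
  simp [resHom, resGen]

lemma resHom_rel (N : DGMod k d) (x y : N.carrier) (hx : x ∈ N.gr i) (hx' : N.diff x = 0)
    (hy : y ∈ N.gr (i + (r + 1) * d + 1)) (hy' : N.diff y = (N.T ^ (r + 1)) x) :
    lin (resHom N x y hx hx' hy hy') (resRel r i) = y := by
  simp [resHom, resRel]

lemma lin_resGen_mem {N : DGMod k d} (f : res k d r i ⟶ N) : lin f (resGen r i) ∈ N.gr i :=
  lin_mem f resGen_mem

lemma lin_resRel_mem {N : DGMod k d} (f : res k d r i ⟶ N) :
    lin f (resRel r i) ∈ N.gr (i + (r + 1) * d + 1) :=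
  lin_mem f resRel_mem

lemma diff_lin_resGen {N : DGMod k d} (f : res k d r i ⟶ N) :
    N.diff (lin f (resGen r i)) = 0 := by
  rw [← lin_diff, diff_resGen, map_zero]

lemma diff_lin_resRel {N : DGMod k d} (f : res k d r i ⟶ N) :
    N.diff (lin f (resRel r i)) = (N.T ^ (r + 1)) (lin f (resGen r i)) := by
  rw [← lin_diff, diff_resRel, lin_T_pow]

/-- A homotopy is determined by its values a and b on the two generators. The term with T^(r+1) a is
the value of the homotopy on the boundary of the second generator. -/
lemma res_homotopic {N : DGMod k d} {f g : res k d r i ⟶ N} {a b : N.carrier}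
    (ha : a ∈ N.gr (i + 1)) (hb : b ∈ N.gr (i + (r + 1) * d + 1 + 1))
    (h : lin f (resGen r i) - lin g (resGen r i) = N.diff a)
    (h' : lin f (resRel r i) - lin g (resRel r i) =
      N.diff b + sgn k ((r + 1 : ℕ) * d) • (N.T ^ (r + 1)) a) : homotopic k d f g := by
  refine homotopic_of_basis (Sum.elim (fun n => sgn k (n * d) • (N.T ^ n) a)
    (fun n => sgn k (n * d) • (N.T ^ n) b)) ?_ ?_ ?_
  · rintro (n | n)
    · have := T_pow_mem N n ha
      rw [show i + 1 + n * d = i + n * d + 1 by ring] at this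
      exact Submodule.smul_mem _ _ this
    · have := T_pow_mem N n hb
      rw [show i + (r + 1) * d + 1 + 1 + n * d = i + (r + 1) * d + 1 + n * d + 1 by ring] at this
      exact Submodule.smul_mem _ _ this
  · rintro (n | n)
    all_goals
      simp only [Sum.elim_inl, Sum.elim_inr, Finsupp.linearCombination_single,
        T_pow_succ_apply, map_smul, smul_smul, ← sgn_add]
      push_cast
      rw [one_mul, show d + (n : ℤ) * d = ((n : ℤ) + 1) * d by ring]
  · rintro (n | n)
    · rw [← res_T_pow_gen, lin_T_pow, lin_T_pow, ← map_sub, h]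
      simp only [Sum.elim_inl, map_smul, sgn_T_pow_diff]
      simp
    · rw [← res_T_pow_rel, lin_T_pow, lin_T_pow, ← map_sub, h']
      simp only [Sum.elim_inr, map_smul, sgn_T_pow_diff, map_add, Sum.elim_inl,
        Finsupp.linearCombination_single, T_pow_add_apply, smul_smul]
      rw [Nat.cast_add n (r + 1), add_mul (n : ℤ), sgn_add, ← mul_assoc, sgn_mul_self, one_mul]

lemma exists_of_res_homotopic {N : DGMod k d} {f g : res k d r i ⟶ N}
    (h : homotopic k d f g) : ∃ a ∈ N.gr (i + 1), ∃ b ∈ N.gr (i + (r + 1) * d + 1 + 1),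
      lin f (resGen r i) - lin g (resGen r i) = N.diff a ∧
      lin f (resRel r i) - lin g (resRel r i) =
        N.diff b + sgn k ((r + 1 : ℕ) * d) • (N.T ^ (r + 1)) a := by
  obtain ⟨h, h1, h2, h3⟩ := h
  refine ⟨h (resGen r i), h1 _ _ resGen_mem, h (resRel r i), h1 _ _ resRel_mem, ?_, ?_⟩
  · rw [h3, diff_resGen, map_zero, add_zero]
  · rw [h3, diff_resRel, homotopy_T_pow h2]

/-- A morphism from `res r i` is a cycle x together with some y bounding T^(r+1) x. Lifting takes
two rounds: x lifts up to a boundary, then y is corrected by a cycle. Uniqueness follows the same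
pattern one degree higher. -/
lemma kProj_res : KProj (res k d r i) := by
  intro N N' s hs
  refine ⟨fun f => ?_, fun g hg => ?_⟩
  · obtain ⟨x, hx, z, hz, hx', h⟩ := hs.exists_cycle (lin_resGen_mem f) (diff_lin_resGen f)
    -- Moving the first datum along z forces this correction of the second one. Its boundary shows
    -- that T^(r+1) x maps to a boundary, so it is already a boundary in N.
    have hT : N'.diff (lin f (resRel r i) + sgn k ((r + 1 : ℕ) * d) • (N'.T ^ (r + 1)) z) =
        lin s ((N.T ^ (r + 1)) x) := by
      rw [map_add, map_smul, sgn_T_pow_diff, h, diff_lin_resRel, lin_T_pow, map_sub]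
      abel
    have hz2 : (N'.T ^ (r + 1)) z ∈ N'.gr (i + (r + 1) * d + 1) := by
      have := T_pow_mem N' (r + 1) hz
      rwa [show i + 1 + ((r + 1 : ℕ) : ℤ) * d = i + (r + 1) * d + 1 by push_cast; ring] at this
    obtain ⟨y, hy, hy'⟩ := hs.exists_boundary (i := i + (r + 1) * d)
      (by simpa using T_pow_mem N (r + 1) hx) (diff_T_pow_eq_zero N _ hx') ⟨_, hT⟩
    obtain ⟨c, hc, b, hb, hc', h'⟩ := hs.exists_cycle
      (y := lin s y - (lin f (resRel r i) + sgn k ((r + 1 : ℕ) * d) • (N'.T ^ (r + 1)) z))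
      (Submodule.sub_mem _ (lin_mem s hy)
        (Submodule.add_mem _ (lin_resRel_mem f) (Submodule.smul_mem _ _ hz2)))
      (by rw [map_sub, hT, ← lin_diff, hy', sub_self])
    refine ⟨resHom N x (y - c) hx hx' (Submodule.sub_mem _ hy hc) (by rw [map_sub, hy', hc', sub_zero]),
      res_homotopic hz (Submodule.neg_mem _ hb) ?_ ?_⟩
    · rw [lin_comp, LinearMap.comp_apply, resHom_gen, h]
    · rw [lin_comp, LinearMap.comp_apply, resHom_rel, map_neg, h', map_sub]
      abel
  · obtain ⟨a', ha', b', hb', h, h'⟩ := exists_of_res_homotopic hg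
    simp only [lin_comp, LinearMap.comp_apply, lin_zero, LinearMap.zero_apply, sub_zero] at h h'
    obtain ⟨a, ha, h1⟩ := hs.exists_boundary (lin_resGen_mem g) (diff_lin_resGen g) ⟨a', h.symm⟩
    -- Both `lin s a` and a' bound the image of the same element, so they differ by a cycle.
    -- Subtracting a suitable cycle c from a makes them agree up to the boundary of e.
    obtain ⟨c, hc, e, -, hc', he⟩ := hs.exists_cycle (y := lin s a - a')
      (Submodule.sub_mem _ (lin_mem s ha) ha') (by rw [map_sub, ← lin_diff, h1, h, sub_self])
    have hac : (N.T ^ (r + 1)) (a - c) ∈ N.gr (i + (r + 1) * d + 1) := by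
      have := T_pow_mem N (r + 1) (Submodule.sub_mem _ ha hc)
      rwa [show i + 1 + ((r + 1 : ℕ) : ℤ) * d = i + (r + 1) * d + 1 by push_cast; ring] at this
    have hd : N.diff (a - c) = lin g (resGen r i) := by rw [map_sub, hc', h1, sub_zero]
    have hs' : lin s (a - c) = a' - N'.diff e := by rw [he, map_sub]; abel
    obtain ⟨b, hb, h2⟩ := hs.exists_boundary
      (x := lin g (resRel r i) - sgn k ((r + 1 : ℕ) * d) • (N.T ^ (r + 1)) (a - c))
      (Submodule.sub_mem _ (lin_resRel_mem g) (Submodule.smul_mem _ _ hac))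
      (by rw [map_sub, map_smul, sgn_T_pow_diff, hd, diff_lin_resRel, sub_self])
      ⟨b' + (N'.T ^ (r + 1)) e, by
        rw [map_sub, h', map_smul, lin_T_pow, hs', map_sub, ← sgn_T_pow_diff, smul_sub,
          sgn_smul_sgn_smul, map_add]
        abel⟩
    exact res_homotopic (Submodule.sub_mem _ ha hc) hb (by rw [hd]; simp) (by rw [h2]; simp)

end Res

end DGMod

namespace DGMod

variable {k : Type u} [Field k] {d : ℤ}

/-! ### The truncated polynomial algebras -/

/-- The element `T ^ m` of `A / T ^ (r + 1)`. -/
def truncPow (k : Type u) [Field k] (r m : ℕ) : Fin (r + 1) →₀ k :=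
  if h : m < r + 1 then Finsupp.single ⟨m, h⟩ 1 else 0

lemma truncPow_coe (r : ℕ) (a : Fin (r + 1)) : truncPow k r a = Finsupp.single a 1 := by
  simp [truncPow, a.2]

lemma truncPow_of_lt {r m : ℕ} (h : r < m) : truncPow k r m = 0 := by
  simp [truncPow]
  omega

lemma truncPow_ne_zero {r m : ℕ} (h : m ≤ r) : truncPow k r m ≠ 0 := by
  rw [truncPow, dif_pos (by omega)]
  simp

variable (k d)

/-- The DG module `Σ ^ i (A / T ^ (r + 1))` with zero differential. -/
abbrev cyc (r : ℕ) (i : ℤ) : DGMod k d :=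
  ofBasis (ι := Fin (r + 1)) (fun a => i + a * d) (fun a => truncPow k r (a + 1)) 0
    (fun a => by
      by_cases h : (a : ℕ) + 1 < r + 1
      · rw [truncPow, dif_pos h]
        exact single_mem_basisGr (by push_cast; ring) _
      · rw [truncPow, dif_neg h]
        exact Submodule.zero_mem _)
    (fun _ => Submodule.zero_mem _) (fun _ => by simp) (fun _ => by simp)

variable {k d}

section Cyc

variable {r : ℕ} {i : ℤ}

/-- The generator of `Σ ^ i (A / T ^ (r + 1))`. -/
def cycGen (r : ℕ) (i : ℤ) : (cyc k d r i).carrier := truncPow k r 0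

lemma cyc_T_pow_gen (m : ℕ) : ((cyc k d r i).T ^ m) (cycGen r i) = truncPow k r m := by
  induction m with
  | zero => rfl
  | succ m ih =>
    rw [T_pow_succ_apply, ih]
    by_cases h : m < r + 1
    · simp [truncPow, h]
    · rw [truncPow_of_lt (by omega : r < m), map_zero, truncPow_of_lt (by omega)]

lemma cycGen_mem : cycGen r i ∈ (cyc k d r i).gr i := by
  rw [cycGen, truncPow, dif_pos (by omega)]
  exact single_mem_basisGr (by simp) _

lemma cyc_diff (x : (cyc k d r i).carrier) : (cyc k d r i).diff x = 0 := by
  simp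

lemma cyc_T_pow_eq_zero {m : ℕ} (h : r < m) (x : (cyc k d r i).carrier) :
    ((cyc k d r i).T ^ m) x = 0 := by
  refine finsupp_map_eq (f := (cyc k d r i).T ^ m) (g := 0) (fun a => ?_) x
  rw [← truncPow_coe, ← cyc_T_pow_gen (d := d) (i := i), ← T_pow_add_apply, cyc_T_pow_gen,
    truncPow_of_lt (by omega)]
  rfl

/-- The homogeneous elements of `Σ ^ i (A / T ^ (r + 1))`. -/
lemma cyc_gr (hd : d ≠ 0) {j : ℤ} {x : (cyc k d r i).carrier} (hx : x ∈ (cyc k d r i).gr j) :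
    x = 0 ∨ ∃ m : ℕ, m ≤ r ∧ j = i + m * d ∧
      ∃ c : k, x = c • ((cyc k d r i).T ^ m) (cycGen r i) := by
  by_cases h : ∃ a : Fin (r + 1), i + a * d = j
  · obtain ⟨a, ha⟩ := h
    refine Or.inr ⟨a, by omega, ha.symm, (show Fin (r + 1) →₀ k from x) a, ?_⟩
    rw [cyc_T_pow_gen, truncPow_coe]
    refine Finsupp.ext fun b => ?_
    by_cases hb : b = a
    · subst hb
      simp
    · have h1 : i + b * d ≠ j := by
        rw [← ha]
        intro h
        have h' : ((b : ℕ) : ℤ) * d = ((a : ℕ) : ℤ) * d := by linarith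
        have := mul_right_cancel₀ hd h'
        exact hb (Fin.ext (by exact_mod_cast this))
      rw [mem_basisGr.1 hx b h1]
      simp [Ne.symm hb]
  · push Not at h
    exact Or.inl (Finsupp.ext fun a => mem_basisGr.1 hx a (h a))

end Cyc

/-- A shift by `r + 1` of basis elements, sending those of smaller index to zero. -/
def dropBasis (k : Type u) [Field k] (d : ℤ) (r m : ℕ) : ℕ ⊕ ℕ →₀ k :=
  if r + 1 ≤ m then Finsupp.single (Sum.inr (m - (r + 1))) (sgn k ((m - (r + 1) : ℕ) * d)) else 0

lemma dropBasis_add (r n : ℕ) : dropBasis k d r (n + (r + 1)) =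
    Finsupp.single (Sum.inr n) (sgn k (n * d)) := by
  simp [dropBasis]

lemma dropBasis_of_le {r m : ℕ} (h : m ≤ r) : dropBasis k d r m = 0 := by
  rw [dropBasis, if_neg (by omega)]

section Res

variable {r : ℕ} {i : ℤ}

/-- The augmentation of the semifree resolution. -/
def resAug (r : ℕ) (i : ℤ) : res k d r i ⟶ cyc k d r i :=
  resHom _ (cycGen r i) 0 cycGen_mem (cyc_diff _) (Submodule.zero_mem _)
    (by rw [cyc_T_pow_eq_zero (by omega), map_zero])

lemma resAug_gen : lin (resAug (k := k) (d := d) r i) (resGen r i) = cycGen r i :=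
  resHom_gen _ _ _ _ _ _ _

lemma resAug_inl (m : ℕ) : lin (resAug (k := k) (d := d) r i)
    (Finsupp.single (Sum.inl m) 1 : ℕ ⊕ ℕ →₀ k) = truncPow k r m := by
  rw [← res_T_pow_gen, lin_T_pow, resAug, resHom_gen, cyc_T_pow_gen]

lemma resAug_inr (m : ℕ) : lin (resAug (k := k) (d := d) r i)
    (Finsupp.single (Sum.inr m) 1 : ℕ ⊕ ℕ →₀ k) = 0 := by
  rw [← res_T_pow_rel, lin_T_pow, resAug, resHom_rel, map_zero]

lemma isQis_resAug : IsQis (resAug (k := k) (d := d) r i) := by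
  -- `σ` is the k-linear section sending T^a to T^a. The contraction `s` inverts the differential on
  -- T^m times the generating cycle for m > r, and vanishes for m ≤ r, where the augmentation is
  -- injective.
  let σ : (Fin (r + 1) →₀ k) →ₗ[k] (ℕ ⊕ ℕ →₀ k) :=
    Finsupp.linearCombination k fun a => Finsupp.single (Sum.inl (a : ℕ)) 1
  let s : (ℕ ⊕ ℕ →₀ k) →ₗ[k] (ℕ ⊕ ℕ →₀ k) :=
    Finsupp.linearCombination k (Sum.elim (dropBasis k d r) 0)
  refine isQis_of_homotopy_inverse (M := res k d r i) (N := cyc k d r i) (resAug r i) σ s 0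
    ?_ ?_ ?_
  · exact finsupp_map_eq (f := (res k d r i).diff ∘ₗ σ) (g := σ ∘ₗ (cyc k d r i).diff)
      fun a => by simp [σ]
  · refine finsupp_map_eq (f := (res k d r i).diff ∘ₗ s + s ∘ₗ (res k d r i).diff)
      (g := LinearMap.id - σ ∘ₗ lin (resAug r i)) ?_
    rintro (m | m)
    · simp only [LinearMap.add_apply, LinearMap.sub_apply, LinearMap.comp_apply,
        LinearMap.id_apply]
      rw [resAug_inl]
      by_cases h : m ≤ r
      · rw [truncPow, dif_pos (by omega)]
        simp [s, σ, dropBasis_of_le h]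
      · obtain ⟨n, rfl⟩ : ∃ n, m = n + (r + 1) := ⟨m - (r + 1), by omega⟩
        rw [truncPow_of_lt (by omega)]
        simp [s, dropBasis_add]
    · simp only [LinearMap.add_apply, LinearMap.sub_apply, LinearMap.comp_apply,
        LinearMap.id_apply]
      rw [resAug_inr]
      simp [s, dropBasis_add]
  · refine finsupp_map_eq (f := (cyc k d r i).diff ∘ₗ 0 + 0 ∘ₗ (cyc k d r i).diff)
      (g := lin (resAug r i) ∘ₗ σ - LinearMap.id) fun a => ?_
    have : σ (Finsupp.single a 1) = Finsupp.single (Sum.inl (a : ℕ)) 1 := by simp [σ]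
    simp only [LinearMap.add_apply, LinearMap.sub_apply, LinearMap.comp_apply, LinearMap.id_apply,
      this]
    rw [resAug_inl, truncPow_coe]
    simp

end Res

/-! ### Coresolutions -/

/-- The predecessor on basis elements, sending `0` to zero. -/
def predBasis (k : Type u) [Field k] (f : ℕ → ℕ ⊕ ℕ) : ℕ → ℕ ⊕ ℕ →₀ k
  | 0 => 0
  | n + 1 => Finsupp.single (f n) 1

variable (k d)

/-- The dual analogue of `res r i`, which is quasi-isomorphic to `Σ ^ i (A / T ^ (r + 1))` as well.
Maps into it are easy to construct. -/
abbrev cores (r : ℕ) (i : ℤ) : DGMod k d :=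
  ofBasis (ι := ℕ ⊕ ℕ)
    -- `inl n` and `inr n` are dual to T^n in two shifted graded duals of A, so T lowers the index.
    -- The cycles among the `inl n` are those with n ≤ r; they form the copy of A/T^(r+1), with
    -- generator `inl r` in degree i.
    (Sum.elim (fun n => i + r * d - n * d) (fun n => i - 1 - (n + 1) * d))
    (Sum.elim (predBasis k Sum.inl) (predBasis k Sum.inr))
    (Sum.elim (dropBasis k d r) 0)
    (by
      rintro ((_ | n) | (_ | n))
      · exact Submodule.zero_mem _
      · exact single_mem_basisGr (by simp; ring) _
      · exact Submodule.zero_mem _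
      · exact single_mem_basisGr (by simp; ring) _)
    (by
      rintro (m | m)
      · by_cases h : m ≤ r
        · simp only [Sum.elim_inl, dropBasis_of_le h]
          exact Submodule.zero_mem _
        · obtain ⟨n, rfl⟩ : ∃ n, m = n + (r + 1) := ⟨m - (r + 1), by omega⟩
          simp only [Sum.elim_inl, dropBasis_add]
          exact single_mem_basisGr (by simp; ring) _
      · exact Submodule.zero_mem _)
    (by
      rintro (m | m)
      · by_cases h : m ≤ r
        · simp [dropBasis_of_le h]
        · obtain ⟨n, rfl⟩ : ∃ n, m = n + (r + 1) := ⟨m - (r + 1), by omega⟩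
          simp [dropBasis_add]
      · simp)
    (by
      rintro ((_ | m) | (_ | m))
      · simp [predBasis, dropBasis_of_le]
      · by_cases h : m + 1 ≤ r
        · simp [predBasis, dropBasis_of_le h, dropBasis_of_le (show m ≤ r by omega)]
        · obtain ⟨n, hn⟩ : ∃ n, m + 1 = n + (r + 1) := ⟨m - r, by omega⟩
          simp only [Sum.elim_inl, hn, dropBasis_add]
          rw [← hn]
          rcases n with _ | n
          · simp [predBasis, dropBasis_of_le (show m ≤ r by omega)]
          · obtain rfl : m = n + (r + 1) := by omega
            simp only [predBasis, Finsupp.linearCombination_single, Sum.elim_inl, dropBasis_add,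
              Sum.elim_inr, one_smul, Finsupp.smul_single, smul_eq_mul, mul_one, ← sgn_add]
            rw [show d + ((n + 1 : ℕ) : ℤ) * d = n * d + (d + d) by push_cast; ring, sgn_add,
              sgn_add k d d, sgn_mul_self, mul_one]
      · simp [predBasis]
      · simp [predBasis])

variable {k d}

section Cores

variable {r : ℕ} {i : ℤ}

/-- The coefficients of an element of `cores r i`. -/
def coresCoeff (a : ℕ ⊕ ℕ) : (cores k d r i).carrier →ₗ[k] k := Finsupp.lapply a

lemma cores_T_inl (x : (cores k d r i).carrier) (n : ℕ) :
    (show ℕ ⊕ ℕ →₀ k from (cores k d r i).T x) (Sum.inl n) =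
      coresCoeff (Sum.inl (n + 1)) (x) := by
  refine finsupp_map_eq (f := coresCoeff (Sum.inl n) ∘ₗ (cores k d r i).T)
    (g := coresCoeff (Sum.inl (n + 1))) ?_ x
  rintro ((_ | m) | (_ | m)) <;> simp [predBasis, coresCoeff, Finsupp.single_apply]

lemma cores_T_inr (x : (cores k d r i).carrier) (n : ℕ) :
    (show ℕ ⊕ ℕ →₀ k from (cores k d r i).T x) (Sum.inr n) =
      coresCoeff (Sum.inr (n + 1)) (x) := by
  refine finsupp_map_eq (f := coresCoeff (Sum.inr n) ∘ₗ (cores k d r i).T)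
    (g := coresCoeff (Sum.inr (n + 1))) ?_ x
  rintro ((_ | m) | (_ | m)) <;> simp [predBasis, coresCoeff, Finsupp.single_apply]

lemma cores_diff_inl (x : (cores k d r i).carrier) (n : ℕ) :
    (show ℕ ⊕ ℕ →₀ k from (cores k d r i).diff x) (Sum.inl n) = 0 := by
  refine finsupp_map_eq (f := coresCoeff (Sum.inl n) ∘ₗ (cores k d r i).diff)
    (g := 0) ?_ x
  rintro (m | m)
  · by_cases h : m ≤ r
    · simp [coresCoeff, dropBasis_of_le h]
    · obtain ⟨n, rfl⟩ : ∃ n, m = n + (r + 1) := ⟨m - (r + 1), by omega⟩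
      simp [coresCoeff, dropBasis_add]
  · simp [coresCoeff]

lemma cores_diff_inr (x : (cores k d r i).carrier) (n : ℕ) :
    (show ℕ ⊕ ℕ →₀ k from (cores k d r i).diff x) (Sum.inr n) =
      sgn k (n * d) * coresCoeff (Sum.inl (n + (r + 1))) (x) := by
  refine finsupp_map_eq (f := coresCoeff (Sum.inr n) ∘ₗ (cores k d r i).diff)
    (g := sgn k (n * d) • coresCoeff (Sum.inl (n + (r + 1)))) ?_ x
  rintro (m | m)
  · by_cases h : m ≤ r
    · simp [coresCoeff, dropBasis_of_le h, Finsupp.single_apply]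
      omega
    · obtain ⟨m, rfl⟩ : ∃ n, m = n + (r + 1) := ⟨m - (r + 1), by omega⟩
      by_cases h : m = n
      · simp [coresCoeff, dropBasis_add, h]
      · simp [coresCoeff, dropBasis_add, h]
  · simp [coresCoeff]

/-- The coaugmentation. -/
def coresAug (r : ℕ) (i : ℤ) : cyc k d r i ⟶ cores k d r i :=
  homOfBasis _ (fun a => (Finsupp.single (Sum.inl (r - a)) 1 : ℕ ⊕ ℕ →₀ k))
    (fun a => single_mem_basisGr (by
      rw [Sum.elim_inl, Nat.cast_sub (by omega)]
      ring) _)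
    (fun a => by
      rw [truncPow]
      split_ifs with h
      · obtain ⟨m, hm⟩ : ∃ m, r - a = m + 1 := ⟨r - a - 1, by omega⟩
        simp [hm, predBasis, show r - (a + 1) = m by omega]
      · simp [show r - a = 0 by omega, predBasis])
    (fun a => by simp [dropBasis_of_le])

/-- `ρ` inverts the coaugmentation on `inl n` for n ≤ r. The remaining basis elements `inl (n + (r +
1))` and `inr n` cancel in pairs, which is what `t` records. -/
lemma isQis_coresAug : IsQis (coresAug (k := k) (d := d) r i) := by
  have hι : ∀ a : Fin (r + 1), lin (coresAug (k := k) (d := d) r i) (Finsupp.single a 1 : _ →₀ k) =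
      (Finsupp.single (Sum.inl (r - a)) 1 : ℕ ⊕ ℕ →₀ k) := fun a => by simp [coresAug]
  let ρ : (ℕ ⊕ ℕ →₀ k) →ₗ[k] (Fin (r + 1) →₀ k) := Finsupp.linearCombination k
    (Sum.elim (fun n => if n ≤ r then truncPow k r (r - n) else 0) 0)
  let t : (ℕ ⊕ ℕ →₀ k) →ₗ[k] (ℕ ⊕ ℕ →₀ k) := -Finsupp.linearCombination k (Sum.elim 0
    (fun n => Finsupp.single (Sum.inl (n + (r + 1))) (sgn k (n * d))))
  refine isQis_of_homotopy_inverse (M := cyc k d r i) (N := cores k d r i) (coresAug r i) ρ 0 t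
    ?_ ?_ ?_
  · refine finsupp_map_eq (f := (cyc k d r i).diff ∘ₗ ρ) (g := ρ ∘ₗ (cores k d r i).diff) ?_
    rintro (m | m)
    · by_cases h : m ≤ r
      · simp [dropBasis_of_le h]
      · obtain ⟨n, rfl⟩ : ∃ n, m = n + (r + 1) := ⟨m - (r + 1), by omega⟩
        simp [ρ, dropBasis_add]
    · simp
  · refine finsupp_map_eq (f := (cyc k d r i).diff ∘ₗ 0 + 0 ∘ₗ (cyc k d r i).diff)
      (g := LinearMap.id - ρ ∘ₗ lin (coresAug r i)) fun a => ?_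
    simp only [LinearMap.add_apply, LinearMap.sub_apply, LinearMap.comp_apply, LinearMap.id_apply]
    rw [hι]
    simp [ρ, show r - (r - (a : ℕ)) = a by omega, truncPow_coe]
  · refine finsupp_map_eq (f := (cores k d r i).diff ∘ₗ t + t ∘ₗ (cores k d r i).diff)
      (g := lin (coresAug r i) ∘ₗ ρ - LinearMap.id) ?_
    rintro (m | m)
    · by_cases h : m ≤ r
      · have : ρ (Finsupp.single (Sum.inl m) 1) = Finsupp.single ⟨r - m, by omega⟩ 1 := by
          simp only [ρ, Finsupp.linearCombination_single, one_smul, Sum.elim_inl, if_pos h]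
          rw [truncPow, dif_pos (by omega)]
        simp only [LinearMap.add_apply, LinearMap.sub_apply, LinearMap.comp_apply,
          LinearMap.id_apply, this]
        rw [hι]
        simp [t, dropBasis_of_le h, show r - (r - m) = m by omega]
      · have : ρ (Finsupp.single (Sum.inl m) 1) = 0 := by
          simp only [ρ, Finsupp.linearCombination_single, one_smul, Sum.elim_inl, if_neg h]
        obtain ⟨n, rfl⟩ : ∃ n, m = n + (r + 1) := ⟨m - (r + 1), by omega⟩
        simp only [LinearMap.add_apply, LinearMap.sub_apply, LinearMap.comp_apply,
          LinearMap.id_apply, this]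
        rw [map_zero]
        simp [t, dropBasis_add]
    · have : ρ (Finsupp.single (Sum.inr m) 1) = 0 := by simp [ρ]
      simp only [LinearMap.add_apply, LinearMap.sub_apply, LinearMap.comp_apply,
        LinearMap.id_apply, this]
      rw [map_zero]
      simp [t, dropBasis_add]

/-- Maps into `cores r i` from linear forms. -/
lemma exists_hom_cores (hd : d ≠ 0) (Z : DGMod k d) (F G : Z.carrier →ₗ[k] k)
    (hF : ∀ j, ∀ x ∈ Z.gr j, j ≠ i + r * d → F x = 0)
    (hG : ∀ j, ∀ x ∈ Z.gr j, j ≠ i - 1 - d → G x = 0) (hF' : ∀ x, F (Z.diff x) = 0)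
    (hFG : ∀ x, G (Z.diff x) = F ((Z.T ^ (r + 1)) x)) :
    ∃ φ : Z ⟶ cores k d r i, ∀ x n,
      coresCoeff (Sum.inl n) (lin φ x) = F ((Z.T ^ n) x) := by
  -- F lives in one degree and d ≠ 0, so for homogeneous x at most one n gives a non-zero F(T^n x).
  -- Hence the prescribed coefficients have finite support.
  have fin : ∀ (F : Z.carrier →ₗ[k] k) (e : ℤ), (∀ j, ∀ x ∈ Z.gr j, j ≠ e → F x = 0) →
      ∀ x, {n : ℕ | F ((Z.T ^ n) x) ≠ 0}.Finite := by
    intro F e hF x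
    induction x using homogeneous_induction with
    | h0 => simp
    | hadd x y hx hy =>
      refine (hx.union hy).subset fun n hn => ?_
      by_contra h
      simp only [Set.mem_union, Set.mem_ofPred_eq, not_or, not_not] at h
      exact hn (by rw [map_add, map_add, h.1, h.2, add_zero])
    | hmem j x hx =>
      refine Set.Subsingleton.finite fun m hm n hn => ?_
      have key : ∀ n : ℕ, F ((Z.T ^ n) x) ≠ 0 → j + n * d = e := fun n hn => by
        by_contra h
        exact hn (hF _ _ (T_pow_mem Z n hx) h)
      have h : (m : ℤ) * d = n * d := by linarith [key m hm, key n hn]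
      exact_mod_cast mul_right_cancel₀ hd h
  have hfin : ∀ x, (Function.support (Sum.elim (fun n : ℕ => F ((Z.T ^ n) x))
      (fun n : ℕ => G ((Z.T ^ n) x)))).Finite := by
    intro x
    refine (((fin F _ hF x).image Sum.inl).union ((fin G _ hG x).image Sum.inr)).subset ?_
    rintro (n | n) hn
    · exact Or.inl ⟨n, hn, rfl⟩
    · exact Or.inr ⟨n, hn, rfl⟩
  have hval : ∀ x a, Finsupp.ofSupportFinite _ (hfin x) a =
      Sum.elim (fun n : ℕ => F ((Z.T ^ n) x)) (fun n : ℕ => G ((Z.T ^ n) x)) a := fun _ _ => rfl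
  let f : Z.carrier →ₗ[k] (ℕ ⊕ ℕ →₀ k) :=
    { toFun := fun x => Finsupp.ofSupportFinite _ (hfin x)
      map_add' := fun x y => Finsupp.ext fun a => by
        rw [Finsupp.add_apply, hval, hval, hval]
        rcases a with n | n <;> simp
      map_smul' := fun c x => Finsupp.ext fun a => by
        rw [Finsupp.smul_apply, hval, hval]
        rcases a with n | n <;> simp }
  have fl : ∀ x n, f x (Sum.inl n) = F ((Z.T ^ n) x) := fun _ _ => rfl
  have fr : ∀ x n, f x (Sum.inr n) = G ((Z.T ^ n) x) := fun _ _ => rfl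
  refine ⟨mkHom (N := cores k d r i) f (fun j x hx => mem_basisGr.2 ?_)
    (fun x => Finsupp.ext ?_) (fun x => Finsupp.ext ?_), fl⟩
  · rintro (n | n) h
    · rw [fl]
      refine hF _ _ (T_pow_mem Z n hx) fun h' => h ?_
      rw [Sum.elim_inl]
      linarith
    · rw [fr]
      refine hG _ _ (T_pow_mem Z n hx) fun h' => h ?_
      rw [Sum.elim_inr]
      linarith
  · rintro (n | n)
    · refine Eq.trans ?_ (cores_T_inl (f x) n).symm
      exact fl x (n + 1)
    · refine Eq.trans ?_ (cores_T_inr (f x) n).symm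
      exact fr x (n + 1)
  · rintro (n | n)
    · refine Eq.trans ?_ (cores_diff_inl (f x) n).symm
      rw [fl, ← sgn_T_pow_diff, map_smul, hF', smul_zero]
    · refine Eq.trans ?_ (cores_diff_inr (f x) n).symm
      change _ = sgn k (n * d) * f x (Sum.inl (n + (r + 1)))
      rw [fr, fl, ← sgn_T_pow_diff, map_smul, hFG, ← T_pow_add_apply, add_comm (r + 1), smul_eq_mul]

lemma pr_T_pow (M : DGMod k d) (n : ℕ) (j : ℤ) (x : M.carrier) :
    M.pr (j + n * d) ((M.T ^ n) x) = (M.T ^ n) (M.pr j x) :=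
  pr_map (N := M) (M.T ^ n) (n * d) (fun _ _ hx => T_pow_mem M n hx) j x

/-- A cycle `x` such that the class of `T ^ r x` is not divisible by `T ^ (r + 1)` is detected by a
morphism to `cores r i`. -/
lemma exists_hom_cores_of_pure (hd : d ≠ 0) (Z : DGMod k d) {x : Z.carrier} (hx : x ∈ Z.gr i)
    (h : ∀ c b, Z.diff c = 0 → (Z.T ^ r) x ≠ (Z.T ^ (r + 1)) c + Z.diff b) :
    ∃ φ : Z ⟶ cores k d r i, ∀ a, lin φ x ≠ (cores k d r i).diff a := by
  -- Purity says that T^r x avoids the subspace T^(r+1)(cycles) + boundaries, so a linear form f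
  -- separates it from that subspace.
  have hW : (Z.T ^ r) x ∉
      (LinearMap.ker Z.diff).map (Z.T ^ (r + 1)) ⊔ LinearMap.range Z.diff := by
    rw [Submodule.mem_sup]
    rintro ⟨_, ⟨c, hc, rfl⟩, _, ⟨b, rfl⟩, hcb⟩
    exact h c b hc hcb.symm
  obtain ⟨f, hf, hW⟩ := Submodule.exists_le_ker_of_notMem hW
  have hfd : ∀ b, f (Z.diff b) = 0 := fun b =>
    hW (Submodule.mem_sup_right ⟨b, rfl⟩)
  have hfT : ∀ c, Z.diff c = 0 → f ((Z.T ^ (r + 1)) c) = 0 := fun c hc =>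
    hW (Submodule.mem_sup_left ⟨c, hc, rfl⟩)
  let F := f ∘ₗ Z.pr (i + r * d)
  have hF : ∀ j, ∀ x ∈ Z.gr j, j ≠ i + r * d → F x = 0 := fun j x hx hj => by
    simp only [F, LinearMap.comp_apply, pr_of_mem_ne _ hx hj, map_zero]
  have hFT : ∀ y, F ((Z.T ^ (r + 1)) y) = f ((Z.T ^ (r + 1)) (Z.pr (i - d) y)) := fun y => by
    rw [← pr_T_pow]
    simp only [F, LinearMap.comp_apply]
    rw [show i - d + ((r + 1 : ℕ) : ℤ) * d = i + r * d by push_cast; ring]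
  -- The second linear form must satisfy g ∘ ∂ = F ∘ T^(r+1). It exists because the right-hand side
  -- kills all cycles and hence factors through ∂.
  have hF0 : F ∘ₗ (Z.T ^ (r + 1)) ∈ (LinearMap.ker Z.diff).dualAnnihilator := by
    rw [Submodule.mem_dualAnnihilator]
    intro c hc
    rw [LinearMap.comp_apply, hFT]
    exact hfT _ (by rw [← pr_diff, hc, map_zero])
  rw [← LinearMap.range_dualMap_eq_dualAnnihilator_ker] at hF0
  obtain ⟨g, hg⟩ := hF0
  have hg' : ∀ y, g (Z.diff y) = F ((Z.T ^ (r + 1)) y) := LinearMap.congr_fun hg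
  obtain ⟨φ, hφ⟩ := exists_hom_cores (r := r) (i := i) hd Z F (g ∘ₗ Z.pr (i - 1 - d)) hF
    (fun j x hx hj => by rw [LinearMap.comp_apply, pr_of_mem_ne _ hx hj, map_zero])
    (fun y => by
      have := pr_diff Z (i + r * d + 1) y
      rw [add_sub_cancel_right] at this
      simp only [F, LinearMap.comp_apply]
      rw [this, hfd])
    (fun y => by
      have := pr_diff Z (i - d) y
      rw [show i - d - 1 = i - 1 - d by ring] at this
      rw [LinearMap.comp_apply, this, hg', hFT, hFT, pr_of_mem _ (pr_mem _ _ _)])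
  -- The coefficient of φ(x) at `inl r` is f(T^r x) ≠ 0, whereas boundaries in `cores r i` have no
  -- `inl` coefficients.
  refine ⟨φ, fun a ha => hf ?_⟩
  have h1 := hφ x r
  rw [ha] at h1
  have h2 := h1.symm.trans (cores_diff_inl a r)
  simpa only [F, LinearMap.comp_apply, pr_of_mem _ (T_pow_mem Z r hx)] using h2

end Cores

end DGMod

/-! ### Morphisms in the derived category -/

namespace DerCat

open DGMod

variable {k : Type u} [Field k] {d : ℤ}

lemma exists_proj_obj_eq (Z : DerCat k d) : ∃ M : DGMod k d, (proj k d).obj M = Z := by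
  obtain ⟨⟨M⟩, rfl⟩ := (Localization.Construction.objEquiv (HoCat.qis k d)).surjective Z
  exact ⟨M, rfl⟩

lemma isIso_proj_map {M N : DGMod k d} {f : M ⟶ N} (hf : IsQis f) : IsIso ((proj k d).map f) :=
  Localization.inverts (HoCat.qis k d).Q (HoCat.qis k d) _ ((HoCat.qis_proj_map_iff f).2 hf)

lemma proj_map_eq {M N : DGMod k d} {f g : M ⟶ N} (h : homotopic k d f g) :
    (proj k d).map f = (proj k d).map g :=
  congrArg (HoCat.qis k d).Q.map (CategoryTheory.Quotient.sound _ h)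

/-- A morphism of the localization is a left fraction, that is some a followed by the inverse of a
quasi-isomorphism s. Lifting a along s turns it into a morphism of DG modules. -/
lemma exists_proj_map_eq {P : DGMod k d} (hP : KProj P) {N : DGMod k d}
    (f : (proj k d).obj P ⟶ (proj k d).obj N) : ∃ g : P ⟶ N, (proj k d).map g = f := by
  obtain ⟨φ, hφ⟩ := Localization.exists_leftFraction (HoCat.qis k d).Q (HoCat.qis k d)
    (X := (HoCat.proj k d).obj P) (Y := (HoCat.proj k d).obj N) f
  obtain ⟨a, s, hs⟩ := φ
  rename_i N'
  obtain ⟨N'⟩ := N'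
  obtain ⟨a, rfl⟩ := (HoCat.proj k d).map_surjective (X := P) (Y := N') a
  obtain ⟨s, rfl⟩ := (HoCat.proj k d).map_surjective (X := N) (Y := N') s
  have hs' := (HoCat.qis_proj_map_iff s).1 hs
  obtain ⟨g, hg⟩ := (hP s hs').1 a
  refine ⟨g, ?_⟩
  have : IsIso ((proj k d).map s) := isIso_proj_map hs'
  rw [← cancel_mono ((proj k d).map s), ← Functor.map_comp, proj_map_eq hg, hφ]
  exact (MorphismProperty.LeftFraction.map_comp_map_s
    (MorphismProperty.LeftFraction.mk _ _ hs) (HoCat.qis k d).Q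
    (Localization.inverts _ _)).symm

/-- By the calculus of left fractions, f becomes zero in the homotopy category after composition
with some quasi-isomorphism, and `KProj` cancels that quasi-isomorphism. -/
lemma homotopic_zero_of_proj_map {P : DGMod k d} (hP : KProj P) {N : DGMod k d} {f : P ⟶ N}
    (h : (proj k d).map f = 0) : homotopic k d f 0 := by
  have h' : (HoCat.qis k d).Q.map ((HoCat.proj k d).map f) = (HoCat.qis k d).Q.map 0 := by
    rw [Functor.map_zero]
    exact h
  rw [MorphismProperty.map_eq_iff_postcomp _ (HoCat.qis k d)] at h'
  obtain ⟨⟨N'⟩, s, hs, h'⟩ := h'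
  obtain ⟨s, rfl⟩ := (HoCat.proj k d).map_surjective (X := N) (Y := N') s
  refine (hP s ((HoCat.qis_proj_map_iff s).1 hs)).2 f ?_
  rw [zero_comp, ← Functor.map_comp] at h'
  refine (CategoryTheory.Quotient.functor_map_eq_iff (homotopic k d) (f ≫ s) 0).1 ?_
  exact h'.trans ((HoCat.proj k d).map_zero _ _).symm

lemma homotopic_of_proj_map_eq {P : DGMod k d} (hP : KProj P) {N : DGMod k d} {f g : P ⟶ N}
    (h : (proj k d).map f = (proj k d).map g) : homotopic k d f g := by
  obtain ⟨l, l1, l2, l3⟩ := homotopic_zero_of_proj_map hP (f := f - g)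
    (by rw [Functor.map_sub, h, sub_self])
  exact ⟨l, l1, l2, fun x => by rw [← l3]; simp⟩

/-! ### Free modules and homology classes in the derived category -/

variable (k d)

/-- The free module `Σ ^ i A` in the derived category. -/
abbrev fr (i : ℤ) : DerCat k d := (proj k d).obj (free k d i)

/-- The object `Σ ^ i (A / T ^ (r + 1))` of the derived category. -/
abbrev X (r : ℕ) (i : ℤ) : DerCat k d := (proj k d).obj (cyc k d r i)

variable {k d}

/-- The action of `T ^ m` on homology. -/
def tau (m : ℕ) {i j : ℤ} (h : i = j + m * d) : fr k d i ⟶ fr k d j := (proj k d).map (freeTau m h)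

lemma tau_comp_tau (m n : ℕ) {i j l : ℤ} (h : i = j + m * d) (h' : j = l + n * d) :
    tau (k := k) m h ≫ tau n h' = tau (m + n) (by rw [h, h']; push_cast; ring) := by
  rw [tau, tau, ← Functor.map_comp]
  congr 1
  refine free_hom_ext ?_
  rw [lin_freeTau_comp, freeTau, freeTau, freeHom_gen, freeHom_gen, free_T_pow_single, add_comm]

lemma tau_comp_tau_eq (m n : ℕ) {i j l : ℤ} (h : i = j + m * d) (h' : j = l + n * d) {p : ℕ}
    (hp : m + n = p) (h'' : i = l + p * d) : tau (k := k) m h ≫ tau n h' = tau p h'' := by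
  subst hp
  exact tau_comp_tau m n h h'

lemma tau_zero (i : ℤ) (h : i = i + (0 : ℕ) * d) : tau 0 h = 𝟙 (fr k d i) := by
  refine (congrArg (proj k d).map (free_hom_ext ?_)).trans ((proj k d).map_id _)
  rw [freeTau, freeHom_gen]
  rfl

/-- Homology classes are represented by cycles. -/
lemma exists_fr_map {i : ℤ} {N : DGMod k d} (f : fr k d i ⟶ (proj k d).obj N) :
    ∃ (x : N.carrier) (hx : x ∈ N.gr i) (hx' : N.diff x = 0),
      f = (proj k d).map (freeHom N x hx hx') := by
  obtain ⟨g, rfl⟩ := exists_proj_map_eq (kProj_free i) f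
  refine ⟨_, free_gen_mem N g, free_gen_cycle N g, congrArg _ (free_hom_ext ?_)⟩
  rw [freeHom_gen]

lemma tau_comp_freeHom (m : ℕ) {i j : ℤ} (h : i = j + m * d) {N : DGMod k d} (x : N.carrier)
    (hx : x ∈ N.gr j) (hx' : N.diff x = 0) : tau m h ≫ (proj k d).map (freeHom N x hx hx') =
      (proj k d).map (freeHom N ((N.T ^ m) x) (h ▸ T_pow_mem N m hx)
        (diff_T_pow_eq_zero N m hx')) := by
  rw [tau, ← Functor.map_comp]
  congr 1
  refine free_hom_ext ?_
  rw [lin_freeTau_comp, freeHom_gen, freeHom_gen]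

/-- Together with `exists_fr_map`, this identifies the morphisms from Σ^iA to N with the degree i
homology of N. -/
lemma proj_freeHom_eq_iff {i : ℤ} {N : DGMod k d} {x y : N.carrier}
    (hx : x ∈ N.gr i) (hx' : N.diff x = 0) (hy : y ∈ N.gr i) (hy' : N.diff y = 0) :
    (proj k d).map (freeHom N x hx hx') = (proj k d).map (freeHom N y hy hy') ↔
      ∃ a ∈ N.gr (i + 1), x - y = N.diff a := by
  refine ⟨fun h => ?_, fun ⟨a, ha, h⟩ => proj_map_eq (free_homotopic ha ?_)⟩
  · have := exists_of_free_homotopic (homotopic_of_proj_map_eq (kProj_free i) h)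
    rwa [freeHom_gen, freeHom_gen] at this
  · rw [freeHom_gen, freeHom_gen, h]

lemma proj_freeHom_eq_zero_iff {i : ℤ} {N : DGMod k d} {x : N.carrier}
    (hx : x ∈ N.gr i) (hx' : N.diff x = 0) :
    (proj k d).map (freeHom N x hx hx') = 0 ↔ ∃ a ∈ N.gr (i + 1), x = N.diff a := by
  have := proj_freeHom_eq_iff hx hx' (Submodule.zero_mem _) (map_zero N.diff)
  rw [sub_zero] at this
  rw [← this, show freeHom N 0 (Submodule.zero_mem (N.gr i)) (map_zero N.diff) = 0 from
    free_hom_ext (by rw [freeHom_gen]; rfl), Functor.map_zero]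

/-! ### The triangle given by T^(r+1) -/

section

variable (r : ℕ) (i : ℤ)

/-- The homology class of the generator. -/
def gen : fr k d i ⟶ X k d r i := (proj k d).map (freeHom _ (cycGen r i) cycGen_mem (cyc_diff _))

/-- The projection of the semifree resolution onto its second free summand. -/
def resBd : res k d r i ⟶ free k d (i + (r + 1) * d + 1) :=
  resHom _ 0 (freeGen _) (Submodule.zero_mem _) (map_zero _) freeGen_mem (by simp)

instance : IsIso ((proj k d).map (resAug (k := k) (d := d) r i)) := isIso_proj_map isQis_resAug

/-- The connecting morphism of the triangle given by `T ^ (r + 1)`. -/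
def bd : X k d r i ⟶ fr k d (i + (r + 1) * d + 1) :=
  inv ((proj k d).map (resAug r i)) ≫ (proj k d).map (resBd r i)

variable {r i}

lemma aug_bd : (proj k d).map (resAug r i) ≫ bd r i = (proj k d).map (resBd (k := k) (d := d) r i) := by
  simp [bd]

lemma gen_eq : gen (k := k) (d := d) r i =
    (proj k d).map (freeHom _ (resGen r i) resGen_mem diff_resGen) ≫
      (proj k d).map (resAug r i) := by
  rw [gen, ← Functor.map_comp]
  congr 1
  refine free_hom_ext ?_
  rw [lin_comp, LinearMap.comp_apply, freeHom_gen, freeHom_gen, resAug_gen]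

lemma gen_comp {N : DGMod k d} {f : X k d r i ⟶ (proj k d).obj N} {g : res k d r i ⟶ N}
    (h : (proj k d).map g = (proj k d).map (resAug r i) ≫ f) : gen r i ≫ f =
      (proj k d).map (freeHom N (lin g (resGen r i)) (lin_resGen_mem g) (diff_lin_resGen g)) := by
  rw [gen_eq, Category.assoc, ← h, ← Functor.map_comp]
  congr 1
  refine free_hom_ext ?_
  rw [lin_comp, LinearMap.comp_apply, freeHom_gen, freeHom_gen]

/-- Exactness of Hom(-, Z) at X(r,i) in the triangle given by T^(r+1); `exists_eq_tau` and
`exists_gen_eq` are exactness at the neighbouring terms. On the resolution, the image of the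
generating cycle bounds, so a homotopy moves it to zero, and the second generator is then sent to a
cycle. -/
lemma exists_eq_bd {Z : DerCat k d} (f : X k d r i ⟶ Z) (h : gen r i ≫ f = 0) :
    ∃ y, f = bd r i ≫ y := by
  obtain ⟨N, rfl⟩ := exists_proj_obj_eq Z
  obtain ⟨g, hg⟩ := exists_proj_map_eq kProj_res ((proj k d).map (resAug r i) ≫ f)
  rw [gen_comp hg, proj_freeHom_eq_zero_iff] at h
  obtain ⟨a, ha, h⟩ := h
  have hTa : (N.T ^ (r + 1)) a ∈ N.gr (i + (r + 1) * d + 1) := by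
    have := T_pow_mem N (r + 1) ha
    rwa [show i + 1 + ((r + 1 : ℕ) : ℤ) * d = i + (r + 1) * d + 1 by push_cast; ring] at this
  refine ⟨(proj k d).map (freeHom N
    (lin g (resRel r i) - sgn k ((r + 1 : ℕ) * d) • (N.T ^ (r + 1)) a)
    (Submodule.sub_mem _ (lin_resRel_mem g) (Submodule.smul_mem _ _ hTa)) ?_), ?_⟩
  · rw [map_sub, map_smul, sgn_T_pow_diff, diff_lin_resRel, h, sub_self]
  · rw [← cancel_epi ((proj k d).map (resAug r i)), ← hg, ← Category.assoc, aug_bd,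
      ← Functor.map_comp]
    refine proj_map_eq (res_homotopic ha (Submodule.zero_mem _) ?_ ?_)
    · rw [lin_comp, LinearMap.comp_apply, resBd, resHom_gen, map_zero, sub_zero, h]
    · rw [lin_comp, LinearMap.comp_apply, resBd, resHom_rel, freeHom_gen, map_zero, zero_add,
        sub_sub_cancel]

lemma exists_eq_tau {Z : DerCat k d} (y : fr k d (i + (r + 1) * d + 1) ⟶ Z)
    (h : bd r i ≫ y = 0) (e : i + (r + 1) * d + 1 = i + 1 + (r + 1 : ℕ) * d) :
    ∃ z, y = tau (r + 1) e ≫ z := by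
  obtain ⟨N, rfl⟩ := exists_proj_obj_eq Z
  obtain ⟨y, hy, hy', rfl⟩ := exists_fr_map y
  have h' : (proj k d).map (resBd r i ≫ freeHom N y hy hy') = 0 := by
    rw [Functor.map_comp, ← aug_bd, Category.assoc, h, comp_zero]
  obtain ⟨a, ha, b, hb, h1, h2⟩ := exists_of_res_homotopic (homotopic_zero_of_proj_map kProj_res h')
  rw [lin_comp, LinearMap.comp_apply, resBd, resHom_gen, map_zero, lin_zero, LinearMap.zero_apply,
    sub_zero] at h1
  rw [lin_comp, LinearMap.comp_apply, resBd, resHom_rel, freeHom_gen, lin_zero,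
    LinearMap.zero_apply, sub_zero] at h2
  refine ⟨(proj k d).map (freeHom N (sgn k ((r + 1 : ℕ) * d) • a) (Submodule.smul_mem _ _ ha)
    (by rw [map_smul, ← h1, smul_zero])), ?_⟩
  rw [tau_comp_freeHom, proj_freeHom_eq_iff]
  exact ⟨b, hb, by rw [h2, map_smul, add_sub_cancel_right]⟩

lemma bd_tau (e : i + (r + 1) * d + 1 = i + 1 + (r + 1 : ℕ) * d) :
    bd (k := k) (d := d) r i ≫ tau (r + 1) e = 0 := by
  rw [← cancel_epi ((proj k d).map (resAug r i)), ← Category.assoc, aug_bd, comp_zero, tau,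
    ← Functor.map_comp, ← Functor.map_zero (proj k d)]
  -- The homotopy sends the first generator to a multiple of the free generator. As the second
  -- generator bounds T^(r+1) times the first, this already accounts for the whole composite.
  refine proj_map_eq (res_homotopic (a := sgn k ((r + 1 : ℕ) * d) • freeGen (i + 1))
    (Submodule.smul_mem _ _ freeGen_mem) (Submodule.zero_mem _) ?_ ?_)
  · rw [lin_comp, LinearMap.comp_apply, resBd, resHom_gen, map_zero]
    simp
  · rw [lin_comp, LinearMap.comp_apply, resBd, resHom_rel, freeTau, freeHom_gen, map_zero, zero_add,
      map_smul, sgn_smul_sgn_smul, freeGen, free_T_pow_single, zero_add]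
    simp

lemma exists_gen_eq {Z : DerCat k d} {i' : ℤ} (e : i' = i + (r + 1 : ℕ) * d) (z : fr k d i ⟶ Z)
    (h : tau (r + 1) e ≫ z = 0) : ∃ f : X k d r i ⟶ Z, gen r i ≫ f = z := by
  obtain ⟨N, rfl⟩ := exists_proj_obj_eq Z
  obtain ⟨x, hx, hx', rfl⟩ := exists_fr_map z
  rw [tau_comp_freeHom, proj_freeHom_eq_zero_iff] at h
  obtain ⟨y, hy, h⟩ := h
  refine ⟨inv ((proj k d).map (resAug r i)) ≫ (proj k d).map (resHom N x y hx hx'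
    (by rw [e] at hy; exact_mod_cast hy) h.symm), ?_⟩
  rw [gen_comp (g := resHom N x y hx hx' (by rw [e] at hy; exact_mod_cast hy) h.symm) (by simp)]
  congr 1
  refine free_hom_ext ?_
  rw [freeHom_gen, freeHom_gen, resHom_gen]

end

lemma tau_gen_eq_zero {m s : ℕ} {i j : ℤ} (h : i = j + m * d) (hm : s < m) :
    tau m h ≫ gen (k := k) s j = 0 := by
  rw [gen, tau_comp_freeHom, proj_freeHom_eq_zero_iff]
  exact ⟨0, Submodule.zero_mem _, by rw [cyc_T_pow_eq_zero hm, map_zero]⟩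

lemma tau_gen_ne_zero {m s : ℕ} {i j : ℤ} (h : i = j + m * d) (hm : m ≤ s) :
    tau m h ≫ gen (k := k) s j ≠ 0 := by
  rw [gen, tau_comp_freeHom, Ne, proj_freeHom_eq_zero_iff]
  rintro ⟨a, -, ha⟩
  rw [cyc_diff, cyc_T_pow_gen] at ha
  exact truncPow_ne_zero hm ha

/-- The homology of the target has the basis T^m gen with m ≤ s, whose degrees are pairwise distinct
because d ≠ 0. -/
lemma exists_fr_X (hd : d ≠ 0) {s : ℕ} {i j : ℤ} {f : fr k d i ⟶ X k d s j} (hf : f ≠ 0) :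
    ∃ m ≤ s, ∃ (h : i = j + m * d) (c : k), c ≠ 0 ∧ f = c • (tau m h ≫ gen s j) := by
  obtain ⟨x, hx, hx', rfl⟩ := exists_fr_map f
  rcases cyc_gr hd hx with rfl | ⟨m, hm, h, c, rfl⟩
  · exact absurd ((proj_freeHom_eq_zero_iff _ _).2
      ⟨0, Submodule.zero_mem _, by rw [map_zero]⟩) hf
  · refine ⟨m, hm, h, c, ?_, ?_⟩
    · rintro rfl
      exact absurd ((proj_freeHom_eq_zero_iff _ _).2
        ⟨0, Submodule.zero_mem _, by rw [map_zero, zero_smul]⟩) hf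
    · rw [gen, tau_comp_freeHom, ← Functor.map_smul]
      congr 1
      refine free_hom_ext ?_
      rw [freeHom_gen, lin_smul, LinearMap.smul_apply, freeHom_gen]

end DerCat

namespace DerCat

open DGMod

variable {k : Type u} [Field k] {d : ℤ}

/-! ### Morphisms between the objects `Σ ^ i (A / T ^ (r + 1))` -/

/-- The two kinds of morphisms cannot coexist: subtracting the degree equations gives (m + r - b +
1)d = -1 with a positive first factor, hence d = -1. This is where w ≠ 0 enters. -/
lemma bd_degree_ne (hd' : d ≠ -1) {m b r : ℕ} {i j : ℤ} (h : i = j + m * d) (hb : b ≤ r)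
    (h' : i + (r + 1) * d + 1 = j + b * d) : False := by
  obtain ⟨n, rfl⟩ := Nat.exists_eq_add_of_le hb
  have h1 : ((m + n + 1 : ℕ) : ℤ) * d = -1 := by
    push_cast at h' ⊢
    linarith
  rcases Int.eq_one_or_neg_one_of_mul_eq_neg_one h1 with h2 | h2
  · rw [h2] at h1
    omega
  · omega

lemma exists_eq_smul_bd (hd : d ≠ 0) {r s : ℕ} {i j : ℤ} {f : X k d r i ⟶ X k d s j} (hf : f ≠ 0)
    (h : gen r i ≫ f = 0) : ∃ b ≤ r, b ≤ s ∧ ∃ (e : i + (r + 1) * d + 1 = j + b * d) (c : k),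
      f = c • (bd r i ≫ tau b e ≫ gen s j) := by
  obtain ⟨y, rfl⟩ := exists_eq_bd f h
  obtain ⟨b, hb, e, c, -, rfl⟩ := exists_fr_X hd (f := y) (by rintro rfl; simp at hf)
  refine ⟨b, ?_, hb, e, c, by simp⟩
  by_contra hbr
  refine hf ?_
  -- For b > r the class is divisible by T^(r+1), which `bd` annihilates.
  obtain ⟨n, rfl⟩ : ∃ n, b = r + 1 + n := ⟨b - (r + 1), by omega⟩
  have e1 : i + (r + 1) * d + 1 = i + 1 + (r + 1 : ℕ) * d := by push_cast; ring
  have e2 : i + 1 = j + n * d := by push_cast at e; linarith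
  rw [← tau_comp_tau (r + 1) n e1 e2, Linear.comp_smul, ← Category.assoc, ← Category.assoc,
    bd_tau, zero_comp, zero_comp, smul_zero]

/-- If the composite vanished, exactness would make T^b gen divisible by T^(r+1). Comparing degrees,
that requires b > r. -/
lemma bd_tau_gen_ne_zero (hd : d ≠ 0) {r s b : ℕ} {i j : ℤ} (hbr : b ≤ r) (hbs : b ≤ s)
    (e : i + (r + 1) * d + 1 = j + b * d) : bd (k := k) r i ≫ tau b e ≫ gen s j ≠ 0 := by
  intro h
  have e1 : i + (r + 1) * d + 1 = i + 1 + (r + 1 : ℕ) * d := by push_cast; ring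
  obtain ⟨z, hz⟩ := exists_eq_tau _ h e1
  have hz0 : z ≠ 0 := by
    rintro rfl
    rw [comp_zero] at hz
    exact tau_gen_ne_zero e hbs hz
  obtain ⟨m, -, e2, -⟩ := exists_fr_X hd hz0
  have : (b : ℤ) * d = (m + r + 1 : ℕ) * d := by push_cast; linarith
  have : (b : ℤ) = (m + r + 1 : ℕ) := mul_right_cancel₀ hd this
  omega

lemma gen_ne_zero {r : ℕ} {i : ℤ} : gen (k := k) (d := d) r i ≠ 0 := by
  have := tau_gen_ne_zero (k := k) (d := d) (m := 0) (s := r) (i := i) (j := i) (by simp)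
    (Nat.zero_le r)
  rintro h
  rw [h, comp_zero] at this
  exact this rfl

lemma eq_zero_of_gen_comp (hd : d ≠ 0) (hd' : d ≠ -1) {r s m : ℕ} {i j : ℤ} (e : i = j + m * d)
    {f : X k d r i ⟶ X k d s j} (h : gen r i ≫ f = 0) : f = 0 := by
  by_contra hf
  obtain ⟨b, hb, -, e', -⟩ := exists_eq_smul_bd hd hf h
  exact bd_degree_ne hd' e hb e'

/-- The generator may be sent to any class killed by T^(r+1), and T^(m+r+1) gen = 0 because m + r +
1 > s. -/
lemma exists_gen_comp_eq {r s m : ℕ} {i j : ℤ} (e : i = j + m * d) (h : s ≤ m + r) :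
    ∃ f : X k d r i ⟶ X k d s j, gen r i ≫ f = tau m e ≫ gen s j := by
  refine exists_gen_eq rfl _ ?_
  rw [← Category.assoc, tau_comp_tau, tau_gen_eq_zero _ (by omega)]

lemma exists_fr_X_smul (hd : d ≠ 0) {s m : ℕ} {i j : ℤ} (e : i = j + m * d)
    (f : fr k d i ⟶ X k d s j) : ∃ c : k, f = c • (tau m e ≫ gen s j) := by
  by_cases hf : f = 0
  · exact ⟨0, by rw [hf, zero_smul]⟩
  · obtain ⟨m', -, e', c, -, rfl⟩ := exists_fr_X hd hf
    have : (m : ℤ) * d = m' * d := by linarith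
    obtain rfl : m = m' := by exact_mod_cast mul_right_cancel₀ hd this
    exact ⟨c, rfl⟩

lemma exists_eq_smul (hd : d ≠ 0) (hd' : d ≠ -1) {r s m : ℕ} {i j : ℤ} (e : i = j + m * d)
    {f₀ : X k d r i ⟶ X k d s j} (hf₀ : gen r i ≫ f₀ = tau m e ≫ gen s j)
    (f : X k d r i ⟶ X k d s j) : ∃ c : k, f = c • f₀ := by
  obtain ⟨c, hc⟩ := exists_fr_X_smul hd e (gen r i ≫ f)
  refine ⟨c, sub_eq_zero.1 (eq_zero_of_gen_comp hd hd' e ?_)⟩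
  rw [Preadditive.comp_sub, hc, Linear.comp_smul, hf₀, sub_self]

lemma exists_eq_smul_id (hd : d ≠ 0) (hd' : d ≠ -1) {r : ℕ} {i : ℤ}
    (f : X k d r i ⟶ X k d r i) : ∃ c : k, f = c • 𝟙 _ :=
  exists_eq_smul hd hd' (m := 0) (by simp) (by rw [tau_zero, Category.id_comp, Category.comp_id]) f

/-- There is a non-zero morphism from `Σ ^ i (A / T ^ (r + 1))` to `Σ ^ j (A / T ^ (s + 1))`. -/
def HomNonzero (d : ℤ) (r : ℕ) (i : ℤ) (s : ℕ) (j : ℤ) : Prop :=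
  (∃ m : ℕ, i = j + m * d ∧ m ≤ s ∧ s ≤ m + r) ∨
    ∃ b : ℕ, i + (r + 1) * d + 1 = j + b * d ∧ b ≤ r ∧ b ≤ s

/-- The image of the generator is a multiple of T^m gen. Since T^(r+1) kills the generator it kills
this image too, which gives s ≤ m + r. -/
lemma gen_comp_cases (hd : d ≠ 0) {r s : ℕ} {i j : ℤ} {f : X k d r i ⟶ X k d s j}
    (hf : gen r i ≫ f ≠ 0) : ∃ (m : ℕ) (e : i = j + m * d) (c : k), m ≤ s ∧ s ≤ m + r ∧ c ≠ 0 ∧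
      gen r i ≫ f = c • (tau m e ≫ gen s j) := by
  obtain ⟨m, hm, e, c, hc, h⟩ := exists_fr_X hd hf
  refine ⟨m, e, c, hm, ?_, hc, h⟩
  by_contra hs
  have h0 : tau (k := k) (r + 1) (i := i + (r + 1 : ℕ) * d) rfl ≫ gen r i ≫ f = 0 := by
    rw [← Category.assoc, tau_gen_eq_zero _ (by omega), zero_comp]
  rw [h, Linear.comp_smul, ← Category.assoc, tau_comp_tau] at h0
  exact (smul_ne_zero hc (tau_gen_ne_zero _ (by omega))) h0

lemma exists_generator_of_homNonzero (hd : d ≠ 0) (hd' : d ≠ -1) {r s : ℕ} {i j : ℤ}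
    (h : HomNonzero d r i s j) :
    ∃ f₀ : X k d r i ⟶ X k d s j, f₀ ≠ 0 ∧ ∀ f, ∃ c : k, c • f₀ = f := by
  rcases h with ⟨m, e, hm, hs⟩ | ⟨b, e, hbr, hbs⟩
  · obtain ⟨f₀, hf₀⟩ := exists_gen_comp_eq (k := k) e hs
    refine ⟨f₀, ?_, fun f => (exists_eq_smul hd hd' e hf₀ f).imp fun _ h => h.symm⟩
    rintro rfl
    rw [comp_zero] at hf₀
    exact tau_gen_ne_zero e hm hf₀.symm
  · refine ⟨_, bd_tau_gen_ne_zero hd hbr hbs e, fun f => ?_⟩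
    by_cases hf : f = 0
    · exact ⟨0, by rw [hf, zero_smul]⟩
    · have hg : gen r i ≫ f = 0 := by
        by_contra hg
        obtain ⟨m, e', -⟩ := gen_comp_cases hd hg
        exact bd_degree_ne hd' e' hbr e
      obtain ⟨b', -, -, e', c, rfl⟩ := exists_eq_smul_bd hd hf hg
      have : (b : ℤ) * d = b' * d := by linarith
      obtain rfl : b = b' := by exact_mod_cast mul_right_cancel₀ hd this
      exact ⟨c, rfl⟩

lemma homNonzero_of_ne_zero (hd : d ≠ 0) {r s : ℕ} {i j : ℤ} {f : X k d r i ⟶ X k d s j}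
    (hf : f ≠ 0) : HomNonzero d r i s j := by
  by_cases h : gen r i ≫ f = 0
  · obtain ⟨b, hbr, hbs, e, -⟩ := exists_eq_smul_bd hd hf h
    exact Or.inr ⟨b, e, hbr, hbs⟩
  · obtain ⟨m, e, -, hm, hs, -⟩ := gen_comp_cases hd h
    exact Or.inl ⟨m, e, hm, hs⟩

lemma isIso_of_ne_zero (hd : d ≠ 0) (hd' : d ≠ -1) {r : ℕ} {i : ℤ}
    {f : X k d r i ⟶ X k d r i} (hf : f ≠ 0) : ∃ g, f ≫ g = 𝟙 _ := by
  obtain ⟨c, rfl⟩ := exists_eq_smul_id hd hd' f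
  refine ⟨c⁻¹ • 𝟙 _, ?_⟩
  have hc : c ≠ 0 := by
    rintro rfl
    simp at hf
  rw [Linear.smul_comp, Linear.comp_smul, smul_smul, mul_inv_cancel₀ hc, one_smul, Category.comp_id]

/-- An isomorphism and its inverse do not kill the generators, so both are of the first kind, with
exponents m and n. The degrees give (m + n)d = 0, so m = n = 0. -/
lemma eq_of_iso (hd : d ≠ 0) {r s : ℕ} {i j : ℤ} (e : X k d r i ≅ X k d s j) : r = s ∧ i = j := by
  have key : ∀ {r s : ℕ} {i j : ℤ} (e : X k d r i ≅ X k d s j),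
      ∃ m : ℕ, i = j + m * d ∧ s ≤ m + r := fun {r s i j} e => by
    have : gen r i ≫ e.hom ≠ 0 := fun h => gen_ne_zero (k := k) (d := d) (r := r) (i := i)
      (by rw [← Category.comp_id (gen r i), ← e.hom_inv_id, ← Category.assoc, h, zero_comp])
    obtain ⟨m, e', -, -, hs, -⟩ := gen_comp_cases hd this
    exact ⟨m, e', hs⟩
  obtain ⟨m, h1, h2⟩ := key e
  obtain ⟨n, h3, h4⟩ := key e.symm
  have : ((m + n : ℕ) : ℤ) * d = 0 := by push_cast; linarith
  have := (mul_eq_zero.1 this).resolve_right hd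
  obtain ⟨rfl, rfl⟩ : m = 0 ∧ n = 0 := by omega
  simp at h1
  exact ⟨by omega, h1⟩

/-! ### Split monomorphisms and split epimorphisms -/

/-- If the image of the class of `T ^ r` is not divisible by `T ^ (r + 1)`, then the morphism
factors a morphism to the coresolution which is non-zero in the derived category. -/
lemma exists_comp_ne_zero (hd : d ≠ 0) {r : ℕ} {i : ℤ} {Z : DGMod k d} (g : res k d r i ⟶ Z)
    (h : ∀ z : fr k d (i - d) ⟶ (proj k d).obj Z,
      tau r rfl ≫ gen r i ≫ inv ((proj k d).map (resAug r i)) ≫ (proj k d).map g ≠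
        tau (r + 1) (by push_cast; ring) ≫ z) :
    ∃ φ : Z ⟶ cores k d r i, (proj k d).map (g ≫ φ) ≠ 0 := by
  have key : ∀ c b, Z.diff c = 0 → (Z.T ^ r) (lin g (resGen r i)) ≠
      (Z.T ^ (r + 1)) c + Z.diff b := by
    intro c b hc hcb
    -- The element c need not be homogeneous, but only its component of degree i - d can contribute
    -- to a class of degree i + rd.
    refine h ((proj k d).map (freeHom Z (Z.pr (i - d) c) (pr_mem _ _ _)
      (by rw [← pr_diff, hc, map_zero]))) ?_
    rw [gen_comp (g := g) (by simp), tau_comp_freeHom, tau_comp_freeHom, proj_freeHom_eq_iff]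
    refine ⟨Z.pr (i + r * d + 1) b, pr_mem _ _ _, ?_⟩
    rw [← pr_diff, ← pr_T_pow, sub_eq_iff_eq_add, add_sub_cancel_right,
      show i - d + ((r + 1 : ℕ) : ℤ) * d = i + r * d by push_cast; ring, ← map_add,
      add_comm (Z.diff b), ← hcb, pr_of_mem _ (T_pow_mem Z r (lin_resGen_mem g))]
  obtain ⟨φ, hφ⟩ := exists_hom_cores_of_pure hd Z (lin_resGen_mem g) key
  refine ⟨φ, fun h0 => ?_⟩
  obtain ⟨a, -, b, -, h1, -⟩ := exists_of_res_homotopic (homotopic_zero_of_proj_map kProj_res h0)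
  exact hφ a (by simpa only [lin_comp, LinearMap.comp_apply, lin_zero, LinearMap.zero_apply,
    sub_zero] using h1)

instance (r : ℕ) (i : ℤ) : IsIso ((proj k d).map (coresAug (k := k) (d := d) r i)) :=
  isIso_proj_map isQis_coresAug

/-- Source and target are both models of X(r,i), and non-zero endomorphisms of X(r,i) are invertible
scalars. -/
lemma isIso_res_cores (hd : d ≠ 0) (hd' : d ≠ -1) {r : ℕ} {i : ℤ} (f : res k d r i ⟶ cores k d r i)
    (hf : (proj k d).map f ≠ 0) : IsIso ((proj k d).map f) := by
  let e := inv ((proj k d).map (resAug r i)) ≫ (proj k d).map f ≫ inv ((proj k d).map (coresAug r i))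
  have he : (proj k d).map f = (proj k d).map (resAug r i) ≫ e ≫ (proj k d).map (coresAug r i) := by
    simp [e]
  obtain ⟨c, hc⟩ := exists_eq_smul_id hd hd' e
  rw [hc, Linear.smul_comp, Linear.comp_smul, Category.id_comp] at he
  have hc0 : c ≠ 0 := by
    rintro rfl
    rw [zero_smul] at he
    exact hf he
  rw [he]
  refine ⟨c⁻¹ • inv ((proj k d).map (resAug r i) ≫ (proj k d).map (coresAug r i)), ?_, ?_⟩
  · rw [Linear.smul_comp, Linear.comp_smul, smul_smul, mul_inv_cancel₀ hc0, one_smul,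
      IsIso.hom_inv_id]
  · rw [Linear.smul_comp, Linear.comp_smul, smul_smul, inv_mul_cancel₀ hc0, one_smul,
      IsIso.inv_hom_id]

/-- Purity yields a morphism from Z to the coresolution whose composite with g is non-zero, hence an
isomorphism, and this inverts g on one side. -/
lemma exists_retraction (hd : d ≠ 0) (hd' : d ≠ -1) {r : ℕ} {i : ℤ} {Z : DerCat k d}
    (g : X k d r i ⟶ Z) (h : ∀ z : fr k d (i - d) ⟶ Z,
      tau r rfl ≫ gen r i ≫ g ≠ tau (r + 1) (by push_cast; ring) ≫ z) : ∃ p, g ≫ p = 𝟙 _ := by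
  obtain ⟨N, rfl⟩ := exists_proj_obj_eq Z
  obtain ⟨g', hg'⟩ := exists_proj_map_eq kProj_res ((proj k d).map (resAug r i) ≫ g)
  obtain ⟨φ, hφ⟩ := exists_comp_ne_zero hd g' (by rwa [hg', IsIso.inv_hom_id_assoc])
  have := isIso_res_cores hd hd' _ hφ
  refine ⟨(proj k d).map φ ≫ inv ((proj k d).map (g' ≫ φ)) ≫ (proj k d).map (resAug r i), ?_⟩
  rw [← cancel_epi ((proj k d).map (resAug r i)), ← Category.assoc, ← hg', ← Category.assoc,
    ← Functor.map_comp, IsIso.hom_inv_id_assoc, Category.comp_id]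

/-- A class killed by T^(s+1) is the image of the generator under some g. The composite of g with h
fixes the generator, so it is a non-zero scalar and g can be rescaled. -/
lemma exists_section (hd : d ≠ 0) (hd' : d ≠ -1) {s : ℕ} {j j' : ℤ} {Z : DerCat k d}
    (h : Z ⟶ X k d s j) (z : fr k d j ⟶ Z) (e : j' = j + (s + 1 : ℕ) * d)
    (hz : tau (s + 1) e ≫ z = 0) (hzh : z ≫ h = gen s j) : ∃ g, g ≫ h = 𝟙 _ := by
  obtain ⟨g, rfl⟩ := exists_gen_eq e z hz
  rw [Category.assoc] at hzh
  obtain ⟨p, hp⟩ := isIso_of_ne_zero hd hd' (f := g ≫ h) (by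
    intro h0
    rw [h0, comp_zero] at hzh
    exact gen_ne_zero hzh.symm)
  obtain ⟨c, rfl⟩ := exists_eq_smul_id hd hd' p
  refine ⟨c • g, ?_⟩
  rw [Linear.smul_comp]
  simpa using hp

/-! ### Factorizations -/

/-- The factorizations of the projections `A / T ^ (r + 2) ⟶ A / T ^ (r + 1)`. -/
lemma split_of_comp_eq_proj (hd : d ≠ 0) (hd' : d ≠ -1) {r : ℕ} {i : ℤ} {Z : DerCat k d}
    (g : X k d (r + 1) i ⟶ Z) (h : Z ⟶ X k d r i) (hgh : gen (r + 1) i ≫ g ≫ h = gen r i) :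
    (∃ p, g ≫ p = 𝟙 _) ∨ ∃ q, q ≫ h = 𝟙 _ := by
  by_cases hg : ∀ z : fr k d (i - d) ⟶ Z,
      tau (r + 1) rfl ≫ gen (r + 1) i ≫ g ≠ tau (r + 1 + 1) (by push_cast; ring) ≫ z
  · exact Or.inl (exists_retraction hd hd' g hg)
  · push Not at hg
    obtain ⟨z, hz⟩ := hg
    -- The homology of X(r,i) lives in the degrees i + md with m ≥ 0, so it vanishes in degree i -
    -- d.
    have hzh : z ≫ h = 0 := by
      by_contra h0
      obtain ⟨m, -, e, -⟩ := exists_fr_X hd h0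
      have : ((m + 1 : ℕ) : ℤ) * d = 0 := by push_cast; linarith
      have := (mul_eq_zero.1 this).resolve_right hd
      omega
    have e1 : i = i - d + (1 : ℕ) * d := by push_cast; ring
    -- Subtracting T z does not change the image under h, and makes the class vanish under T^(r+1),
    -- so it defines a section.
    refine Or.inr (exists_section hd hd' h (gen (r + 1) i ≫ g - tau 1 e1 ≫ z) rfl ?_ ?_)
    · rw [Preadditive.comp_sub, hz, ← Category.assoc (tau (r + 1) _), tau_comp_tau, sub_self]
    · rw [Preadditive.sub_comp, Category.assoc, hgh, Category.assoc, hzh, comp_zero, sub_zero]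

/-- The factorizations of the inclusions `A / T ^ (r + 1) ⟶ Σ ^ (-d) (A / T ^ (r + 2))`. -/
lemma split_of_comp_eq_incl (hd : d ≠ 0) (hd' : d ≠ -1) {r : ℕ} {i : ℤ} {Z : DerCat k d}
    (g : X k d r i ⟶ Z) (h : Z ⟶ X k d (r + 1) (i - d)) (e : i = i - d + (1 : ℕ) * d)
    (hgh : gen r i ≫ g ≫ h = tau 1 e ≫ gen (r + 1) (i - d)) :
    (∃ p, g ≫ p = 𝟙 _) ∨ ∃ q, q ≫ h = 𝟙 _ := by
  by_cases hg : ∀ z : fr k d (i - d) ⟶ Z,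
      tau r rfl ≫ gen r i ≫ g ≠ tau (r + 1) (by push_cast; ring) ≫ z
  · exact Or.inl (exists_retraction hd hd' g hg)
  · push Not at hg
    obtain ⟨z, hz⟩ := hg
    -- In degree i - d the homology of the target is spanned by its generator, so z is sent to c
    -- gen. Multiplying by T^(r+1) and comparing with the inclusion gives c = 1.
    obtain ⟨c, hc⟩ := exists_fr_X_smul hd (m := 0) (by simp) (z ≫ h)
    rw [tau_zero, Category.id_comp] at hc
    have e2 : i + r * d = i - d + (r + 1 : ℕ) * d := by push_cast; ring
    have h1 : c • (tau (r + 1) e2 ≫ gen (k := k) (r + 1) (i - d)) =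
        tau (r + 1) e2 ≫ gen (r + 1) (i - d) := by
      rw [← Linear.comp_smul, ← hc, ← Category.assoc, ← hz, Category.assoc, Category.assoc, hgh,
        ← Category.assoc, tau_comp_tau]
    have hc1 : c = 1 := by
      have h2 : (c - 1) • (tau (r + 1) e2 ≫ gen (k := k) (r + 1) (i - d)) = 0 := by
        rw [sub_smul, h1, one_smul, sub_self]
      exact sub_eq_zero.1 ((smul_eq_zero.1 h2).resolve_right (tau_gen_ne_zero _ le_rfl))
    rw [hc1, one_smul] at hc
    refine Or.inr (exists_section hd hd' h z
      (j' := i + (r + 1 : ℕ) * d) (by push_cast; ring) ?_ hc)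
    -- T^(r+2) z equals T^(r+1) applied to the image of the generator of X(r,i), hence vanishes.
    have e3 : i + (r + 1 : ℕ) * d = i + r * d + (1 : ℕ) * d := by push_cast; ring
    rw [← tau_comp_tau_eq 1 (r + 1) e3 e2 (by omega), Category.assoc, ← hz, ← Category.assoc,
      tau_comp_tau_eq 1 r e3 rfl (p := r + 1) (by omega) (by push_cast; ring), ← Category.assoc,
      tau_gen_eq_zero _ (by omega), zero_comp]

end DerCat

/-! ### The thick subcategory generated by the trivial module -/

namespace DGMod

variable {k : Type u} [Field k] {d : ℤ}

lemma mem_of_pr_mem (M : DGMod k d) (W : Submodule k M.carrier) {x : M.carrier}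
    (h : ∀ j, M.pr j x ∈ W) : x ∈ W := by
  let e := LinearEquiv.ofBijective (DirectSum.coeLinearMap M.gr) M.isInternal
  have hx : x = DirectSum.coeLinearMap M.gr (e.symm x) := (e.apply_symm_apply x).symm
  classical
  rw [hx, DirectSum.coeLinearMap_eq_dfinsuppSum]
  exact Submodule.dfinsuppSum_mem _ _ _ fun j _ => h j

lemma isQis_of_bijective {M N : DGMod k d} (f : M ⟶ N) (hf : Function.Bijective (lin f)) :
    IsQis f := by
  refine ⟨fun x hx ⟨y, hy⟩ => ?_, fun y hy => ?_⟩
  · obtain ⟨z, rfl⟩ := hf.2 y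
    exact ⟨z, hf.1 (by rw [lin_diff, hy])⟩
  · obtain ⟨x, rfl⟩ := hf.2 y
    exact ⟨x, 0, hf.1 (by rw [lin_diff, hy, map_zero]), by rw [map_zero, sub_self]⟩

/-! ### Explicit quasi-isomorphisms: suspensions, short exact sequences, rotation of cones -/

/-- The isomorphism of the trivial module with `A / T`. -/
def trivialIso (k : Type u) [Field k] (d : ℤ) : trivial k d ⟶ cyc k d 0 0 :=
  mkHom (M := trivial k d) (N := cyc k d 0 0) (LinearMap.toSpanSingleton k _ (cycGen 0 0))
    (fun i x hx => by
      by_cases h : i = 0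
      · subst h
        exact Submodule.smul_mem _ _ cycGen_mem
      · change x ∈ (if i = 0 then ⊤ else ⊥ : Submodule k k) at hx
        rw [if_neg h, Submodule.mem_bot] at hx
        rw [hx, map_zero]
        exact Submodule.zero_mem _)
    (fun x => by
      have := cyc_T_pow_eq_zero (k := k) (d := d) (i := 0) (show 0 < 1 by omega)
        (LinearMap.toSpanSingleton k _ (cycGen 0 0) x)
      rw [pow_one] at this
      rw [this]
      simp)
    (fun x => by
      rw [cyc_diff]
      simp)

lemma isQis_trivialIso : IsQis (trivialIso k d) := by
  refine isQis_of_bijective _ ⟨?_, fun y => ?_⟩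
  · refine (injective_iff_map_eq_zero _).2 fun x hx => ?_
    exact (smul_eq_zero.1 hx).resolve_right (truncPow_ne_zero (le_refl 0))
  · refine ⟨(y : Fin 1 →₀ k) 0, Finsupp.ext fun a => ?_⟩
    obtain rfl : a = 0 := Fin.ext (by omega)
    change ((y : Fin 1 →₀ k) 0 • truncPow k 0 0 : Fin 1 →₀ k) 0 = _
    simp [truncPow]

/-- The isomorphism of `Σ ^ (i + n) (A / T ^ (r + 1))` with the suspension. -/
def cycShift (k : Type u) [Field k] (d : ℤ) (r : ℕ) (i n : ℤ) :
    cyc k d r (i + n) ⟶ shift n (cyc k d r i) :=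
  homOfBasis (shift n (cyc k d r i))
    -- T acts on the n-th suspension with the additional sign (-1)^(nd), so T^a acquires the a-th
    -- power of it.
    (fun a => (Finsupp.single a (sgn k (a * (n * d))) : Fin (r + 1) →₀ k))
    (fun a => single_mem_basisGr (by ring) _)
    (fun a => by
      rw [truncPow]
      split_ifs with h
      · simp only [Finsupp.linearCombination_single, one_smul, LinearMap.smul_apply, truncPow,
          dif_pos h, Finsupp.smul_single, smul_eq_mul, mul_one, ← sgn_add]
        congr 2
        push_cast
        ring
      · simp [truncPow, show ¬ (a : ℕ) < r by omega])
    (fun a => by simp)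

lemma isQis_cycShift (r : ℕ) (i n : ℤ) : IsQis (cycShift k d r i n) := by
  have h : ∀ x : Fin (r + 1) →₀ k, (lin (cycShift k d r i n) : (Fin (r + 1) →₀ k) →ₗ[k] _)
      ((lin (cycShift k d r i n) : (Fin (r + 1) →₀ k) →ₗ[k] (Fin (r + 1) →₀ k)) x) = x :=
    finsupp_map_eq (f := (lin (cycShift k d r i n) : (Fin (r + 1) →₀ k) →ₗ[k] _) ∘ₗ
      (lin (cycShift k d r i n) : (Fin (r + 1) →₀ k) →ₗ[k] (Fin (r + 1) →₀ k)))
      (g := LinearMap.id) fun a => by simp [cycShift]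
  exact isQis_of_bijective _ (Function.Involutive.bijective h)

/-- The embedding of `Σ ^ d (A / T ^ (r + 1))` into `A / T ^ (r + 2)`. -/
def cycIncl (k : Type u) [Field k] (d : ℤ) (r : ℕ) (i : ℤ) :
    cyc k d r (i + d) ⟶ cyc k d (r + 1) i :=
  homOfBasis _ (fun a => (Finsupp.single a.succ 1 : Fin (r + 1 + 1) →₀ k))
    (fun a => single_mem_basisGr (by rw [Fin.val_succ]; push_cast; ring) _)
    (fun a => by
      rw [Finsupp.linearCombination_single, one_smul, truncPow, truncPow]
      by_cases h : (a : ℕ) + 1 < r + 1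
      · rw [dif_pos h, dif_pos (by rw [Fin.val_succ]; omega)]
        simp
      · rw [dif_neg h, dif_neg (by rw [Fin.val_succ]; omega), map_zero])
    (fun a => by simp)

/-- The projection of `A / T ^ (r + 2)` onto `A / T`. -/
def cycProj (k : Type u) [Field k] (d : ℤ) (r : ℕ) (i : ℤ) :
    cyc k d (r + 1) i ⟶ cyc k d 0 i :=
  homOfBasis _ (fun a => truncPow k 0 a)
    (fun a => by
      have := T_pow_mem (cyc k d 0 i) a cycGen_mem
      rwa [cyc_T_pow_gen] at this)
    (fun a => by
      have hT : (cyc k d 0 i).T (truncPow k 0 a) = 0 := by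
        rw [← cyc_T_pow_gen (d := d) (i := i), ← T_pow_succ_apply, cyc_T_pow_eq_zero (by omega)]
      rw [hT, truncPow]
      split_ifs with h
      · rw [Finsupp.linearCombination_single, one_smul, truncPow_of_lt (Nat.succ_pos _)]
      · rw [map_zero])
    (fun a => by simp)

/-- The morphism from the cone of the first morphism in a short exact sequence. -/
def coneDesc {M N L : DGMod k d} (f : M ⟶ N) (p : N ⟶ L) (h : ∀ m, lin p (lin f m) = 0) :
    cone f ⟶ L :=
  mkHom (M := cone f) ((lin p) ∘ₗ LinearMap.fst k _ _) (fun _ _ hx => lin_mem p hx.1)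
    (fun x => lin_T p x.1)
    (fun x => by
      change lin p (N.diff x.1 + lin f x.2) = L.diff (lin p x.1)
      rw [map_add, h, add_zero, lin_diff])

/-- This presents A/T as the cone of Σ^d(A/T^(r+1)) → A/T^(r+2), the inductive step of `thick_X`. -/
lemma isQis_coneDesc {M N L : DGMod k d} (f : M ⟶ N) (p : N ⟶ L) (h : ∀ m, lin p (lin f m) = 0)
    (hf : Function.Injective (lin f)) (hp : Function.Surjective (lin p))
    (hfp : ∀ n, lin p n = 0 → ∃ m, lin f m = n) : IsQis (coneDesc f p h) := by
  refine ⟨?_, fun l hl => ?_⟩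
  · rintro ⟨n, m⟩ hx ⟨l, hl⟩
    have hl : L.diff l = lin p n := hl
    have hx1 : N.diff n + lin f m = 0 := congrArg Prod.fst hx
    obtain ⟨n', rfl⟩ := hp l
    obtain ⟨m', hm'⟩ := hfp (n - N.diff n') (by rw [map_sub, lin_diff, hl, sub_self])
    refine ⟨(n', m'), Prod.ext ?_ ?_⟩
    · change N.diff n' + lin f m' = n
      rw [hm', add_sub_cancel]
    · change -M.diff m' = m
      refine hf ?_
      rw [map_neg, lin_diff, hm', map_sub, diff_diff, sub_zero, neg_eq_iff_add_eq_zero, hx1]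
  · obtain ⟨n, rfl⟩ := hp l
    obtain ⟨m, hm⟩ := hfp (N.diff n) (by rw [lin_diff, hl])
    refine ⟨(n, -m), 0, Prod.ext ?_ ?_, ?_⟩
    · change N.diff n + lin f (-m) = 0
      rw [map_neg, hm, add_neg_cancel]
    · change -M.diff (-m) = 0
      rw [map_neg, neg_neg]
      exact hf (by rw [lin_diff, hm, diff_diff, map_zero])
    · change L.diff 0 = lin p n - lin p n
      rw [map_zero, sub_self]

lemma sgn_one (k : Type u) [Field k] : sgn k 1 = -1 := by simp [sgn]

/-- The projection of a cone onto the suspension of the source. -/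
def coneSnd {M N : DGMod k d} (f : M ⟶ N) : cone f ⟶ shift 1 M :=
  mkHom (M := cone f) (N := shift 1 M) (LinearMap.snd k _ _) (fun _ _ hx => hx.2)
    (fun x => by
      change sgn k d • M.T x.2 = sgn k (1 * d) • M.T x.2
      rw [one_mul])
    (fun x => by
      change -M.diff x.2 = sgn k 1 • M.diff x.2
      rw [sgn_one, neg_smul, one_smul])

/-- The inclusion into a cone. -/
def coneInl {M N : DGMod k d} (f : M ⟶ N) : N ⟶ cone f :=
  mkHom (N := cone f) (LinearMap.inl k _ _) (fun _ _ hx => ⟨hx, Submodule.zero_mem _⟩)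
    (fun x => by
      refine Prod.ext rfl ?_
      change 0 = sgn k d • M.T 0
      rw [map_zero, smul_zero])
    (fun x => by
      refine Prod.ext ?_ ?_
      · change N.diff x = N.diff x + lin f 0
        rw [map_zero, add_zero]
      · change 0 = -M.diff 0
        rw [map_zero, neg_zero])

/-- The rotation of a mapping cone. -/
def coneRotate {M N : DGMod k d} (f : M ⟶ N) : shift 1 N ⟶ cone (coneSnd f) :=
  mkHom (M := shift 1 N) (N := cone (coneSnd f))
    (LinearMap.inr k M.carrier (N.carrier × M.carrier) ∘ₗ LinearMap.inl k N.carrier M.carrier)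
    (fun _ _ hx => ⟨Submodule.zero_mem _, hx, Submodule.zero_mem _⟩)
    (fun x => by
      refine Prod.ext ?_ (Prod.ext ?_ ?_)
      · change 0 = sgn k (1 * d) • M.T 0
        rw [map_zero, smul_zero]
      · change sgn k (1 * d) • N.T x = sgn k d • N.T x
        rw [one_mul]
      · change 0 = sgn k d • sgn k d • M.T 0
        rw [map_zero, smul_zero, smul_zero])
    (fun x => by
      refine Prod.ext ?_ (Prod.ext ?_ ?_)
      · change 0 = sgn k 1 • M.diff 0 + 0
        rw [map_zero, smul_zero, add_zero]
      · change sgn k 1 • N.diff x = -(N.diff x + lin f 0)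
        rw [map_zero, add_zero, sgn_one, neg_smul, one_smul]
      · change 0 = - -M.diff 0
        rw [map_zero, neg_zero, neg_zero])

lemma isQis_coneRotate {M N : DGMod k d} (f : M ⟶ N) : IsQis (coneRotate f) := by
  refine ⟨fun (n : N.carrier) hn => ?_, ?_⟩
  · rintro ⟨⟨m, n', m'⟩, h⟩
    have h1 : sgn k 1 • M.diff m + m' = 0 := congrArg Prod.fst h
    have h2 : -(N.diff n' + lin f m') = n := congrArg (fun x => x.2.1) h
    rw [sgn_one, neg_smul, one_smul, neg_add_eq_zero] at h1
    refine ⟨(n' + lin f m : N.carrier), ?_⟩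
    change sgn k 1 • N.diff (n' + lin f m) = n
    rw [sgn_one, neg_smul, one_smul, map_add, ← lin_diff, h1, h2]
  · rintro ⟨m, n, m'⟩ h
    have h1 : sgn k 1 • M.diff m + m' = 0 := congrArg Prod.fst h
    have h2 : -(N.diff n + lin f m') = 0 := congrArg (fun x => x.2.1) h
    rw [sgn_one, neg_smul, one_smul, neg_add_eq_zero] at h1
    rw [neg_eq_zero] at h2
    refine ⟨(n + lin f m : N.carrier), ((0 : M.carrier), (0 : N.carrier), -m), ?_, ?_⟩
    · change sgn k 1 • N.diff (n + lin f m) = 0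
      rw [map_add, ← lin_diff, h1, h2, smul_zero]
    · refine Prod.ext ?_ (Prod.ext ?_ ?_)
      · change sgn k 1 • M.diff 0 + -m = 0 - m
        rw [map_zero, smul_zero]
        abel
      · change -(N.diff 0 + lin f (-m)) = n + lin f m - n
        rw [map_zero, map_neg]
        abel
      · change - -M.diff (-m) = 0 - m'
        rw [map_neg, h1]
        abel

/-- The inverse suspension of the suspension. -/
def shiftNegOne (N : DGMod k d) : N ⟶ shift (-1) (shift 1 N) :=
  mkHom (N := shift (-1) (shift 1 N)) LinearMap.id
    (fun i x hx => by
      change x ∈ N.gr (i - -1 - 1)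
      rwa [show i - -1 - 1 = i by ring])
    (fun x => by
      change N.T x = sgn k (-1 * d) • sgn k (1 * d) • N.T x
      rw [smul_smul, ← sgn_add, show -1 * d + 1 * d = 0 by ring, sgn_zero, one_smul])
    (fun x => by
      change N.diff x = sgn k (-1) • sgn k 1 • N.diff x
      rw [smul_smul, ← sgn_add, neg_add_cancel, sgn_zero, one_smul])

end DGMod

/-! ### Closure properties of the thick subcategory -/

namespace DerCat

open DGMod

variable {k : Type u} [Field k] {d : ℤ} {G : DerCat k d}

lemma Thick.of_iso {Y Z : DerCat k d} (hY : Thick G Y) (e : Z ≅ Y) : Thick G Z :=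
  Thick.retract ⟨e.hom, e.inv, e.hom_inv_id⟩ hY

lemma Thick.of_isQis {M N : DGMod k d} {f : M ⟶ N} (hf : IsQis f)
    (h : Thick G ((proj k d).obj M)) : Thick G ((proj k d).obj N) :=
  have := isIso_proj_map hf
  h.of_iso (asIso ((proj k d).map f)).symm

lemma Thick.of_isQis' {M N : DGMod k d} {f : M ⟶ N} (hf : IsQis f)
    (h : Thick G ((proj k d).obj N)) : Thick G ((proj k d).obj M) :=
  have := isIso_proj_map hf
  h.of_iso (asIso ((proj k d).map f))

/-- The constructor `Thick.cone` only yields third terms of triangles. Rotation reaches the middle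
term: the cone of `coneSnd f` is ΣN, and desuspending gives N. -/
lemma Thick.of_cone {M N : DGMod k d} (f : M ⟶ N) (hM : Thick G ((proj k d).obj M))
    (h : Thick G ((proj k d).obj (DGMod.cone f))) : Thick G ((proj k d).obj N) := by
  have h1 : Thick G ((proj k d).obj (DGMod.cone (coneSnd f))) := Thick.cone _ h (Thick.shift 1 hM)
  have h2 : Thick G ((proj k d).obj (DGMod.shift (-1) (DGMod.shift 1 N))) :=
    Thick.shift (-1) (h1.of_isQis' (isQis_coneRotate f))
  exact h2.of_isQis' (isQis_of_bijective (shiftNegOne N) Function.bijective_id)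

lemma thick_X (r : ℕ) (i : ℤ) :
    Thick ((proj k d).obj (trivial k d)) (X k d r i) := by
  have h0 : ∀ i, Thick ((proj k d).obj (trivial k d)) (X k d 0 i) := fun i => by
    have h := (Thick.shift i (Thick.base.of_isQis (isQis_trivialIso (k := k) (d := d))))
    have := Thick.of_isQis' (M := cyc k d 0 (0 + i)) (isQis_cycShift 0 0 i) h
    rwa [zero_add] at this
  induction r generalizing i with
  | zero => exact h0 i
  | succ r ih =>
    refine Thick.of_cone (cycIncl k d r i) (ih _) ?_
    have hT : ∀ a : Fin (r + 1), lin (cycIncl k d r i) (Finsupp.single a 1 : Fin (r + 1) →₀ k) =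
        (Finsupp.single a.succ 1 : Fin (r + 1 + 1) →₀ k) := fun a => by simp [cycIncl]
    have hP : ∀ a : Fin (r + 1 + 1), lin (cycProj k d r i)
        (Finsupp.single a 1 : Fin (r + 1 + 1) →₀ k) = truncPow k 0 a := fun a => by simp [cycProj]
    -- `σ` and `τ` split the sequence Σ^d(A/T^(r+1)) → A/T^(r+2) → A/T over k, from which exactness
    -- is read off.
    let σ : (Fin (r + 1 + 1) →₀ k) →ₗ[k] (Fin (r + 1) →₀ k) :=
      Finsupp.lcomapDomain Fin.succ (Fin.succ_injective _)
    let τ : (Fin (0 + 1) →₀ k) →ₗ[k] (Fin (r + 1 + 1) →₀ k) :=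
      Finsupp.linearCombination k fun _ => Finsupp.single 0 1
    have h1 : ∀ m, σ (lin (cycIncl k d r i) m) = m := by
      refine finsupp_map_eq (f := σ ∘ₗ lin (cycIncl k d r i)) (g := LinearMap.id) fun a => ?_
      rw [LinearMap.comp_apply, hT]
      ext b
      simp [σ, Finsupp.single_apply]
    have h2 : ∀ l, lin (cycProj k d r i) (τ l) = l := by
      refine finsupp_map_eq (f := lin (cycProj k d r i) ∘ₗ τ) (g := LinearMap.id) fun a => ?_
      rw [LinearMap.comp_apply, show τ (Finsupp.single a 1) = Finsupp.single 0 1 by simp [τ], hP]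
      obtain rfl : a = 0 := Fin.ext (by omega)
      exact truncPow_coe 0 0
    have h3 : ∀ n, lin (cycIncl k d r i) (σ n) + τ (lin (cycProj k d r i) n) = n := by
      refine finsupp_map_eq (f := lin (cycIncl k d r i) ∘ₗ σ + τ ∘ₗ lin (cycProj k d r i))
        (g := LinearMap.id) fun a => ?_
      rw [LinearMap.add_apply, LinearMap.comp_apply, LinearMap.comp_apply, hP]
      refine Fin.cases ?_ (fun b => ?_) a
      · rw [show σ (Finsupp.single 0 1) = 0 by ext b; simp [σ], map_zero, zero_add]
        simp [truncPow, τ]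
      · rw [show σ (Finsupp.single b.succ 1) = Finsupp.single b 1 by
          ext c; simp [σ, Finsupp.single_apply], hT, truncPow_of_lt (by simp), map_zero, add_zero]
        rfl
    have h4 : ∀ m, lin (cycProj k d r i) (lin (cycIncl k d r i) m) = 0 := by
      refine finsupp_map_eq (f := lin (cycProj k d r i) ∘ₗ lin (cycIncl k d r i)) (g := 0)
        fun a => ?_
      rw [LinearMap.comp_apply, hT, hP, truncPow_of_lt (by simp)]
      rfl
    refine (h0 i).of_isQis' (isQis_coneDesc (cycIncl k d r i) (cycProj k d r i) h4
      (Function.LeftInverse.injective h1) (Function.RightInverse.surjective h2) fun n hn => ?_)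
    refine ⟨σ n, ?_⟩
    have := h3 n
    rwa [hn, map_zero, add_zero] at this

end DerCat

/-! ### Nilpotency of `T` on homology -/

namespace DerCat

open DGMod

variable {k : Type u} [Field k] {d : ℤ}

/-- `T ^ N` acts as zero on homology for some `N`. -/
def IsNil (Z : DerCat k d) : Prop :=
  ∃ N : ℕ, ∀ (i j : ℤ) (h : i = j + N * d) (z : fr k d j ⟶ Z), tau N h ≫ z = 0

lemma isNil_proj_iff {M : DGMod k d} : IsNil ((proj k d).obj M) ↔
    ∃ N : ℕ, ∀ i, ∀ x ∈ M.gr i, M.diff x = 0 → ∃ b, M.diff b = (M.T ^ N) x := by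
  refine exists_congr fun N => ⟨fun h i x hx hx' => ?_, fun h i j e z => ?_⟩
  · have := h _ i rfl ((proj k d).map (freeHom M x hx hx'))
    rw [tau_comp_freeHom, proj_freeHom_eq_zero_iff] at this
    obtain ⟨a, -, ha⟩ := this
    exact ⟨a, ha.symm⟩
  · obtain ⟨x, hx, hx', rfl⟩ := exists_fr_map z
    obtain ⟨b, hb⟩ := h j x hx hx'
    rw [tau_comp_freeHom, proj_freeHom_eq_zero_iff]
    refine ⟨M.pr (i + 1) b, pr_mem _ _ _, ?_⟩
    rw [← pr_diff, hb, add_sub_cancel_right, e, pr_of_mem _ (T_pow_mem M N hx)]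

lemma isNil_shift {M : DGMod k d} (n : ℤ) (h : IsNil ((proj k d).obj M)) :
    IsNil ((proj k d).obj (DGMod.shift n M)) := by
  rw [isNil_proj_iff] at h ⊢
  obtain ⟨N, h⟩ := h
  refine ⟨N, fun i (x : M.carrier) hx (hx' : sgn k n • M.diff x = 0) => ?_⟩
  obtain ⟨b, hb⟩ := h (i - n) x hx ((smul_eq_zero.1 hx').resolve_left (sgn_ne_zero k n))
  refine ⟨(sgn k n • sgn k (n * d) ^ N • b : M.carrier), ?_⟩
  change sgn k n • M.diff (sgn k n • sgn k (n * d) ^ N • b) = ((sgn k (n * d) • M.T) ^ N) x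
  rw [map_smul, sgn_smul_sgn_smul, map_smul, hb, smul_pow, LinearMap.smul_apply]

/-- The long exact homology sequence of a cone, at its middle term. -/
lemma exists_factor_coneInl {M N : DGMod k d} (f : M ⟶ N) {i : ℤ}
    (z : fr k d i ⟶ (proj k d).obj (DGMod.cone f)) (h : z ≫ (proj k d).map (coneSnd f) = 0) :
    ∃ y, z = y ≫ (proj k d).map (coneInl f) := by
  obtain ⟨⟨n, m⟩, hx, hx', rfl⟩ := exists_fr_map z
  rw [← Functor.map_comp, show freeHom (DGMod.cone f) (n, m) hx hx' ≫ coneSnd f =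
    freeHom (DGMod.shift 1 M) m hx.2 (by
      have : -M.diff m = 0 := congrArg Prod.snd hx'
      change sgn k 1 • M.diff m = 0
      rw [← neg_neg (M.diff m), this, neg_zero, smul_zero]) from
      free_hom_ext (by rw [lin_comp, LinearMap.comp_apply, freeHom_gen, freeHom_gen]; rfl),
    proj_freeHom_eq_zero_iff] at h
  obtain ⟨(a : M.carrier), (ha : a ∈ M.gr (i + 1 - 1)), (h : m = sgn k 1 • M.diff a)⟩ := h
  rw [sgn_one, neg_smul, one_smul] at h
  rw [add_sub_cancel_right] at ha
  have hn : N.diff n + lin f m = 0 := congrArg Prod.fst hx'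
  refine ⟨(proj k d).map (freeHom N (n - lin f a) (Submodule.sub_mem _ hx.1 (lin_mem f ha)) ?_), ?_⟩
  · rw [map_sub, ← lin_diff, ← neg_neg (M.diff a), ← h, map_neg, sub_neg_eq_add, hn]
  · rw [← Functor.map_comp]
    refine proj_map_eq (free_homotopic (a := ((0 : N.carrier), a)) ⟨Submodule.zero_mem _, ?_⟩ ?_)
    · change a ∈ M.gr (i + 1 - 1)
      rwa [add_sub_cancel_right]
    · rw [lin_comp, LinearMap.comp_apply, freeHom_gen, freeHom_gen]
      refine Prod.ext ?_ ?_
      · change n - (n - lin f a) = N.diff 0 + lin f a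
        rw [map_zero, zero_add, sub_sub_cancel]
      · change m - 0 = -M.diff a
        rw [h, sub_zero]

lemma IsNil.cone {M N : DGMod k d} (f : M ⟶ N) (hM : IsNil ((proj k d).obj M))
    (hN : IsNil ((proj k d).obj N)) : IsNil ((proj k d).obj (DGMod.cone f)) := by
  obtain ⟨m, hM⟩ := isNil_shift 1 hM
  obtain ⟨n, hN⟩ := hN
  refine ⟨n + m, fun i j h z => ?_⟩
  -- T^m z dies in the homology of ΣM, so it comes from a class of N, which T^n kills. The exponents
  -- therefore add up.
  obtain ⟨y, hy⟩ := exists_factor_coneInl f (tau m rfl ≫ z) (by rw [Category.assoc, hM])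
  rw [← tau_comp_tau_eq n m (j := j + m * d) (by rw [h]; push_cast; ring) rfl rfl h,
    Category.assoc, hy, ← Category.assoc, hN, zero_comp]

lemma isNil_of_thick {Z : DerCat k d} (h : Thick ((proj k d).obj (trivial k d)) Z) : IsNil Z := by
  induction h with
  | base =>
    rw [isNil_proj_iff]
    refine ⟨1, fun i x _ _ => ⟨0, ?_⟩⟩
    rw [pow_one, map_zero]
    rfl
  | shift n _ ih =>
    rename_i Y _
    obtain ⟨M, rfl⟩ := exists_proj_obj_eq Y
    exact isNil_shift n ih
  | cone f _ _ hM hN => exact IsNil.cone f hM hN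
  | retract r _ ih =>
    obtain ⟨N, h⟩ := ih
    refine ⟨N, fun i j e z => ?_⟩
    have := h i j e (z ≫ r.i)
    rw [← Category.comp_id z, ← r.retract, ← Category.assoc z, ← Category.assoc, this, zero_comp]

/-- The hypothesis says that M is acyclic. Then the zero endomorphism of M is a quasi-isomorphism,
so it is invertible in the derived category. -/
lemma isZero_of_fr {Z : DerCat k d} (h : ∀ i (z : fr k d i ⟶ Z), z = 0) : IsZero Z := by
  obtain ⟨M, rfl⟩ := exists_proj_obj_eq Z
  have hM : ∀ x, M.diff x = 0 → ∃ b, M.diff b = x := by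
    intro x hx
    refine M.mem_of_pr_mem (LinearMap.range M.diff) fun j => ?_
    have := h j ((proj k d).map (freeHom M (M.pr j x) (pr_mem _ _ _)
      (by rw [← pr_diff, hx, map_zero])))
    rw [proj_freeHom_eq_zero_iff] at this
    obtain ⟨a, -, ha⟩ := this
    exact ⟨a, ha.symm⟩
  have hq : IsQis (0 : M ⟶ M) := by
    refine ⟨fun x hx _ => hM x hx, fun y hy => ?_⟩
    obtain ⟨b, hb⟩ := hM y hy
    refine ⟨0, -b, map_zero _, ?_⟩
    rw [map_neg, hb, map_zero, zero_sub]
  have := isIso_proj_map hq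
  rw [IsZero.iff_id_eq_zero]
  exact (IsIso.hom_inv_id ((proj k d).map (0 : M ⟶ M))).symm.trans
    ((congrArg (· ≫ _) ((proj k d).map_zero M M)).trans zero_comp)

/-- A non-zero object with `T` nilpotent on homology has a homology class generating a direct
summand of maximal length. -/
lemma IsNil.exists_class {Z : DerCat k d} (hZ : IsNil Z) (h0 : ¬ IsZero Z) :
    ∃ (r : ℕ) (i : ℤ) (z : fr k d i ⟶ Z), tau r rfl ≫ z ≠ 0 ∧
      ∀ (i j : ℤ) (h : i = j + (r + 1 : ℕ) * d) (z : fr k d j ⟶ Z), tau (r + 1) h ≫ z = 0 := by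
  classical
  obtain ⟨N, hN⟩ : ∃ N, Nat.find hZ = N := ⟨_, rfl⟩
  have hs := Nat.find_spec hZ
  rw [hN] at hs
  -- Exponent 0 would mean that there is no homology at all. Otherwise minimality of r + 1 provides
  -- a class not killed by T^r.
  rcases N with _ | r
  · refine absurd (isZero_of_fr fun i z => ?_) h0
    have := hs i i (by simp) z
    rwa [tau_zero, Category.id_comp] at this
  · have := Nat.find_min hZ (m := r) (by omega)
    push Not at this
    obtain ⟨i, j, rfl, z, hz⟩ := this
    exact ⟨r, j, z, hz, hs⟩

/-! ### Splitting off a summand -/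

/-- Homology as a functor on the derived category. -/
def homology (k : Type u) [Field k] (d : ℤ) : DerCat k d ⥤ ModuleCat.{u} k :=
  Localization.Construction.lift (HoCat.homology k d) fun _ _ _ hf => hf

lemma isQis_of_isIso {M N : DGMod k d} (f : M ⟶ N) (h : IsIso ((proj k d).map f)) : IsQis f := by
  have : IsIso ((homology k d).map ((proj k d).map f)) := inferInstance
  exact (isIso_homology_map_iff f).1 this

/-- As g ≫ φ is bijective on homology, g splits there with complement the homology of its cone. The
map Φ realises this decomposition by DG modules. -/
lemma isQis_prod_lift {P N J : DGMod k d} (g : P ⟶ N) (φ : N ⟶ J) (h : IsQis (g ≫ φ))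
    (Φ : N ⟶ DGMod.prod J (DGMod.cone g)) (hΦ : ∀ x, lin Φ x = (lin φ x, (x, 0))) : IsQis Φ := by
  have hg : ∀ x, P.diff x = 0 → (∃ y, J.diff y = lin φ (lin g x)) → ∃ z, P.diff z = x := h.1
  refine ⟨fun x hx => ?_, ?_⟩
  · rintro ⟨⟨u, z, p⟩, hy⟩
    rw [hΦ] at hy
    have h1 : J.diff u = lin φ x := congrArg Prod.fst hy
    have h2 : N.diff z + lin g p = x := congrArg (fun x => x.2.1) hy
    have h3 : -P.diff p = 0 := congrArg (fun x => x.2.2) hy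
    obtain ⟨q, rfl⟩ := hg p (neg_eq_zero.1 h3) ⟨u - lin φ z, by
      rw [map_sub, h1, ← h2, map_add, ← lin_diff]; abel⟩
    exact ⟨z + lin g q, by rw [map_add, ← lin_diff, h2]⟩
  · rintro ⟨u, z, p⟩ hy
    have h1 : J.diff u = 0 := congrArg Prod.fst hy
    have h2 : N.diff z + lin g p = 0 := congrArg (fun x => x.2.1) hy
    have h3 : -P.diff p = 0 := congrArg (fun x => x.2.2) hy
    obtain ⟨q, rfl⟩ := hg p (neg_eq_zero.1 h3) ⟨-lin φ z, by
      rw [map_neg, ← lin_diff, neg_eq_iff_add_eq_zero, ← map_add, h2, map_zero]⟩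
    rw [lin_diff, ← map_add] at h2
    obtain ⟨p, v, hp, hv⟩ := h.2 (u - lin φ (z + lin g q))
      (by rw [map_sub, h1, ← lin_diff, h2, map_zero, sub_zero])
    refine ⟨z + lin g q + lin g p, (v, (0, q + p)), ?_, ?_⟩
    · rw [map_add, h2, ← lin_diff, hp, map_zero, add_zero]
    · rw [hΦ]
      refine Prod.ext ?_ (Prod.ext ?_ ?_)
      · change J.diff v = lin φ (z + lin g q + lin g p) - u
        rw [hv, map_add (lin φ) (z + lin g q)]
        change lin φ (lin g p) - _ = _
        abel
      · change N.diff 0 + lin g (q + p) = z + lin g q + lin g p - z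
        rw [map_zero, map_add]
        abel
      · change -P.diff (q + p) = 0 - P.diff q
        rw [map_add, hp, add_zero, zero_sub]

/-- The data of a direct sum decomposition `Z = X ⊕ Y`. -/
structure Splitting {C : Type*} [Category C] [Preadditive C] (Z X Y : C) where
  inl : X ⟶ Z
  inr : Y ⟶ Z
  fst : Z ⟶ X
  snd : Z ⟶ Y
  inl_fst : inl ≫ fst = 𝟙 X
  inr_snd : inr ≫ snd = 𝟙 Y
  inl_snd : inl ≫ snd = 0
  inr_fst : inr ≫ fst = 0
  total : fst ≫ inl + snd ≫ inr = 𝟙 Z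

/-- The canonical decomposition of a product of DG modules. -/
def prodSplitting (M N : DGMod k d) : Splitting (DGMod.prod M N) M N where
  inl := mkHom (N := DGMod.prod M N) (LinearMap.inl k _ _)
    (fun _ _ hx => ⟨hx, Submodule.zero_mem _⟩)
    (fun _ => Prod.ext rfl (map_zero N.T).symm) (fun _ => Prod.ext rfl (map_zero N.diff).symm)
  inr := mkHom (N := DGMod.prod M N) (LinearMap.inr k _ _)
    (fun _ _ hx => ⟨Submodule.zero_mem _, hx⟩)
    (fun _ => Prod.ext (map_zero M.T).symm rfl) (fun _ => Prod.ext (map_zero M.diff).symm rfl)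
  fst := mkHom (M := DGMod.prod M N) (LinearMap.fst k _ _) (fun _ _ hx => hx.1)
    (fun _ => rfl) (fun _ => rfl)
  snd := mkHom (M := DGMod.prod M N) (LinearMap.snd k _ _) (fun _ _ hx => hx.2)
    (fun _ => rfl) (fun _ => rfl)
  inl_fst := rfl
  inr_snd := rfl
  inl_snd := rfl
  inr_fst := rfl
  total := hom_ext fun x => by
    rw [lin_add]
    exact Prod.ext (add_zero _) (zero_add _)

/-- The image of a decomposition under an additive functor. -/
def Splitting.map {C D : Type*} [Category C] [Preadditive C] [Category D] [Preadditive D]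
    {Z X Y : C} (s : Splitting Z X Y) (F : C ⥤ D) [F.Additive] :
    Splitting (F.obj Z) (F.obj X) (F.obj Y) where
  inl := F.map s.inl
  inr := F.map s.inr
  fst := F.map s.fst
  snd := F.map s.snd
  inl_fst := by rw [← F.map_comp, s.inl_fst, F.map_id]
  inr_snd := by rw [← F.map_comp, s.inr_snd, F.map_id]
  inl_snd := by rw [← F.map_comp, s.inl_snd, F.map_zero]
  inr_fst := by rw [← F.map_comp, s.inr_fst, F.map_zero]
  total := by rw [← F.map_comp, ← F.map_comp, ← F.map_add, s.total, F.map_id]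

/-- Transport of a decomposition along isomorphisms. -/
def Splitting.ofIso {C : Type*} [Category C] [Preadditive C] {Z Z' X X' Y : C}
    (s : Splitting Z X Y) (e : Z' ≅ Z) (e' : X' ≅ X) : Splitting Z' X' Y where
  inl := e'.hom ≫ s.inl ≫ e.inv
  inr := s.inr ≫ e.inv
  fst := e.hom ≫ s.fst ≫ e'.inv
  snd := e.hom ≫ s.snd
  inl_fst := by simp [reassoc_of% s.inl_fst]
  inr_snd := by simp [s.inr_snd]
  inl_snd := by simp [s.inl_snd]
  inr_fst := by simp [reassoc_of% s.inr_fst]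
  total := by
    have : e.hom ≫ (s.fst ≫ s.inl + s.snd ≫ s.inr) ≫ e.inv = 𝟙 _ := by rw [s.total]; simp
    simpa using this

/-- A non-zero object of the thick subcategory has a direct summand `Σ ^ i (A / T ^ (r + 1))`. -/
lemma exists_splitting (hd : d ≠ 0) (hd' : d ≠ -1) {Z : DerCat k d}
    (h : Thick ((proj k d).obj (trivial k d)) Z) (h0 : ¬ IsZero Z) :
    ∃ (r : ℕ) (i : ℤ) (C : DerCat k d), Thick ((proj k d).obj (trivial k d)) C ∧
      Nonempty (Splitting Z (X k d r i) C) := by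
  obtain ⟨r, i, z, hz, hZ⟩ := (isNil_of_thick h).exists_class h0
  obtain ⟨N, rfl⟩ := exists_proj_obj_eq Z
  obtain ⟨f, rfl⟩ := exists_gen_eq rfl z (hZ _ _ rfl z)
  obtain ⟨g, hg⟩ := exists_proj_map_eq kProj_res ((proj k d).map (resAug r i) ≫ f)
  -- T^(r+1) kills every class of Z, so purity amounts to T^r z ≠ 0.
  obtain ⟨φ, hφ⟩ := exists_comp_ne_zero hd g (fun z' => by
    rw [hg, IsIso.inv_hom_id_assoc, hZ]
    exact hz)
  have hq := isQis_of_isIso _ (isIso_res_cores hd hd' _ hφ)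
  have s := prodSplitting (cores k d r i) (DGMod.cone g)
  let Φ : N ⟶ DGMod.prod (cores k d r i) (DGMod.cone g) :=
    mkHom (N := DGMod.prod (cores k d r i) (DGMod.cone g))
      ((lin φ).prod (lin (coneInl g))) (fun _ _ hx => ⟨lin_mem φ hx, lin_mem (coneInl g) hx⟩)
      (fun _ => Prod.ext (lin_T φ _) (lin_T (coneInl g) _))
      (fun _ => Prod.ext (lin_diff φ _) (lin_diff (coneInl g) _))
  have := isIso_proj_map (isQis_prod_lift g φ hq Φ fun _ => rfl)
  refine ⟨r, i, (proj k d).obj (DGMod.cone g), Thick.cone g ?_ h,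
    ⟨(s.map (proj k d)).ofIso (asIso ((proj k d).map Φ))
      (asIso ((proj k d).map (coresAug r i)))⟩⟩
  exact (thick_X r i).of_isQis' isQis_resAug

end DerCat

/-! ### Automorphisms of `ℤA_∞` and uniqueness of coordinates on a component -/

lemma eqvGen_ZAInftyArrow (p q : ℤ × ℕ) : Relation.EqvGen ZAInftyArrow p q := by
  have hup : ∀ (n : ℤ) (r : ℕ), Relation.EqvGen ZAInftyArrow (n, 0) (n, r) := by
    intro n r
    induction r with
    | zero => exact .refl _
    | succ r ih => exact .trans _ _ _ ih (.rel _ _ (Or.inl ⟨rfl, rfl⟩))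
  have hstep : ∀ n : ℤ, Relation.EqvGen ZAInftyArrow (n, 0) (n + 1, 0) := fun n =>
    .trans _ (n, 1) _ (.rel _ _ (Or.inl ⟨rfl, rfl⟩)) (.rel _ _ (Or.inr ⟨rfl, rfl⟩))
  have hrow : ∀ n : ℤ, Relation.EqvGen ZAInftyArrow (0, 0) (n, 0) := by
    intro n
    induction n using Int.induction_on with
    | zero => exact .refl _
    | succ n ih => exact .trans _ _ _ ih (hstep _)
    | pred n ih =>
      have := hstep (-(n : ℤ) - 1)
      rw [sub_add_cancel] at this
      exact .trans _ _ _ ih (.symm _ _ this)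
  have h : ∀ p, Relation.EqvGen ZAInftyArrow (0, 0) p := fun p => .trans _ _ _ (hrow p.1) (hup _ _)
  exact .trans _ _ _ (.symm _ _ (h p)) (h q)

/-- Every automorphism of the quiver `ℤA_∞` is a translation. -/
lemma exists_translation (θ : ℤ × ℕ → ℤ × ℕ) (hθ : Function.Bijective θ)
    (h : ∀ p q, ZAInftyArrow p q ↔ ZAInftyArrow (θ p) (θ q)) :
    ∃ e : ℤ, ∀ (n : ℤ) (r : ℕ), θ (n, r) = (n + e, r) := by
  -- The vertices of height 0 are those with only one outgoing arrow, so an automorphism preserves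
  -- the base line.
  have h0 : ∀ n : ℤ, (θ (n, 0)).2 = 0 := by
    intro n
    by_contra hn
    obtain ⟨q₁, h1⟩ := hθ.2 ((θ (n, 0)).1, (θ (n, 0)).2 + 1)
    obtain ⟨q₂, h2⟩ := hθ.2 ((θ (n, 0)).1 + 1, (θ (n, 0)).2 - 1)
    have a1 : ZAInftyArrow (n, 0) q₁ := (h _ _).2 (by rw [h1]; exact Or.inl ⟨rfl, rfl⟩)
    have a2 : ZAInftyArrow (n, 0) q₂ := (h _ _).2 (by
      rw [h2]; exact Or.inr ⟨rfl, by simp only; omega⟩)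
    have : q₁ = q₂ := by
      rcases a1 with a1 | a1 <;> rcases a2 with a2 | a2 <;> simp only at a1 a2
      · exact Prod.ext (a1.1.trans a2.1.symm) (a1.2.trans a2.2.symm)
      all_goals omega
    rw [this, h2] at h1
    have := congrArg Prod.fst h1
    simp at this
  have h1 : ∀ n : ℤ, θ (n, 1) = ((θ (n, 0)).1, 1) := by
    intro n
    have := (h (n, 0) (n, 1)).1 (Or.inl ⟨rfl, rfl⟩)
    rcases this with ⟨a, b⟩ | ⟨a, b⟩ <;> rw [h0] at b
    · exact Prod.ext a b
    · omega
  have h2 : ∀ n : ℤ, (θ (n + 1, 0)).1 = (θ (n, 0)).1 + 1 := by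
    intro n
    have := (h (n, 1) (n + 1, 0)).1 (Or.inr ⟨rfl, rfl⟩)
    rw [h1] at this
    rcases this with ⟨a, b⟩ | ⟨a, b⟩
    · rw [h0] at b
      omega
    · exact a
  have h3 : ∀ n : ℤ, (θ (n, 0)).1 = n + (θ (0, 0)).1 := by
    intro n
    induction n using Int.induction_on with
    | zero => simp
    | succ n ih => rw [h2, ih]; ring
    | pred n ih =>
      have := h2 (-(n : ℤ) - 1)
      rw [sub_add_cancel, ih] at this
      linarith
  -- Two consecutive heights are carried along: of the two successors of the image of (n, r + 1),
  -- the lower one is already the image of (n + 1, r), which leaves the upper one for (n, r + 2).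
  have key : ∀ r : ℕ, (∀ n : ℤ, θ (n, r) = (n + (θ (0, 0)).1, r)) ∧
      ∀ n : ℤ, θ (n, r + 1) = (n + (θ (0, 0)).1, r + 1) := by
    intro r
    induction r with
    | zero => exact ⟨fun n => Prod.ext (h3 n) (h0 n), fun n => by rw [h1, h3]⟩
    | succ r ih =>
      refine ⟨ih.2, fun n => ?_⟩
      have := (h (n, r + 1) (n, r + 1 + 1)).1 (Or.inl ⟨rfl, rfl⟩)
      rw [ih.2] at this
      rcases this with ⟨a, b⟩ | ⟨a, b⟩
      · exact Prod.ext a b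
      · have e : θ (n, r + 1 + 1) = θ (n + 1, r) := by
          rw [ih.1]
          refine Prod.ext ?_ ?_
          · rw [a]; ring
          · simpa using b
        have := congrArg Prod.snd (hθ.1 e)
        simp only at this
        omega
  exact ⟨_, fun n r => (key r).1 n⟩

/-! ### Isomorphism invariance of arrows and components -/

lemma IsIrred.of_iso {C : Type u} [Category.{v} C] {X Y X' Y' : C} {f : X ⟶ Y} (hf : IsIrred f) (e : X ≅ X') (e' : Y ≅ Y') :
    IsIrred (e.inv ≫ f ≫ e'.hom) := by
  refine ⟨fun h => hf.1 ?_, fun h => hf.2.1 ?_, fun Z g h hgh => ?_⟩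
  · obtain ⟨⟨p, hp⟩⟩ := h.exists_splitMono
    refine IsSplitMono.mk' ⟨e'.hom ≫ p ≫ e.inv, ?_⟩
    rw [← cancel_epi e.inv, ← cancel_mono e.hom]
    simpa using hp
  · obtain ⟨⟨p, hp⟩⟩ := h.exists_splitEpi
    refine IsSplitEpi.mk' ⟨e'.hom ≫ p ≫ e.inv, ?_⟩
    rw [← cancel_mono e'.hom, ← cancel_epi e'.inv]
    simpa using hp
  · rcases hf.2.2 Z (e.hom ≫ g) (h ≫ e'.inv) (by
      rw [Category.assoc, ← Category.assoc g, hgh]; simp) with h1 | h1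
    · left
      obtain ⟨⟨p, hp⟩⟩ := h1.exists_splitMono
      refine IsSplitMono.mk' ⟨p ≫ e.hom, ?_⟩
      rw [← cancel_epi e.hom, ← cancel_mono e.inv]
      simpa using hp
    · right
      obtain ⟨⟨p, hp⟩⟩ := h1.exists_splitEpi
      refine IsSplitEpi.mk' ⟨e'.inv ≫ p, ?_⟩
      rw [← cancel_mono e'.inv, ← cancel_epi e'.hom]
      simpa using hp

section

variable {C : Type u} [Category.{v} C] [Preadditive C]

lemma IsZAInftyComponent.arConnected {φ : ℤ × ℕ → C} (hφ : IsZAInftyComponent φ) (p q : ℤ × ℕ) :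
    ARConnected (φ p) (φ q) := by
  induction eqvGen_ZAInftyArrow p q with
  | rel p q h => exact .rel _ _ (Or.inr ((hφ.arrow_iff p q).2 h))
  | refl p => exact .refl _
  | symm p q _ ih => exact .symm _ _ ih
  | trans p q r _ _ ih ih' => exact .trans _ _ _ ih ih'

lemma IsIndec.of_iso {X Y : C} (e : X ≅ Y) (h : IsIndec X) : IsIndec Y :=
  ⟨fun hY => h.1 (hY.of_iso e), fun A B b hb ⟨e'⟩ => h.2 A B b hb ⟨e ≪≫ e'⟩⟩

lemma ARArrow.of_iso {X Y X' Y' : C} (h : ARArrow X Y) (e : X ≅ X') (e' : Y ≅ Y') :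
    ARArrow X' Y' :=
  ⟨h.1.of_iso e, h.2.1.of_iso e', h.2.2.imp' _ fun _ hf => hf.of_iso e e'⟩

/-- The identification of a component with `ℤA_∞` is unique up to translation. -/
lemma IsZAInftyComponent.exists_translation {φ ψ : ℤ × ℕ → C} (hφ : IsZAInftyComponent φ)
    (hψ : IsZAInftyComponent ψ) {p q : ℤ × ℕ} (e : φ p ≅ ψ q) :
    ∃ a : ℤ, ∀ (n : ℤ) (r : ℕ), Nonempty (φ (n, r) ≅ ψ (n + a, r)) := by
  have he : ARConnected (φ p) (ψ q) := .rel _ _ (Or.inl ⟨e⟩)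
  have h1 : ∀ v, ∃ v', Nonempty (φ v ≅ ψ v') := fun v =>
    hψ.surjective q _ (hφ.indec v) (.trans _ _ _ (.symm _ _ he) (hφ.arConnected p v))
  choose θ hθ using h1
  have hbij : Function.Bijective θ := by
    refine ⟨fun v v' h => ?_, fun v => ?_⟩
    · obtain ⟨e1⟩ := hθ v
      obtain ⟨e2⟩ := hθ v'
      rw [← h] at e2
      exact hφ.injective _ _ ⟨e1 ≪≫ e2.symm⟩
    · obtain ⟨v', ⟨e'⟩⟩ := hφ.surjective p _ (hψ.indec v)
        (.trans _ _ _ he (hψ.arConnected q v))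
      obtain ⟨e1⟩ := hθ v'
      exact ⟨v', hψ.injective _ _ ⟨e1.symm ≪≫ e'.symm⟩⟩
  obtain ⟨a, ha⟩ := SphericalAR.exists_translation θ hbij fun v v' => by
    obtain ⟨e1⟩ := hθ v
    obtain ⟨e2⟩ := hθ v'
    rw [← hφ.arrow_iff, ← hψ.arrow_iff]
    exact ⟨fun h => h.of_iso e1 e2, fun h => h.of_iso e1.symm e2.symm⟩
  exact ⟨a, fun n r => ha n r ▸ hθ (n, r)⟩

end

/-! ### Irreducible morphisms between the objects `Σ ^ i (A / T ^ (r + 1))` -/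

namespace DerCat

open DGMod

variable {k : Type u} [Field k] {d : ℤ}

lemma id_X_ne_zero (r : ℕ) (i : ℤ) : 𝟙 (X k d r i) ≠ 0 := fun h =>
  gen_ne_zero (k := k) (d := d) (r := r) (i := i) (by rw [← Category.comp_id (gen r i), h, comp_zero])

/-- p ≫ f is a scalar c, and f = f ≫ p ≫ f = c f with f ≠ 0 gives c = 1. So a split monomorphism
between these objects is an isomorphism. -/
lemma eq_of_retract (hd : d ≠ 0) (hd' : d ≠ -1) {r s : ℕ} {i j : ℤ} {f : X k d r i ⟶ X k d s j}
    {p : X k d s j ⟶ X k d r i} (h : f ≫ p = 𝟙 _) : r = s ∧ i = j := by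
  obtain ⟨c, hc⟩ := exists_eq_smul_id hd hd' (p ≫ f)
  have h1 : (1 - c) • f = 0 := by
    rw [sub_smul, one_smul, sub_eq_zero]
    calc f = f ≫ p ≫ f := by rw [← Category.assoc, h, Category.id_comp]
      _ = c • f := by rw [hc, Linear.comp_smul, Category.comp_id]
  rcases smul_eq_zero.1 h1 with h2 | h2
  · rw [← sub_eq_zero.1 h2, one_smul] at hc
    exact eq_of_iso hd ⟨f, p, h, hc⟩
  · rw [h2, zero_comp] at h
    exact absurd h.symm (id_X_ne_zero r i)

/-- The arrows between the objects `Σ ^ i (A / T ^ (r + 1))` in the AR quiver. -/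
def ArrowRel (d : ℤ) (r : ℕ) (i : ℤ) (s : ℕ) (j : ℤ) : Prop :=
  (s = r + 1 ∧ j = i - d) ∨ (r = s + 1 ∧ j = i)

/-- A non-zero morphism that only factors in the trivial ways is of one of two kinds. -/
lemma arrowRel_of_factorizations (hd : d ≠ 0) (hd' : d ≠ -1) {r s : ℕ} {i j : ℤ}
    {f : X k d r i ⟶ X k d s j} (hf : f ≠ 0) (hne : ¬ (r = s ∧ i = j))
    (h : ∀ (r' : ℕ) (i' : ℤ) (g : X k d r i ⟶ X k d r' i') (g' : X k d r' i' ⟶ X k d s j),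
      g ≫ g' = f → (r = r' ∧ i = i') ∨ (r' = s ∧ i' = j)) : ArrowRel d r i s j := by
  by_cases hg : gen r i ≫ f = 0
  · obtain ⟨b, -, -, e, c, rfl⟩ := exists_eq_smul_bd hd hf hg
    -- A morphism of the second kind lifts along the projection X(s+1,j) → X(s,j), so it always
    -- factors through a third object.
    obtain ⟨π, hπ⟩ := exists_gen_comp_eq (k := k) (d := d) (r := s + 1) (s := s) (m := 0)
      (i := j) (j := j) (by simp) (by omega)
    rw [tau_zero, Category.id_comp] at hπ
    rcases h (s + 1) j (c • (bd r i ≫ tau b e ≫ gen (s + 1) j)) π (by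
      rw [Linear.smul_comp, Category.assoc, Category.assoc, hπ]) with ⟨-, h1⟩ | ⟨h1, -⟩
    · exact absurd (eq_zero_of_gen_comp hd hd' (m := 0) (by simp [h1]) hg) hf
    · omega
  · obtain ⟨m, e, c, hm, hs, -, hc⟩ := gen_comp_cases hd hg
    have fac : ∀ (r' : ℕ) (i' : ℤ) (g : X k d r i ⟶ X k d r' i')
        (g' : X k d r' i' ⟶ X k d s j), gen r i ≫ g ≫ g' = tau m e ≫ gen s j →
        (r = r' ∧ i = i') ∨ (r' = s ∧ i' = j) := fun r' i' g g' hgg => by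
      refine h r' i' (c • g) g' (sub_eq_zero.1 (eq_zero_of_gen_comp hd hd' e ?_))
      rw [Preadditive.comp_sub, Linear.smul_comp, Linear.comp_smul, hgg, hc, sub_self]
    -- With l = s - m, a morphism of the first kind is, up to a scalar, the projection X(r,i) →
    -- X(l,i) followed by an inclusion. So either l = r or m = 0. An inclusion then factors through
    -- X(r+1,i-d) and a projection through X(r-1,i), which only leaves the one-step cases.
    obtain ⟨l, rfl⟩ : ∃ l, s = m + l := ⟨s - m, by omega⟩
    obtain ⟨g, hg1⟩ := exists_gen_comp_eq (k := k) (d := d) (r := r) (s := l) (m := 0)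
      (i := i) (j := i) (by simp) (by omega)
    obtain ⟨g', hg2⟩ := exists_gen_comp_eq (k := k) (r := l) (s := m + l) e le_rfl
    rw [tau_zero, Category.id_comp] at hg1
    rcases fac l i g g' (by rw [← Category.assoc, hg1, hg2]) with ⟨rfl, -⟩ | ⟨h1, rfl⟩
    · rcases m with _ | m
      · exact absurd ⟨by omega, by simpa using e⟩ hne
      · have e1 : i = i - d + (1 : ℕ) * d := by push_cast; ring
        have e2 : i - d = j + m * d := by rw [e]; push_cast; ring
        obtain ⟨g, hg1⟩ := exists_gen_comp_eq (k := k) (d := d) (r := r) (s := r + 1) e1 (by omega)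
        obtain ⟨g', hg2⟩ := exists_gen_comp_eq (k := k) (d := d) (r := r + 1) (s := m + 1 + r) e2
          (by omega)
        rcases fac (r + 1) (i - d) g g' (by
          rw [← Category.assoc, hg1, Category.assoc, hg2, ← Category.assoc,
            tau_comp_tau_eq 1 m e1 e2 (by omega) e]) with ⟨h1, -⟩ | ⟨h1, h2⟩
        · omega
        · exact Or.inl ⟨h1.symm, h2.symm⟩
    · obtain rfl : m = 0 := by omega
      by_cases hr : r = l
      · exact absurd ⟨by omega, rfl⟩ hne
      · obtain ⟨r, rfl⟩ : ∃ r', r = r' + 1 := ⟨r - 1, by omega⟩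
        obtain ⟨g, hg1⟩ := exists_gen_comp_eq (k := k) (d := d) (r := r + 1) (s := r) (m := 0)
          (i := i) (j := i) (by simp) (by omega)
        obtain ⟨g', hg2⟩ := exists_gen_comp_eq (k := k) (r := r) (s := 0 + l) e (by omega)
        rw [tau_zero, Category.id_comp] at hg1
        rcases fac r i g g' (by rw [← Category.assoc, hg1, hg2]) with ⟨h1, -⟩ | ⟨h1, -⟩
        · omega
        · exact Or.inr ⟨by omega, rfl⟩

/-- The morphisms of the two kinds exist and only factor in the trivial ways. -/
lemma exists_of_arrowRel (hd : d ≠ 0) (hd' : d ≠ -1) {r s : ℕ} {i j : ℤ}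
    (h : ArrowRel d r i s j) : ∃ f : X k d r i ⟶ X k d s j,
      ∀ (Z : DerCat k d) (g : X k d r i ⟶ Z) (g' : Z ⟶ X k d s j), g ≫ g' = f →
        (∃ p, g ≫ p = 𝟙 _) ∨ ∃ q, q ≫ g' = 𝟙 _ := by
  rcases h with ⟨rfl, rfl⟩ | ⟨rfl, rfl⟩
  · have e : i = i - d + (1 : ℕ) * d := by push_cast; ring
    obtain ⟨f, hf⟩ := exists_gen_comp_eq (k := k) (d := d) (r := r) (s := r + 1) e (by omega)
    exact ⟨f, fun Z g g' hgg => split_of_comp_eq_incl hd hd' g g' e (by rw [hgg, hf])⟩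
  · obtain ⟨f, hf⟩ := exists_gen_comp_eq (k := k) (d := d) (r := s + 1) (s := s) (m := 0)
      (i := j) (j := j) (by simp) (by omega)
    rw [tau_zero, Category.id_comp] at hf
    exact ⟨f, fun Z g g' hgg => split_of_comp_eq_proj hd hd' g g' (by rw [hgg, hf])⟩

end DerCat

/-! ### The category `T` -/

namespace SphericalCat

open DerCat

variable {k : Type u} [Field k] {w : ℤ}

variable (k w) in
/-- The object `Σ ^ i (A / T ^ (r + 1))` of `T`. -/
def X (r : ℕ) (i : ℤ) : SphericalCat k w := ⟨DerCat.X k (w - 1) r i, thick_X r i⟩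

lemma isZero_of_isZero_obj {Z : SphericalCat k w} (h : IsZero Z.obj) : IsZero Z := by
  rw [IsZero.iff_id_eq_zero] at h ⊢
  exact ObjectProperty.hom_ext _ h

lemma isZero_obj {Z : SphericalCat k w} (h : IsZero Z) : IsZero Z.obj := by
  rw [IsZero.iff_id_eq_zero] at h ⊢
  exact congrArg (fun f => f.hom) h

/-- An isomorphism in the ambient derived category. -/
def objIso {Y Z : SphericalCat k w} (e : Y ≅ Z) : Y.obj ≅ Z.obj := (ObjectProperty.ι _).mapIso e

lemma eq_of_iso_X (hw₁ : w ≠ 1) {r s : ℕ} {i j : ℤ} (e : X k w r i ≅ X k w s j) :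
    r = s ∧ i = j :=
  DerCat.eq_of_iso (k := k) (d := w - 1) (by omega) (objIso e)

/-- By `exists_splitting` some X(r,i) is a direct summand of t, and indecomposability makes its
complement vanish. -/
lemma exists_iso_X (hw₀ : w ≠ 0) (hw₁ : w ≠ 1) {t : SphericalCat k w} (ht : IsIndec t) :
    ∃ r i, Nonempty (t ≅ X k w r i) := by
  obtain ⟨r, i, C, hC, ⟨s⟩⟩ := exists_splitting (by omega) (by omega) t.property
    fun h => ht.1 (isZero_of_isZero_obj h)
  refine ⟨r, i, ?_⟩
  let C' : SphericalCat k w := ⟨C, hC⟩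
  let b : BinaryBicone (X k w r i) C' :=
    { pt := t
      fst := ObjectProperty.homMk s.fst
      snd := ObjectProperty.homMk s.snd
      inl := ObjectProperty.homMk s.inl
      inr := ObjectProperty.homMk s.inr
      inl_fst := ObjectProperty.hom_ext _ s.inl_fst
      inl_snd := ObjectProperty.hom_ext _ s.inl_snd
      inr_fst := ObjectProperty.hom_ext _ s.inr_fst
      inr_snd := ObjectProperty.hom_ext _ s.inr_snd }
  have hb : b.IsBilimit := isBinaryBilimitOfTotal b (ObjectProperty.hom_ext _ s.total)
  rcases ht.2 _ _ b ⟨hb⟩ ⟨Iso.refl _⟩ with h | h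
  · exact absurd ((IsZero.iff_id_eq_zero _).1 (isZero_obj h)) (id_X_ne_zero r i)
  · have hsnd : s.snd = 0 := (isZero_obj h).eq_of_tgt _ _
    have htot := s.total
    rw [hsnd, zero_comp, add_zero] at htot
    exact ⟨ObjectProperty.isoMk _ ⟨s.fst, s.inl, htot, s.inl_fst⟩⟩

/-- The projector onto the first summand is a scalar c. If c = 0 the first summand vanishes,
otherwise the second one does. -/
lemma isIndec_X (hw₀ : w ≠ 0) (hw₁ : w ≠ 1) (r : ℕ) (i : ℤ) : IsIndec (X k w r i) := by
  refine ⟨fun h => id_X_ne_zero r i ((IsZero.iff_id_eq_zero _).1 (isZero_obj h)),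
    fun Y Z b _ ⟨e⟩ => ?_⟩
  obtain ⟨c, hc⟩ := exists_eq_smul_id (k := k) (d := w - 1) (by omega) (by omega)
    (e.hom ≫ b.fst ≫ b.inl ≫ e.inv).hom
  have hc' : e.hom ≫ b.fst ≫ b.inl ≫ e.inv = c • 𝟙 _ := ObjectProperty.hom_ext _ hc
  have h : b.fst ≫ b.inl = c • 𝟙 _ := by
    calc b.fst ≫ b.inl = e.inv ≫ (e.hom ≫ b.fst ≫ b.inl ≫ e.inv) ≫ e.hom := by simp
      _ = c • 𝟙 _ := by rw [hc', Linear.smul_comp, Linear.comp_smul]; simp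
  by_cases h0 : c = 0
  · left
    rw [IsZero.iff_id_eq_zero]
    calc 𝟙 Y = b.inl ≫ (b.fst ≫ b.inl) ≫ b.fst := by simp
      _ = 0 := by rw [h, h0, zero_smul, zero_comp, comp_zero]
  · right
    rw [IsZero.iff_id_eq_zero]
    have h1 : c • b.inr = 0 := by
      rw [← Category.comp_id b.inr, ← Linear.comp_smul, ← h, ← Category.assoc, b.inr_fst, zero_comp]
    rw [← b.inr_snd, (smul_eq_zero.1 h1).resolve_left h0, zero_comp]

lemma eq_of_isSplitMono (hw₀ : w ≠ 0) (hw₁ : w ≠ 1) {r s : ℕ} {i j : ℤ}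
    {f : X k w r i ⟶ X k w s j} (hf : IsSplitMono f) : r = s ∧ i = j := by
  obtain ⟨⟨p, hp⟩⟩ := hf.exists_splitMono
  exact eq_of_retract (k := k) (d := w - 1) (by omega) (by omega) (congrArg (fun f => f.hom) hp)

lemma eq_of_isSplitEpi (hw₀ : w ≠ 0) (hw₁ : w ≠ 1) {r s : ℕ} {i j : ℤ}
    {f : X k w r i ⟶ X k w s j} (hf : IsSplitEpi f) : r = s ∧ i = j := by
  obtain ⟨⟨p, hp⟩⟩ := hf.exists_splitEpi
  have := eq_of_retract (k := k) (d := w - 1) (by omega) (by omega) (congrArg (fun f => f.hom) hp)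
  exact ⟨this.1.symm, this.2.symm⟩

/-- The zero morphism factors as 0 ≫ 0 through its source, and if either factor splits then so does
the zero morphism itself. -/
lemma IsIrred.ne_zero {C : Type u} [Category.{v} C] [Preadditive C] {Y Z : C} {f : Y ⟶ Z}
    (hf : IsIrred f) : f ≠ 0 := by
  rintro rfl
  rcases hf.2.2 Y 0 0 (by simp) with h | h
  · obtain ⟨⟨p, hp⟩⟩ := h.exists_splitMono
    refine hf.1 (IsSplitMono.mk' ⟨0, ?_⟩)
    rw [← hp, zero_comp, zero_comp]
  · obtain ⟨⟨p, hp⟩⟩ := h.exists_splitEpi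
    refine hf.2.1 (IsSplitEpi.mk' ⟨0, ?_⟩)
    rw [← hp, comp_zero, comp_zero]

lemma arArrow_X_iff (hw₀ : w ≠ 0) (hw₁ : w ≠ 1) {r s : ℕ} {i j : ℤ} :
    ARArrow (X k w r i) (X k w s j) ↔ ArrowRel (w - 1) r i s j := by
  constructor
  · rintro ⟨-, -, f, hf⟩
    refine arrowRel_of_factorizations (k := k) (by omega) (by omega) (f := f.hom)
      (fun h => IsIrred.ne_zero hf (ObjectProperty.hom_ext _ h)) ?_ fun r' i' g g' hgg => ?_
    · rintro ⟨rfl, rfl⟩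
      obtain ⟨p, hp⟩ := isIso_of_ne_zero (k := k) (d := w - 1) (by omega) (by omega) (f := f.hom)
        (fun h => IsIrred.ne_zero hf (ObjectProperty.hom_ext _ h))
      exact hf.1 (IsSplitMono.mk' ⟨ObjectProperty.homMk p, ObjectProperty.hom_ext _ hp⟩)
    · rcases hf.2.2 (X k w r' i') (ObjectProperty.homMk g) (ObjectProperty.homMk g')
        (ObjectProperty.hom_ext _ hgg) with h | h
      · exact Or.inl (eq_of_isSplitMono hw₀ hw₁ h)
      · exact Or.inr (eq_of_isSplitEpi hw₀ hw₁ h)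
  · intro h
    obtain ⟨f, hf⟩ := exists_of_arrowRel (k := k) (d := w - 1) (by omega) (by omega) h
    have hne : ¬ (r = s ∧ i = j) := by
      rcases h with ⟨rfl, -⟩ | ⟨rfl, -⟩ <;> omega
    refine ⟨isIndec_X hw₀ hw₁ r i, isIndec_X hw₀ hw₁ s j, ObjectProperty.homMk f,
      fun h' => hne (eq_of_isSplitMono hw₀ hw₁ h'), fun h' => hne (eq_of_isSplitEpi hw₀ hw₁ h'),
      fun Z g g' hgg => ?_⟩
    rcases hf Z.obj g.hom g'.hom (congrArg (fun f => f.hom) hgg) with ⟨p, hp⟩ | ⟨p, hp⟩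
    · exact Or.inl (IsSplitMono.mk' ⟨ObjectProperty.homMk p, ObjectProperty.hom_ext _ hp⟩)
    · exact Or.inr (IsSplitEpi.mk' ⟨ObjectProperty.homMk p, ObjectProperty.hom_ext _ hp⟩)

/-! ### The components of the AR quiver -/

variable (k w) in
/-- The coordinates on the component of the AR quiver that contains `Σ ^ c k`. -/
def coord (c : ℤ) (p : ℤ × ℕ) : SphericalCat k w := X k w p.2 (c - (p.1 + p.2) * (w - 1))

lemma arrowRel_coord_iff (hw₁ : w ≠ 1) (c : ℤ) (p q : ℤ × ℕ) :
    ArrowRel (w - 1) p.2 (c - (p.1 + p.2) * (w - 1)) q.2 (c - (q.1 + q.2) * (w - 1)) ↔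
      ZAInftyArrow p q := by
  obtain ⟨n, r⟩ := p
  obtain ⟨m, s⟩ := q
  have hd : w - 1 ≠ 0 := by omega
  have key : ∀ x y : ℤ, c - x * (w - 1) = c - y * (w - 1) ↔ x = y := fun x y => by
    rw [sub_right_inj, mul_left_inj' hd]
  simp only [ArrowRel, ZAInftyArrow]
  rw [show c - ((n : ℤ) + r) * (w - 1) - (w - 1) = c - (n + r + 1) * (w - 1) by ring, key, key]
  omega

lemma isZAInftyComponent_coord (hw₀ : w ≠ 0) (hw₁ : w ≠ 1) (c : ℤ) :
    IsZAInftyComponent (coord k w c) where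
  indec p := isIndec_X hw₀ hw₁ _ _
  injective p q := by
    rintro ⟨e⟩
    obtain ⟨h1, h2⟩ := eq_of_iso_X hw₁ e
    have hd : w - 1 ≠ 0 := by omega
    rw [sub_right_inj, mul_left_inj' hd] at h2
    exact Prod.ext (by omega) h1
  arrow_iff p q := (arArrow_X_iff hw₀ hw₁).trans (arrowRel_coord_iff hw₁ c p q)
  surjective := by
    -- Arrows change the degree i by 0 or -d, so its class modulo d is constant on a component, and
    -- `coord k w c` exhausts the class of c.
    have key : ∀ Y Z : SphericalCat k w, ARConnected Y Z →
        ((∃ q, Nonempty (Y ≅ coord k w c q)) ↔ ∃ q, Nonempty (Z ≅ coord k w c q)) := by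
      intro Y Z h
      induction h with
      | rel Y Z h =>
        rcases h with ⟨⟨e⟩⟩ | h
        · exact ⟨fun ⟨q, ⟨e'⟩⟩ => ⟨q, ⟨e.symm ≪≫ e'⟩⟩, fun ⟨q, ⟨e'⟩⟩ => ⟨q, ⟨e ≪≫ e'⟩⟩⟩
        · obtain ⟨r, i, ⟨e₁⟩⟩ := exists_iso_X hw₀ hw₁ h.1
          obtain ⟨s, j, ⟨e₂⟩⟩ := exists_iso_X hw₀ hw₁ h.2.1
          have hrel := (arArrow_X_iff hw₀ hw₁).1 (h.of_iso e₁ e₂)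
          have hco : ∀ (W : SphericalCat k w) (r : ℕ) (i : ℤ), (W ≅ X k w r i) →
              ((∃ q, Nonempty (W ≅ coord k w c q)) ↔ ∃ n : ℤ, i = c - n * (w - 1)) := by
            intro W r i e
            constructor
            · rintro ⟨q, ⟨e'⟩⟩
              exact ⟨_, (eq_of_iso_X hw₁ (e.symm ≪≫ e')).2⟩
            · rintro ⟨n, rfl⟩
              refine ⟨(n - r, r), ⟨e ≪≫ eqToIso ?_⟩⟩
              rw [coord]
              congr 2
              simp
          rw [hco _ _ _ e₁, hco _ _ _ e₂]
          rcases hrel with ⟨-, rfl⟩ | ⟨-, rfl⟩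
          · exact ⟨fun ⟨n, hn⟩ => ⟨n + 1, by rw [hn]; ring⟩,
              fun ⟨n, hn⟩ => ⟨n - 1, by rw [← sub_add_cancel i (w - 1), hn]; ring⟩⟩
          · rfl
      | refl Y => rfl
      | symm Y Z _ ih => exact ih.symm
      | trans Y Z W _ _ ih ih' => exact ih.trans ih'
    exact fun p Y _ h => (key _ _ h).1 ⟨p, ⟨Iso.refl _⟩⟩

/-! ### The rectangles in terms of lengths and degrees -/

/-- The coordinates of an object on any identification of its component with `ℤA_∞`. -/
lemma exists_coord (hw₀ : w ≠ 0) (hw₁ : w ≠ 1) {φ : ℤ × ℕ → SphericalCat k w}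
    (hφ : IsZAInftyComponent φ) {t u : SphericalCat k w} {p q : ℤ × ℕ} {r s : ℕ} {i j : ℤ}
    (e : t ≅ φ p) (e' : t ≅ X k w r i) (f : u ≅ φ q) (f' : u ≅ X k w s j) :
    r = p.2 ∧ s = q.2 ∧ j = i + (p.1 + p.2 - q.1 - q.2) * (w - 1) := by
  -- The base value is chosen such that X(r,i) has coordinates (0, r); the translation is then by
  -- -p.1.
  have e₀ : φ p ≅ coord k w (i + r * (w - 1)) (0, r) := e.symm ≪≫ e' ≪≫ eqToIso (by
    rw [coord]
    congr 1
    simp)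
  obtain ⟨a, ha⟩ := hφ.exists_translation (isZAInftyComponent_coord hw₀ hw₁ _) e₀
  obtain ⟨g⟩ := ha p.1 p.2
  obtain ⟨g'⟩ := ha q.1 q.2
  have h1 := (isZAInftyComponent_coord hw₀ hw₁ _).injective _ _ ⟨e₀.symm ≪≫ g⟩
  rw [Prod.mk.injEq] at h1
  obtain ⟨h2, h3⟩ := eq_of_iso_X hw₁ (f'.symm ≪≫ f ≪≫ g')
  refine ⟨h1.2, h2, ?_⟩
  rw [h3, h1.2, show a = -p.1 by omega]
  ring

/-- Here m is the number of arrows up. Each of them lowers the degree by d, while arrows down leave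
it unchanged. -/
lemma mem_FPlus_iff (hw₀ : w ≠ 0) (hw₁ : w ≠ 1) {t u : SphericalCat k w} {r s : ℕ} {i j : ℤ}
    (e : t ≅ X k w r i) (f : u ≅ X k w s j) :
    u ∈ FPlus t ↔ ∃ m : ℕ, i = j + m * (w - 1) ∧ m ≤ s ∧ s ≤ m + r := by
  constructor
  · rintro ⟨φ, hφ, p, q, ⟨e'⟩, ⟨f'⟩, l, m, hl, h1, h2⟩
    obtain ⟨rfl, rfl, rfl⟩ := exists_coord hw₀ hw₁ hφ e' e f' f
    refine ⟨m, ?_, by omega, by omega⟩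
    have : p.1 + p.2 - q.1 - q.2 = -(m : ℤ) := by omega
    rw [this]
    ring
  · rintro ⟨m, rfl, hm, hs⟩
    -- These coordinates place t at (0, r); then u is reached by m + r - s arrows down and m arrows
    -- up.
    refine ⟨coord k w (j + (m + r) * (w - 1)), isZAInftyComponent_coord hw₀ hw₁ _, (0, r),
      ((m : ℤ) + r - s, s), ⟨e ≪≫ eqToIso ?_⟩, ⟨f ≪≫ eqToIso ?_⟩, m + r - s, m, ?_, ?_, ?_⟩
    · rw [coord]
      congr 1
      simp only
      ring
    · rw [coord]
      congr 1
      simp only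
      ring
    · simp only
      omega
    · simp only
      omega
    · simp only
      omega

/-- Each of the l backward steps to the lower left raises the degree by d, while backward steps to
the upper left leave it unchanged. -/
lemma mem_FMinus_iff (hw₀ : w ≠ 0) (hw₁ : w ≠ 1) {t u : SphericalCat k w} {r s : ℕ} {i j : ℤ}
    (e : t ≅ X k w r i) (f : u ≅ X k w s j) :
    u ∈ FMinus t ↔ ∃ l : ℕ, j = i + l * (w - 1) ∧ l ≤ r ∧ r ≤ s + l := by
  constructor
  · rintro ⟨φ, hφ, p, q, ⟨e'⟩, ⟨f'⟩, l, m, hl, h1, h2⟩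
    obtain ⟨rfl, rfl, rfl⟩ := exists_coord hw₀ hw₁ hφ e' e f' f
    refine ⟨l, ?_, by omega, by omega⟩
    rw [show p.1 + p.2 - q.1 - q.2 = (l : ℤ) by omega]
  · rintro ⟨l, rfl, hl, hs⟩
    refine ⟨coord k w (i + r * (w - 1)), isZAInftyComponent_coord hw₀ hw₁ _, (0, r),
      ((r : ℤ) - s - l, s), ⟨e ≪≫ eqToIso ?_⟩, ⟨f ≪≫ eqToIso ?_⟩, l, s + l - r, ?_, ?_, ?_⟩
    · rw [coord]
      congr 1
      simp only
      ring
    · rw [coord]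
      congr 1
      simp only
      ring
    · simp only
      omega
    · simp only
      omega
    · simp only
      omega

/-! ### Suspension and dimensions of morphism spaces -/

/-- The suspension of `Σ ^ i (A / T ^ (r + 1))`. -/
lemma nonempty_susp_iso {t : SphericalCat k w} {r : ℕ} {i : ℤ} (e : t ≅ X k w r i) (n : ℤ) :
    Nonempty ((susp k w n).obj t ≅ X k w r (i + n)) := by
  have := isIso_proj_map (DGMod.isQis_cycShift (k := k) (d := w - 1) r i n)
  exact ⟨(susp k w n).mapIso e ≪≫ ObjectProperty.isoMk _
    (asIso ((DerCat.proj k (w - 1)).map (DGMod.cycShift k (w - 1) r i n))).symm⟩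

lemma mem_FPlus_union_FMinus_iff (hw₀ : w ≠ 0) (hw₁ : w ≠ 1) {t u : SphericalCat k w} {r s : ℕ}
    {i j : ℤ} (e : t ≅ X k w r i) (f : u ≅ X k w s j) :
    u ∈ FPlus t ∪ FMinus ((susp k w w).obj t) ↔ HomNonzero (w - 1) r i s j := by
  obtain ⟨e'⟩ := nonempty_susp_iso e w
  rw [Set.mem_union, mem_FPlus_iff hw₀ hw₁ e f, mem_FMinus_iff hw₀ hw₁ e' f, HomNonzero]
  -- The first clauses coincide. The second ones correspond under b = r - l, because i + w + rd = i
  -- + (r+1)d + 1.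
  refine or_congr_right ⟨?_, ?_⟩
  · rintro ⟨l, h, h1, h2⟩
    obtain ⟨b, rfl⟩ := Nat.exists_eq_add_of_le h1
    refine ⟨b, ?_, by omega, by omega⟩
    rw [h]
    push_cast
    ring
  · rintro ⟨b, h, h1, h2⟩
    obtain ⟨l, rfl⟩ := Nat.exists_eq_add_of_le h1
    refine ⟨l, ?_, by omega, by omega⟩
    push_cast at h
    linarith

lemma hom_eq_conj {C : Type*} [Category C] {t u t' u' : C} (e : t ≅ t') (f : u ≅ u') (g : t ⟶ u) :
    e.hom ≫ (e.inv ≫ g ≫ f.hom) ≫ f.inv = g := by simp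

lemma rank_hom_eq_one (hw₀ : w ≠ 0) (hw₁ : w ≠ 1) {t u : SphericalCat k w} {r s : ℕ}
    {i j : ℤ} (e : t ≅ X k w r i) (f : u ≅ X k w s j) (h : HomNonzero (w - 1) r i s j) :
    Module.rank k (t ⟶ u) = 1 := by
  obtain ⟨g₀, h0, hg⟩ := exists_generator_of_homNonzero (k := k) (d := w - 1) (by omega) (by omega) h
  rw [rank_eq_one_iff]
  let g₁ : X k w r i ⟶ X k w s j := ObjectProperty.homMk g₀
  refine ⟨e.hom ≫ g₁ ≫ f.inv, fun h1 => h0 ?_, fun g => ?_⟩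
  · have h2 : g₁ = 0 := by
      rw [← cancel_epi e.hom, ← cancel_mono f.inv, Category.assoc, h1, comp_zero, zero_comp]
    exact congrArg (fun f => f.hom) h2
  · obtain ⟨c, hc⟩ := hg (e.inv ≫ g ≫ f.hom).hom
    have hc' : c • g₁ = e.inv ≫ g ≫ f.hom := ObjectProperty.hom_ext _ hc
    refine ⟨c, ?_⟩
    rw [← Linear.comp_smul, ← Linear.smul_comp, hc', hom_eq_conj]

lemma rank_hom_eq_zero (hw₁ : w ≠ 1) {t u : SphericalCat k w} {r s : ℕ}
    {i j : ℤ} (e : t ≅ X k w r i) (f : u ≅ X k w s j) (h : ¬ HomNonzero (w - 1) r i s j) :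
    Module.rank k (t ⟶ u) = 0 := by
  rw [rank_zero_iff]
  have key : ∀ g : t ⟶ u, g = 0 := fun g => by
    have h1 : e.inv ≫ g ≫ f.hom = 0 := ObjectProperty.hom_ext _ (by
      by_contra h1
      exact h (homNonzero_of_ne_zero (k := k) (d := w - 1) (by omega) h1))
    rw [← hom_eq_conj e f g, h1, zero_comp, comp_zero]
  exact ⟨fun g g' => by rw [key g, key g']⟩

end SphericalCat

end

end SphericalAR

/-! ### The main theorem -/

theorem mainTheorem4 {k : Type u} [Field k] [IsAlgClosed k] (w : ℤ) (hw₀ : w ≠ 0) (hw₁ : w ≠ 1)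
    (t u : SphericalAR.SphericalCat k w)
    (ht : SphericalAR.IsIndec t) (hu : SphericalAR.IsIndec u) :
    (u ∈ SphericalAR.FPlus t ∪ SphericalAR.FMinus ((SphericalAR.SphericalCat.susp k w w).obj t) →
      Module.rank k (t ⟶ u) = 1) ∧
    (u ∉ SphericalAR.FPlus t ∪ SphericalAR.FMinus ((SphericalAR.SphericalCat.susp k w w).obj t) →
      Module.rank k (t ⟶ u) = 0) := by
  obtain ⟨r, i, ⟨e⟩⟩ := SphericalAR.SphericalCat.exists_iso_X hw₀ hw₁ ht
  obtain ⟨s, j, ⟨f⟩⟩ := SphericalAR.SphericalCat.exists_iso_X hw₀ hw₁ hu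
  rw [SphericalAR.SphericalCat.mem_FPlus_union_FMinus_iff hw₀ hw₁ e f]
  exact ⟨SphericalAR.SphericalCat.rank_hom_eq_one hw₀ hw₁ e f,
    SphericalAR.SphericalCat.rank_hom_eq_zero hw₁ e f⟩
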